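/- Let $d\in\mathbb N$, $\nu\in(0,1]$, let $\Sigma_0,Q\in\mathbb R^{d\times d}$ be symmetric positive definite, let $\rho_0$ and $\rho^*$ be the densities of $\mathcal N(0,\Sigma_0)$ and $\mathcal N(0,Q)$, and put $V=-\log\rho^*$. Let $K$ be one of the bilinear kernels $K_1(x,y)=x^\top y+1$ or $K_2(x,y)=(x-m)^\top(y-m)+1$, where $m$ is the mean of the current distribution $\rho_t$. For a probability measure $\rho$ write $\mathcal T_{K,\rho}f=\int K(\cdot,y)f(y)\,\rho(dy)$. Regularized SVGD (R-SVGD) is the equation $$\partial_t\rho_t=\nabla\cdot\Bigl(\rho_t\bigl((1-\nu)\mathcal T_{K,\rho_t}+\nu I\bigr)^{-1}\mathcal T_{K,\rho_t}\nabla\log\frac{\rho_t}{\rho^*}\Bigr),\qquad t\ge 0.\tag{1}$$ A classical solution is a curve of smooth positive probability densities on $\mathbb R^d$, $C^1$ in $(t,x)$ on $[0,\infty)\times\mathbb R^d$, continuous in the space $\mathcal P_V$ of probability measures integrating $V$ (with convergence of the integrals of all continuous functions of growth $O(1+|V|)$), for which $\mathcal T_{K,\rho_t}\nabla\log(\rho_t/\rho^*)$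 is defined by convergent integrals and (1) holds pointwise. A weak solution is a curve $t\mapsto\rho_t$ in $C([0,\infty),\mathcal P_V)$ that satisfies (1) against all test functions in $C_c^\infty([0,\infty)\times\mathbb R^d)$, with $\mathcal T_{K,\rho}\nabla\log(\rho/\rho^*)$ read as $x\mapsto\int\bigl(K(x,y)\nabla V(y)-\nabla_yK(x,y)\bigr)\rho(dy)$. In both cases $((1-\nu)\mathcal T_{K,\rho}+\nu I)^{-1}$ is the inverse on $L^2(\rho;\mathbb R^d)$. Then there is a curve $(\Sigma_t)_{t\ge0}$ of symmetric positive definite matrices, starting at $\Sigma_0$, with $$\dot\Sigma_t=2((1-\nu)\Sigma_t+\nu I)^{-1}\Sigma_t-((1-\nu)\Sigma_t+\nu I)^{-1}\Sigma_t^2Q^{-1}-Q^{-1}((1-\nu)\Sigma_t+\nu I)^{-1}\Sigma_t^2\qquad(t\ge0),$$ such that the density $\rho_t$ of $\mathcal N(0,\Sigma_t)$ is a classical and a weak solution of R-SVGD with initial value $\rho_0$, and it is the only classical solution and the only weak solution with this initial value. As $t\to\infty$, $\Sigma_t\to Q$ and $\rho_t$ converges weakly to $\rho^*$. If moreover $\Sigma_0Q=Q\Sigma_0$,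 then, in the spectral norm, $$\lVert\Sigma_t-Q\rVert=\mathcal O\bigl(e^{-2t/((1-\nu)\lambda+\nu)}\bigr)\qquad(t\to\infty),$$ where $\lambda$ is the largest eigenvalue of $Q$. -/

import Mathlib

open MeasureTheory ProbabilityTheory Filter Set
open scoped Topology ContDiff Matrix Matrix.Norms.L2Operator

noncomputable section

namespace RSVGD

/-- Euclidean space of dimension `d`. -/
abbrev Rd (d : ℕ) : Type := EuclideanSpace ℝ (Fin d)

variable {d : ℕ}

/-! ### Kernels and the kernelization operator

A kernel may depend on the current distribution, so it is a function of a measure and two points. -/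

/-- The simple bilinear kernel `K₁(x, y) = xᵀ y + 1`. -/
def bilinearKernel (_μ : Measure (Rd d)) (x y : Rd d) : ℝ := inner ℝ x y + 1

/-- The affine-invariant bilinear kernel `K₂(x, y) = (x - m)ᵀ (y - m) + 1`, where `m` is the mean
of the current distribution. -/
def affineInvariantKernel (μ : Measure (Rd d)) (x y : Rd d) : ℝ :=
  inner ℝ (x - ∫ z, z ∂μ) (y - ∫ z, z ∂μ) + 1

/-- The field `f` belongs to the domain of the kernelization operator. -/
def IsKernelizable (k : Rd d → Rd d → ℝ) (μ : Measure (Rd d)) (f : Rd d → Rd d) : Prop :=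
  ∀ x, Integrable (fun y => k x y • f y) μ

/-- The kernelization operator `(T f)(x) = ∫ k(x, y) f(y) dμ(y)`. -/
def kernelize (k : Rd d → Rd d → ℝ) (μ : Measure (Rd d)) (f : Rd d → Rd d) (x : Rd d) : Rd d :=
  ∫ y, k x y • f y ∂μ

/-- `Ψ = ((1 - ν) T + ν I)⁻¹ g`: the field `Ψ` is in `L²(μ)` and `((1 - ν) T + ν I) Ψ = g`. For
`0 < ν ≤ 1` and a positive semidefinite kernel, at most one `Ψ` has this property. -/
structure IsRegularizedInverse (ν : ℝ) (k : Rd d → Rd d → ℝ) (μ : Measure (Rd d))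
    (g Ψ : Rd d → Rd d) : Prop where
  memLp : MemLp Ψ 2 μ
  kernelizable : IsKernelizable k μ Ψ
  eq : ∀ x, (1 - ν) • kernelize k μ Ψ x + ν • Ψ x = g x

/-! ### The class of curves of probability measures -/

/-- A curve in `C([0, ∞), P_V)`, where `P_V` is the set of probability measures that integrate
`V`, with the topology of convergence of the integrals of all continuous functions of growth at
most `1 + |V|`. Values at negative times are irrelevant. -/
structure IsCurve (V : Rd d → ℝ) (μ : ℝ → Measure (Rd d)) : Prop where
  prob : ∀ t, 0 ≤ t → IsProbabilityMeasure (μ t)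
  integrable : ∀ t, 0 ≤ t → Integrable V (μ t)
  continuousOn : ∀ f : Rd d → ℝ, Continuous f → (∃ C : ℝ, ∀ x, |f x| ≤ C * (1 + |V x|)) →
    ContinuousOn (fun t => ∫ x, f x ∂(μ t)) (Ici 0)

/-- The measure with Lebesgue density `ρ`. -/
def densityMeasure (ρ : Rd d → ℝ) : Measure (Rd d) :=
  volume.withDensity (fun x => ENNReal.ofReal (ρ x))

/-- The potential `V = - log ρ⋆` of the target density `ρ⋆`. -/
def potential (ρstar : Rd d → ℝ) (x : Rd d) : ℝ := - Real.log (ρstar x)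

/-- The divergence of a vector field. -/
def divergence (F : Rd d → Rd d) (x : Rd d) : ℝ :=
  ∑ i : Fin d, (fderiv ℝ F x (EuclideanSpace.single i 1)) i

/-! ### Solutions of regularized SVGD -/

/-- `∇ log (ρ / ρ⋆)`, the gradient of the first variation of `KL(ρ ∥ ρ⋆)`. -/
def relativeScore (ρ ρstar : Rd d → ℝ) (x : Rd d) : Rd d :=
  gradient (fun y => Real.log (ρ y / ρstar y)) x

/-- A classical solution, on `[0, ∞)`, of
`∂ₜ ρₜ = ∇ · (ρₜ ((1 - ν) T + ν I)⁻¹ T ∇ log (ρₜ / ρ⋆))`, where `T` is the kernelization operator of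
the kernel `K` and of `ρₜ`; each `ρₜ` is a smooth positive probability density. -/
structure IsClassicalSolution (K : Measure (Rd d) → Rd d → Rd d → ℝ) (ν : ℝ)
    (ρstar : Rd d → ℝ) (ρ : ℝ → Rd d → ℝ) : Prop where
  smooth : ∀ t, 0 ≤ t → ContDiff ℝ ∞ (ρ t)
  pos : ∀ t, 0 ≤ t → ∀ x, 0 < ρ t x
  curve : IsCurve (potential ρstar) (fun t => densityMeasure (ρ t))
  contDiffOn : ContDiffOn ℝ 1 (fun p : ℝ × Rd d => ρ p.1 p.2) (Ici 0 ×ˢ univ)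
  kernelizable : ∀ t, 0 ≤ t → IsKernelizable (K (densityMeasure (ρ t))) (densityMeasure (ρ t))
    (relativeScore (ρ t) ρstar)
  equation : ∃ Ψ : ℝ → Rd d → Rd d,
    ∀ t, 0 ≤ t →
      IsRegularizedInverse ν (K (densityMeasure (ρ t))) (densityMeasure (ρ t))
        (kernelize (K (densityMeasure (ρ t))) (densityMeasure (ρ t)) (relativeScore (ρ t) ρstar))
        (Ψ t) ∧
      Differentiable ℝ (fun x => ρ t x • Ψ t x) ∧
      ∀ x, HasDerivWithinAt (fun s => ρ s x) (divergence (fun y => ρ t y • Ψ t y) x) (Ici 0) t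

/-- The integrand `y ↦ k(x, y) ∇V(y) - ∇_y k(x, y)`. -/
def steinIntegrand (k : Rd d → Rd d → ℝ) (V : Rd d → ℝ) (x y : Rd d) : Rd d :=
  k x y • gradient V y - gradient (fun z => k x z) y

/-- The kernelized relative score of a probability measure `μ` that need not have a density:
`∫ (k(x, y) ∇V(y) - ∇_y k(x, y)) dμ(y)`. When `μ` has a regular density `ρ`, an integration by parts
shows that it is `T ∇ log (ρ / ρ⋆)` for `V = - log ρ⋆`. -/
def kernelizedScore (k : Rd d → Rd d → ℝ) (V : Rd d → ℝ) (μ : Measure (Rd d)) (x : Rd d) : Rd d :=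
  ∫ y, steinIntegrand k V x y ∂μ

/-- A weak (measure-valued) solution of regularized SVGD on `[0, ∞)` for the potential `V`: a curve
in `C([0, ∞), P_V)` that solves `∂ₜ μₜ = ∇ · (μₜ Ψₜ)` against all smooth compactly supported test
functions on `[0, ∞) × ℝᵈ`, where `Ψₜ` is `((1 - ν) T + ν I)⁻¹` of the kernelized relative score
of `μₜ`. -/
structure IsWeakSolution (K : Measure (Rd d) → Rd d → Rd d → ℝ) (ν : ℝ)
    (V : Rd d → ℝ) (μ : ℝ → Measure (Rd d)) : Prop where
  curve : IsCurve V μ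
  integrable : ∀ t, 0 ≤ t → ∀ x, Integrable (steinIntegrand (K (μ t)) V x) (μ t)
  equation : ∃ Ψ : ℝ → Rd d → Rd d,
    (∀ t, 0 ≤ t → IsRegularizedInverse ν (K (μ t)) (μ t)
      (kernelizedScore (K (μ t)) V (μ t)) (Ψ t)) ∧
    ∀ φ : ℝ → Rd d → ℝ, ContDiff ℝ ∞ (fun p : ℝ × Rd d => φ p.1 p.2) →
      HasCompactSupport (fun p : ℝ × Rd d => φ p.1 p.2) →
      (∫ t in Ioi (0 : ℝ), ∫ x, (deriv (fun s => φ s x) t - inner ℝ (gradient (φ t) x) (Ψ t x))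
        ∂(μ t)) + ∫ x, φ 0 x ∂(μ 0) = 0

/-! ### Centered Gaussians and the covariance dynamics -/

/-- The density of the centered Gaussian with covariance matrix `S`. -/
def gaussianDensity (S : Matrix (Fin d) (Fin d) ℝ) (x : Rd d) : ℝ :=
  (Real.sqrt ((2 * Real.pi) ^ d * S.det))⁻¹ * Real.exp (-(x.ofLp ⬝ᵥ (S⁻¹ *ᵥ x.ofLp)) / 2)

/-- The centered Gaussian `N(0, S)` as a probability measure. -/
def gaussianLaw (S : Matrix (Fin d) (Fin d) ℝ) : ProbabilityMeasure (Rd d) :=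
  ⟨multivariateGaussian 0 S, inferInstance⟩

/-- The right-hand side of the covariance equation, with `R = ((1 - ν) S + ν I)⁻¹`:
`2 R S - R S² Q⁻¹ - Q⁻¹ R S²`. -/
def covarianceField (ν : ℝ) (Q S : Matrix (Fin d) (Fin d) ℝ) : Matrix (Fin d) (Fin d) ℝ :=
  (2 : ℝ) • (((1 - ν) • S + ν • (1 : Matrix (Fin d) (Fin d) ℝ))⁻¹ * S)
    - ((1 - ν) • S + ν • (1 : Matrix (Fin d) (Fin d) ℝ))⁻¹ * S ^ 2 * Q⁻¹
    - Q⁻¹ * ((1 - ν) • S + ν • (1 : Matrix (Fin d) (Fin d) ℝ))⁻¹ * S ^ 2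

end RSVGD

end

/-!
# Regularized SVGD with bilinear kernels between centered Gaussians

For a bilinear kernel the operator `T` has finite rank and takes values in the affine fields. If
`((1 - ν) T + ν) Ψ = g` and `g` is the kernelized score, which is affine when the target is
Gaussian, then `Ψ` is affine as well, with coefficients that are explicit functions of the mean and
the covariance matrix of the current law (`isRegularizedInverse_eq`). Every solution is therefore
transported by affine velocity fields. For a centered law with covariance `S` the field is
`Ψ x = A(S) x` with `A(S) = (Q⁻¹ S - 1) ((1 - ν) S + ν)⁻¹`, and the covariance equation reads
`S' = -(A(S) S + S A(S)ᵀ)`.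

*Existence.* The covariance curve is `S t = Φ t S₀ (Φ t)ᵀ`, where `Φ' = -A(S) Φ` and `Φ 0 = 1`. The
relative entropy `tr (Q⁻¹ S) - d - log det (Q⁻¹ S)` decreases along it and controls `‖S - Q‖`, which
gives global existence (`exists_flow`). Jacobi's formula for the derivative of a determinant turns
the covariance equation into the continuity equation for the Gaussian densities
(`isClassicalSolution_gaussian`).

*Uniqueness.* An integration by parts against the kernel and another one against test functions
show that classical solutions are weak (`IsClassicalSolution.isWeakSolution`). For a weak solution,
the equation extends to test functions of quadratic growth by cut-off. Hence the mean solves a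
linear homogeneous equation and stays zero, the second moments solve the covariance equation, which
has one solution, and so the velocity field is that of the Gaussian solution. Finally, if `ξ` solves
the adjoint equation `ξ' = Aᵀ ξ`, the integral of `exp (i ⟪ξ t, x⟫)` does not depend on time, so
that the characteristic function of the law at time `T` is that of the push-forward of the
initial law under `Φ T` (`IsAffineTransport.eq_map`, `IsWeakSolution.eq_gaussian`).

*Asymptotics.* The entropy dissipation vanishes only at `Q` and is bounded below on the compact
regions `a ≤ entropy ≤ b`, `a > 0`, so the entropy tends to zero (`tendsto_covariance`). If `S₀` and
`Q` commute, then so do `S t` and `Q`, and `D = S - Q` solves `D' = -2 D W` with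
`W = ((1 - ν) S + ν)⁻¹ S Q⁻¹`. The Lipschitz dependence of `W` on `S` bootstraps the decay of
`tr (D Dᵀ)`: first to some exponential rate, then to the rate given by the limit
`((1 - ν) Q + ν)⁻¹` of `W` (`isBigO_of_commute`).
-/

noncomputable section

namespace RSVGD

variable {d : ℕ}

/-! ### Global solutions of autonomous differential equations -/

/-- A bounded Lipschitz vector field has global integral curves: the boundedness makes the
Picard-Lindelöf interval arbitrarily long, and uniqueness glues the solutions. -/
theorem exists_global_integralCurve {E : Type*} [NormedAddCommGroup E] [NormedSpace ℝ E]
    [CompleteSpace E] {G : E → E} {K C : NNReal} (hL : LipschitzWith K G)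
    (hb : ∀ x, ‖G x‖ ≤ C) (x₀ : E) :
    ∃ f : ℝ → E, f 0 = x₀ ∧ ∀ t, HasDerivAt f (G (f t)) t := by
  have key : ∀ a : ℝ, ∃ f : ℝ → E, f 0 = x₀ ∧ ∀ t ∈ Ioo (-a) a, HasDerivAt f (G (f t)) t := by
    intro a
    rcases le_or_gt a 0 with ha | ha
    · exact ⟨fun _ => x₀, rfl, fun t ht => by
        have := ht.1; have := ht.2; linarith⟩
    · have h0 : (0 : ℝ) ∈ Icc (-a) a := ⟨by linarith, ha.le⟩
      have hp : IsPicardLindelof (fun _ => G) (⟨0, h0⟩ : Icc (-a) a) x₀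
          (C * a.toNNReal) 0 C K :=
        { lipschitzOnWith := fun _ _ => hL.lipschitzOnWith
          continuousOn := fun _ _ => continuousOn_const
          norm_le := fun _ _ x _ => hb x
          mul_max_le := by simp [ha.le] }
      obtain ⟨f, hf0, hf⟩ := hp.exists_eq_forall_mem_Icc_hasDerivWithinAt₀
      exact ⟨f, hf0, fun t ht => (hf t (Ioo_subset_Icc_self ht)).hasDerivAt
        (Icc_mem_nhds ht.1 ht.2)⟩
  choose f hf0 hf using key
  have huniq : ∀ {a b : ℝ}, 0 < a → a ≤ b → EqOn (f a) (f b) (Ioo (-a) a) := by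
    intro a b ha hab
    refine ODE_solution_unique_of_mem_Ioo (v := fun _ => G) (s := fun _ => univ) (K := K)
      (fun _ _ => hL.lipschitzOnWith) (t₀ := 0) ⟨by linarith, ha⟩
      (fun t ht => ⟨hf a t ht, trivial⟩) (fun t ht => ⟨hf b t ⟨by linarith [ht.1], by
        linarith [ht.2]⟩, trivial⟩) (by rw [hf0, hf0])
  refine ⟨fun t => f (|t| + 1) t, by simp [hf0], fun t => ?_⟩
  have hmem : t ∈ Ioo (-(|t| + 1)) (|t| + 1) := by
    rw [mem_Ioo, ← abs_lt]; exact lt_add_one _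
  refine (hf (|t| + 1) t hmem).congr_of_eventuallyEq ?_
  filter_upwards [Ioo_mem_nhds hmem.1 hmem.2] with s hs
  rcases le_total (|s| + 1) (|t| + 1) with h | h
  · exact huniq (by positivity) h (by rw [mem_Ioo, ← abs_lt]; exact lt_add_one _)
  · exact (huniq (by positivity) h hs).symm

/-! ### Calculus on matrices -/

/-- Square matrices of order `d`. -/
abbrev Mat (d : ℕ) : Type := Matrix (Fin d) (Fin d) ℝ

theorem contDiff_entry {n : WithTop ℕ∞} (i j : Fin d) : ContDiff ℝ n (fun A : Mat d => A i j) :=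
  (LinearMap.toContinuousLinearMap (Matrix.entryLinearMap ℝ ℝ i j : Mat d →ₗ[ℝ] ℝ)).contDiff

theorem contDiff_transpose {n : WithTop ℕ∞} : ContDiff ℝ n (fun A : Mat d => Aᵀ) :=
  (LinearMap.toContinuousLinearMap
    ((Matrix.transposeLinearEquiv (Fin d) (Fin d) ℝ ℝ).toLinearMap : Mat d →ₗ[ℝ] Mat d)).contDiff

theorem contDiff_trace {n : WithTop ℕ∞} : ContDiff ℝ n (fun A : Mat d => A.trace) :=
  (LinearMap.toContinuousLinearMap (Matrix.traceLinearMap (Fin d) ℝ ℝ : Mat d →ₗ[ℝ] ℝ)).contDiff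

theorem contDiff_det {n : WithTop ℕ∞} : ContDiff ℝ n (fun A : Mat d => A.det) := by
  simp only [Matrix.det_apply]
  refine ContDiff.sum fun σ _ => ContDiff.const_smul _ (contDiff_prod fun i _ => ?_)
  exact contDiff_entry _ _

theorem contDiffAt_matrix_inv {n : WithTop ℕ∞} {A : Mat d} (hA : A.det ≠ 0) :
    ContDiffAt ℝ n (fun B : Mat d => B⁻¹) A := by
  obtain ⟨u, rfl⟩ := (Matrix.isUnit_iff_isUnit_det A).2 (isUnit_iff_ne_zero.2 hA)
  have : (fun B : Mat d => B⁻¹) = Ring.inverse := by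
    ext1 B; exact Matrix.nonsing_inv_eq_ringInverse B
  rw [this]
  exact contDiffAt_ringInverse ℝ u

theorem hasDerivAt_transpose {f : ℝ → Mat d} {f' : Mat d} {t : ℝ} (h : HasDerivAt f f' t) :
    HasDerivAt (fun s => (f s)ᵀ) f'ᵀ t :=
  (LinearMap.toContinuousLinearMap ((Matrix.transposeLinearEquiv (Fin d) (Fin d) ℝ ℝ).toLinearMap :
    Mat d →ₗ[ℝ] Mat d)).hasFDerivAt.comp_hasDerivAt t h

theorem hasDerivAt_trace {f : ℝ → Mat d} {f' : Mat d} {t : ℝ} (h : HasDerivAt f f' t) :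
    HasDerivAt (fun s => (f s).trace) f'.trace t :=
  (LinearMap.toContinuousLinearMap
    (Matrix.traceLinearMap (Fin d) ℝ ℝ : Mat d →ₗ[ℝ] ℝ)).hasFDerivAt.comp_hasDerivAt t h

/-- Jacobi's formula. -/
theorem hasDerivAt_det {f : ℝ → Mat d} {f' : Mat d} {t : ℝ} (h : HasDerivAt f f' t)
    (hdet : (f t).det ≠ 0) :
    HasDerivAt (fun s => (f s).det) ((f t).det * ((f t)⁻¹ * f').trace) t := by
  have hd : DifferentiableAt ℝ (fun A : Mat d => A.det) (f t) :=
    (contDiff_det (n := 1)).contDiffAt.differentiableAt one_ne_zero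
  have h1 := hd.hasFDerivAt.comp_hasDerivAt t h
  suffices hL : fderiv ℝ (fun A : Mat d => A.det) (f t) f' = (f t).det * ((f t)⁻¹ * f').trace by
    rw [hL] at h1; exact h1
  -- the directional derivative at `f t` is read off from `det (1 + s M) = 1 + s tr M + O(s²)`
  have hline : HasDerivAt (fun s : ℝ => f t + s • f') f' 0 := by
    simpa using ((hasDerivAt_id (0 : ℝ)).smul_const f').const_add (f t)
  have h2 : HasDerivAt (fun s : ℝ => (f t + s • f').det)
      (fderiv ℝ (fun A : Mat d => A.det) (f t) f') 0 := by
    have hd0 : HasFDerivAt (fun A : Mat d => A.det) (fderiv ℝ (fun A : Mat d => A.det) (f t))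
        (f t + (0 : ℝ) • f') := by simpa using hd.hasFDerivAt
    exact hd0.comp_hasDerivAt 0 hline
  have h3 : (fun s : ℝ => (f t + s • f').det) = fun s : ℝ => (f t).det *
      (1 + ((f t)⁻¹ * f').trace * s + ((1 + (Polynomial.X : Polynomial ℝ) •
        ((f t)⁻¹ * f').map Polynomial.C).det).divX.divX.eval s * s ^ 2) := by
    funext s
    rw [← Matrix.det_one_add_smul, ← Matrix.det_mul]
    congr 1
    rw [mul_add, mul_one, mul_smul_comm, ← mul_assoc,
      Matrix.mul_nonsing_inv _ (isUnit_iff_ne_zero.2 hdet), one_mul]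
  rw [h3] at h2
  set p := ((1 + (Polynomial.X : Polynomial ℝ) • ((f t)⁻¹ * f').map Polynomial.C).det).divX.divX
  have h4 : HasDerivAt (fun s : ℝ => (f t).det *
      (1 + ((f t)⁻¹ * f').trace * s + p.eval s * s ^ 2)) ((f t).det * ((f t)⁻¹ * f').trace) 0 := by
    have h5 := ((((hasDerivAt_id (0 : ℝ)).const_mul ((f t)⁻¹ * f').trace).const_add 1).add
      ((p.hasDerivAt 0).mul (hasDerivAt_pow 2 (0 : ℝ)))).const_mul (f t).det
    simpa using h5
  exact h2.unique h4

/-- The derivative of the inverse matrix. -/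
theorem hasDerivAt_matrix_inv {f : ℝ → Mat d} {f' : Mat d} {t : ℝ} (h : HasDerivAt f f' t)
    (hdet : (f t).det ≠ 0) :
    HasDerivAt (fun s => (f s)⁻¹) (-((f t)⁻¹ * f' * (f t)⁻¹)) t := by
  have h1 : DifferentiableAt ℝ (fun s => (f s)⁻¹) t :=
    ((contDiffAt_matrix_inv (n := 1) hdet).differentiableAt one_ne_zero).comp t h.differentiableAt
  have h2 := h.mul h1.hasDerivAt
  have h3 : (fun s => f s * (f s)⁻¹) =ᶠ[𝓝 t] fun _ => 1 := by
    have hc : ContinuousAt (fun s => (f s).det) t :=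
      (contDiff_det (n := 0)).continuous.continuousAt.comp h.continuousAt
    filter_upwards [hc.eventually_ne hdet] with s hs
    exact Matrix.mul_nonsing_inv _ (isUnit_iff_ne_zero.2 hs)
  have h4 := h2.unique ((hasDerivAt_const t (1 : Mat d)).congr_of_eventuallyEq h3)
  have h5 : deriv (fun s => (f s)⁻¹) t = -((f t)⁻¹ * f' * (f t)⁻¹) := by
    have h6 := congrArg (fun X => (f t)⁻¹ * X) h4
    simp only [mul_add, mul_zero, ← mul_assoc,
      Matrix.nonsing_inv_mul _ (isUnit_iff_ne_zero.2 hdet), one_mul] at h6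
    exact eq_neg_of_add_eq_zero_right h6
  rw [← h5]; exact h1.hasDerivAt

/-! ### The covariance field -/

/-- The matrix `(1 - ν) S + ν I`. -/
def regMatrix (ν : ℝ) (S : Mat d) : Mat d := (1 - ν) • S + ν • (1 : Mat d)

/-- The matrix `A = (Q⁻¹ S - I) ((1 - ν) S + ν I)⁻¹`: for a centered law with second moment matrix
`S`, the regularized velocity field is `x ↦ A x`. -/
def drift (ν : ℝ) (Q S : Mat d) : Mat d := (Q⁻¹ * S - 1) * (regMatrix ν S)⁻¹

theorem regMatrix_posDef {ν : ℝ} (hν₀ : 0 < ν) (hν₁ : ν ≤ 1) {S : Mat d} (hS : S.PosSemidef) :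
    (regMatrix ν S).PosDef :=
  (Matrix.PosDef.one.smul hν₀).posSemidef_add (hS.smul (by linarith))

theorem regMatrix_det_ne_zero {ν : ℝ} (hν₀ : 0 < ν) (hν₁ : ν ≤ 1) {S : Mat d}
    (hS : S.PosSemidef) : (regMatrix ν S).det ≠ 0 :=
  (regMatrix_posDef hν₀ hν₁ hS).det_pos.ne'

theorem commute_regMatrix (ν : ℝ) (S : Mat d) : Commute (regMatrix ν S) S := by
  simp [Commute, SemiconjBy, regMatrix, add_mul, mul_add]

theorem commute_inv {A B : Mat d} (hA : A.det ≠ 0) (h : Commute A B) : Commute A⁻¹ B := by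
  have hu : IsUnit A.det := isUnit_iff_ne_zero.2 hA
  have h1 : A⁻¹ * (A * B) * A⁻¹ = A⁻¹ * (B * A) * A⁻¹ := by rw [h.eq]
  rw [← mul_assoc, Matrix.nonsing_inv_mul _ hu, one_mul, mul_assoc, mul_assoc,
    Matrix.mul_nonsing_inv _ hu, mul_one] at h1
  exact h1.symm

theorem symm_of_posSemidef {S : Mat d} (hS : S.PosSemidef) : Sᵀ = S := by
  simpa [Matrix.IsHermitian, Matrix.conjTranspose_eq_transpose_of_trivial] using hS.1

/-- The covariance equation is the one of a centered law transported by the field `x ↦ -A x`,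
`A = drift ν Q S`. -/
theorem covarianceField_eq {ν : ℝ} (hν₀ : 0 < ν) (hν₁ : ν ≤ 1) {Q S : Mat d} (hQ : Q.PosDef)
    (hS : S.PosSemidef) :
    covarianceField ν Q S = -(drift ν Q S * S + S * (drift ν Q S)ᵀ) := by
  have hc := (commute_inv (regMatrix_det_ne_zero hν₀ hν₁ hS) (commute_regMatrix ν S)).eq
  have hQt : (Q⁻¹)ᵀ = Q⁻¹ := symm_of_posSemidef hQ.inv.posSemidef
  have hRt : ((regMatrix ν S)⁻¹)ᵀ = (regMatrix ν S)⁻¹ :=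
    symm_of_posSemidef (regMatrix_posDef hν₀ hν₁ hS).inv.posSemidef
  have hSt := symm_of_posSemidef hS
  change (2 : ℝ) • ((regMatrix ν S)⁻¹ * S) - (regMatrix ν S)⁻¹ * S ^ 2 * Q⁻¹
    - Q⁻¹ * (regMatrix ν S)⁻¹ * S ^ 2 = _
  set R := (regMatrix ν S)⁻¹ with hR
  have e1 : drift ν Q S * S = Q⁻¹ * R * S ^ 2 - R * S := by
    rw [drift, ← hR, sub_mul, sub_mul, one_mul, pow_two]
    simp only [mul_assoc]
    rw [← mul_assoc S R S, ← hc, mul_assoc]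
  have e2 : S * (drift ν Q S)ᵀ = R * S ^ 2 * Q⁻¹ - R * S := by
    rw [drift, ← hR, Matrix.transpose_mul, Matrix.transpose_sub, Matrix.transpose_mul, hQt, hRt,
      hSt, Matrix.transpose_one, mul_sub, mul_sub, mul_one, pow_two, ← hc]
    simp only [← mul_assoc]
    rw [← hc]
  rw [e1, e2, two_smul]
  abel

/-! ### Relative entropy of Gaussians -/

/-- Twice the relative entropy of `N(0, S)` with respect to `N(0, Q)`. -/
def entropy (Q S : Mat d) : ℝ := (Q⁻¹ * S).trace - d - Real.log (Q⁻¹ * S).det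

/-- The rate at which the covariance flow dissipates `entropy`. -/
def dissipation (ν : ℝ) (Q S : Mat d) : ℝ :=
  2 * ((Q⁻¹ - S⁻¹) * (S * (regMatrix ν S)⁻¹ * S) * (Q⁻¹ - S⁻¹)).trace

theorem log_det_le {Y : Mat d} (hY : Y.PosDef) : Real.log Y.det ≤ Y.trace - d := by
  rw [hY.1.det_eq_prod_eigenvalues, hY.1.trace_eq_sum_eigenvalues]
  simp only [RCLike.ofReal_real_eq_id, id_eq]
  rw [Real.log_prod (fun i _ => (hY.eigenvalues_pos i).ne')]
  calc ∑ i, Real.log (hY.1.eigenvalues i) ≤ ∑ i, (hY.1.eigenvalues i - 1) :=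
        Finset.sum_le_sum fun i _ => Real.log_le_sub_one_of_pos (hY.eigenvalues_pos i)
    _ = _ := by simp

/-- The spectral norm is at most the Frobenius norm. -/
theorem norm_sq_le_trace (A : Mat d) : ‖A‖ ^ 2 ≤ (A * Aᵀ).trace := by
  have hn : 0 ≤ (A * Aᵀ).trace := by
    have := (Matrix.posSemidef_self_mul_conjTranspose A).trace_nonneg
    rwa [Matrix.conjTranspose_eq_transpose_of_trivial] at this
  rw [← Real.le_sqrt (norm_nonneg _) hn, Matrix.l2_opNorm_def]
  refine ContinuousLinearMap.opNorm_le_bound _ (Real.sqrt_nonneg _) fun x => ?_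
  have h1 : ‖(Matrix.toEuclideanLin (𝕜 := ℝ) A) x‖ ^ 2 ≤ (A * Aᵀ).trace * ‖x‖ ^ 2 := by
    rw [EuclideanSpace.real_norm_sq_eq, EuclideanSpace.real_norm_sq_eq, Matrix.trace,
      Finset.sum_mul]
    refine Finset.sum_le_sum fun i _ => ?_
    have := Finset.sum_mul_sq_le_sq_mul_sq Finset.univ (fun j => A i j) (fun j => x j)
    simpa [Matrix.mul_apply, Matrix.toLpLin_apply, Matrix.mulVec, dotProduct, pow_two] using this
  refine (sq_le_sq₀ (norm_nonneg _) (by positivity)).1 ?_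
  rw [mul_pow, Real.sq_sqrt hn]
  exact h1

open scoped MatrixOrder in
theorem exists_posDef_sqrt {S : Mat d} (hS : S.PosDef) : ∃ N : Mat d, N.PosDef ∧ N * N = S := by
  have h1 : CFC.sqrt S * CFC.sqrt S = S := CFC.sqrt_mul_sqrt_self _ hS.posSemidef.nonneg
  refine ⟨CFC.sqrt S, ?_, h1⟩
  have h2 : (CFC.sqrt S).PosSemidef := Matrix.nonneg_iff_posSemidef.1 (CFC.sqrt_nonneg S)
  refine h2.posDef_iff_det_ne_zero.2 fun h => hS.det_pos.ne' ?_
  rw [← h1, Matrix.det_mul, h, zero_mul]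

theorem conj_posDef {S L : Mat d} (hS : S.PosDef) (hL : L.det ≠ 0) : (L * S * Lᵀ).PosDef := by
  have := (Matrix.IsUnit.posDef_star_right_conjugate_iff (x := S)
    ((Matrix.isUnit_iff_isUnit_det L).2 (isUnit_iff_ne_zero.2 hL))).2 hS
  rwa [Matrix.star_eq_conjTranspose, Matrix.conjTranspose_eq_transpose_of_trivial] at this

/-- The entropy controls the distance to the target. With `Y` the square root of
`Q^(-1/2) S Q^(-1/2)`, the inequality `log det Y ≤ tr Y - d` shows that the entropy is at least
`tr (Y - 1)²`. -/
theorem exists_norm_sub_le_of_entropy {Q : Mat d} (hQ : Q.PosDef) :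
    ∃ C : ℝ, 0 ≤ C ∧ ∀ S : Mat d, S.PosDef → 0 ≤ entropy Q S ∧
      ‖S - Q‖ ≤ C * (entropy Q S + 2 * √(entropy Q S)) := by
  obtain ⟨L, hL, hLL⟩ := exists_posDef_sqrt hQ.inv
  have hLu : IsUnit L.det := isUnit_iff_ne_zero.2 hL.det_pos.ne'
  have hLt : Lᵀ = L := symm_of_posSemidef hL.posSemidef
  refine ⟨‖L⁻¹‖ * ‖L⁻¹‖, by positivity, fun S hS => ?_⟩
  have hX : (L * S * L).PosDef := by
    have := conj_posDef hS hL.det_pos.ne'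
    rwa [hLt] at this
  obtain ⟨Y, hY, hYY⟩ := exists_posDef_sqrt hX
  have hYt : Yᵀ = Y := symm_of_posSemidef hY.posSemidef
  have htr : (Q⁻¹ * S).trace = (Y * Y).trace := by
    rw [hYY, ← hLL, mul_assoc, Matrix.trace_mul_comm]
  have hdet : Real.log (Q⁻¹ * S).det = 2 * Real.log Y.det := by
    have : (Q⁻¹ * S).det = Y.det ^ 2 := by
      rw [pow_two, ← Matrix.det_mul, hYY, ← hLL]; simp only [Matrix.det_mul]; ring
    rw [this, Real.log_pow]; norm_num
  have hle : ‖Y - 1‖ ^ 2 ≤ entropy Q S := by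
    refine (norm_sq_le_trace _).trans ?_
    have h1 : ((Y - 1) * (Y - 1)ᵀ).trace = (Y * Y).trace - 2 * Y.trace + d := by
      rw [Matrix.transpose_sub, hYt, Matrix.transpose_one]
      simp [sub_mul, mul_sub]
      ring
    rw [h1, entropy, htr, hdet]
    linarith [log_det_le hY]
  have he : 0 ≤ entropy Q S := (sq_nonneg _).trans hle
  refine ⟨he, ?_⟩
  have hY1 : ‖Y - 1‖ ≤ √(entropy Q S) := Real.le_sqrt_of_sq_le hle
  have hQL : Q = L⁻¹ * L⁻¹ := by
    rw [← Matrix.mul_inv_rev, hLL, Matrix.nonsing_inv_nonsing_inv _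
      (isUnit_iff_ne_zero.2 hQ.det_pos.ne')]
  have hSQ : S - Q = L⁻¹ * ((Y - 1) * (Y - 1) + (2 : ℝ) • (Y - 1)) * L⁻¹ := by
    have h1 : (Y - 1) * (Y - 1) + (2 : ℝ) • (Y - 1) = L * S * L - 1 := by
      rw [← hYY, two_smul]; noncomm_ring
    rw [h1, mul_sub, sub_mul, mul_one, ← hQL, ← mul_assoc, ← mul_assoc,
      Matrix.nonsing_inv_mul _ hLu, one_mul, mul_assoc, Matrix.mul_nonsing_inv _ hLu, mul_one]
  rw [hSQ]
  calc _ ≤ ‖L⁻¹‖ * ‖(Y - 1) * (Y - 1) + (2 : ℝ) • (Y - 1)‖ * ‖L⁻¹‖ := norm_mul₃_le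
    _ ≤ ‖L⁻¹‖ * (‖Y - 1‖ ^ 2 + 2 * ‖Y - 1‖) * ‖L⁻¹‖ := by
        gcongr
        refine (norm_add_le _ _).trans (add_le_add ?_ ?_)
        · rw [pow_two]; exact norm_mul_le _ _
        · rw [norm_smul]; norm_num
    _ ≤ ‖L⁻¹‖ * (entropy Q S + 2 * √(entropy Q S)) * ‖L⁻¹‖ := by gcongr
    _ = _ := by ring

theorem hasDerivAt_entropy {Q : Mat d} (hQ : Q.PosDef) {S : ℝ → Mat d} {S' : Mat d} {t : ℝ}
    (h : HasDerivAt S S' t) (hS : (S t).PosDef) :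
    HasDerivAt (fun s => entropy Q (S s)) ((Q⁻¹ - (S t)⁻¹) * S').trace t := by
  have hQu : IsUnit (Q⁻¹).det := isUnit_iff_ne_zero.2 hQ.inv.det_pos.ne'
  have h1 : HasDerivAt (fun s => Q⁻¹ * S s) (Q⁻¹ * S') t := h.const_mul Q⁻¹
  have hd : (Q⁻¹ * S t).det ≠ 0 := by
    rw [Matrix.det_mul]; exact mul_ne_zero hQ.inv.det_pos.ne' hS.det_pos.ne'
  have h2 := ((hasDerivAt_trace h1).sub_const (d : ℝ)).sub ((hasDerivAt_det h1 hd).log hd)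
  refine h2.congr_deriv ?_
  rw [mul_div_cancel_left₀ _ hd, Matrix.mul_inv_rev, sub_mul, Matrix.trace_sub, mul_assoc,
    ← mul_assoc (Q⁻¹)⁻¹, Matrix.nonsing_inv_mul _ hQu, one_mul]

/-- Since `A = (Q⁻¹ - S⁻¹) S ((1 - ν) S + ν)⁻¹`, the entropy dissipation is a quadratic form in
`Q⁻¹ - S⁻¹`. -/
theorem drift_mul_self {ν : ℝ} {Q S : Mat d} (hS : S.det ≠ 0) :
    drift ν Q S * S = (Q⁻¹ - S⁻¹) * (S * (regMatrix ν S)⁻¹ * S) := by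
  have : S⁻¹ * S = 1 := Matrix.nonsing_inv_mul _ (isUnit_iff_ne_zero.2 hS)
  rw [drift, sub_mul (Q⁻¹), ← mul_assoc S⁻¹, ← mul_assoc S⁻¹, this]
  noncomm_ring

/-- The gradient of the entropy is `Q⁻¹ - S⁻¹`, so that this is its decay rate along the covariance
flow. -/
theorem trace_mul_field_eq {ν : ℝ} {Q S : Mat d} (hQ : Q.PosDef) (hS : S.PosDef) :
    ((Q⁻¹ - S⁻¹) * (drift ν Q S * S + S * (drift ν Q S)ᵀ)).trace = dissipation ν Q S := by
  have hSt := symm_of_posSemidef hS.posSemidef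
  have hBt : (Q⁻¹ - S⁻¹)ᵀ = Q⁻¹ - S⁻¹ := by
    rw [Matrix.transpose_sub, symm_of_posSemidef hQ.inv.posSemidef,
      symm_of_posSemidef hS.inv.posSemidef]
  have h1 : ((Q⁻¹ - S⁻¹) * (S * (drift ν Q S)ᵀ)).trace =
      ((Q⁻¹ - S⁻¹) * (drift ν Q S * S)).trace := by
    rw [← Matrix.trace_transpose, Matrix.transpose_mul, Matrix.transpose_mul, hBt, hSt,
      Matrix.transpose_transpose, Matrix.trace_mul_comm]
  rw [mul_add, Matrix.trace_add, h1, drift_mul_self hS.det_pos.ne', dissipation,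
    Matrix.trace_mul_comm]
  ring

theorem dissipation_nonneg {ν : ℝ} (hν₀ : 0 < ν) (hν₁ : ν ≤ 1) {Q S : Mat d} (hQ : Q.PosDef)
    (hS : S.PosDef) : 0 ≤ dissipation ν Q S ∧ (dissipation ν Q S = 0 → S = Q) := by
  have hSt := symm_of_posSemidef hS.posSemidef
  have hBt : (Q⁻¹ - S⁻¹)ᵀ = Q⁻¹ - S⁻¹ := by
    rw [Matrix.transpose_sub, symm_of_posSemidef hQ.inv.posSemidef,
      symm_of_posSemidef hS.inv.posSemidef]
  have hP : (S * (regMatrix ν S)⁻¹ * S).PosDef := by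
    have := conj_posDef (regMatrix_posDef hν₀ hν₁ hS.posSemidef).inv hS.det_pos.ne'
    rwa [hSt] at this
  obtain ⟨N, hN, hNN⟩ := exists_posDef_sqrt hP
  have hNt := symm_of_posSemidef hN.posSemidef
  have h1 : dissipation ν Q S = 2 * (((Q⁻¹ - S⁻¹) * N) * ((Q⁻¹ - S⁻¹) * N)ᴴ).trace := by
    rw [dissipation, Matrix.conjTranspose_eq_transpose_of_trivial, Matrix.transpose_mul, hNt, hBt,
      ← hNN]
    simp only [mul_assoc]
  refine ⟨?_, fun h => ?_⟩
  · rw [h1]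
    have := (Matrix.posSemidef_self_mul_conjTranspose ((Q⁻¹ - S⁻¹) * N)).trace_nonneg
    linarith
  · have h2 : (Q⁻¹ - S⁻¹) * N = 0 :=
      Matrix.trace_mul_conjTranspose_self_eq_zero_iff.1 (by linarith)
    have h3 : Q⁻¹ - S⁻¹ = 0 := by
      have := congrArg (· * N⁻¹) h2
      simpa [mul_assoc, Matrix.mul_nonsing_inv _ (isUnit_iff_ne_zero.2 hN.det_pos.ne')] using this
    have h4 := congrArg (·⁻¹) (sub_eq_zero.1 h3)
    simpa [Matrix.nonsing_inv_nonsing_inv _ (isUnit_iff_ne_zero.2 hS.det_pos.ne'),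
      Matrix.nonsing_inv_nonsing_inv _ (isUnit_iff_ne_zero.2 hQ.det_pos.ne')] using h4.symm

/-! ### The covariance flow -/

/-- A vector in the kernel of `Φ t` at one time would stay in the kernel, by uniqueness for linear
equations. -/
theorem det_ne_zero_of_linear_ode {B Φ : ℝ → Mat d} (hB : Continuous B)
    (h : ∀ t, HasDerivAt Φ (B t * Φ t) t) (h0 : (Φ 0).det ≠ 0) (t : ℝ) : (Φ t).det ≠ 0 := by
  intro ht
  obtain ⟨v, hv, hΦv⟩ := Matrix.exists_mulVec_eq_zero_iff.2 ht
  set N : Mat d := Matrix.vecMulVec v v with hN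
  have hN0 : Φ t * N = 0 := by rw [hN, Matrix.mul_vecMulVec, hΦv]; ext; simp [Matrix.vecMulVec]
  set a := -(|t| + 1)
  set b := |t| + 1
  have hmem : t ∈ Ioo a b := by rw [mem_Ioo, ← abs_lt]; exact lt_add_one _
  have hmem0 : (0 : ℝ) ∈ Ioo a b := by
    constructor <;> simp only [a, b] <;> linarith [abs_nonneg t]
  obtain ⟨K, hK⟩ := (isCompact_Icc (a := a) (b := b)).exists_bound_of_continuousOn hB.continuousOn
  have hW : EqOn (fun s => Φ s * N) (fun _ => 0) (Ioo a b) := by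
    refine ODE_solution_unique_of_mem_Ioo (v := fun s X => B s * X) (s := fun _ => univ)
      (K := K.toNNReal) (fun s hs => ?_) hmem
      (fun s _ => ⟨?_, trivial⟩) (fun s _ => ⟨?_, trivial⟩) hN0
    · refine (LipschitzWith.of_dist_le_mul fun X Y => ?_).lipschitzOnWith
      rw [dist_eq_norm, dist_eq_norm, ← mul_sub]
      refine (norm_mul_le _ _).trans ?_
      gcongr
      exact (hK s (Ioo_subset_Icc_self hs)).trans (Real.le_coe_toNNReal K)
    · have := (h s).mul_const N
      rwa [mul_assoc] at this
    · simpa using hasDerivAt_const s (0 : Mat d)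
  have h1 : Φ 0 * N = 0 := hW hmem0
  have h2 : N = 0 := by
    have := congrArg ((Φ 0)⁻¹ * ·) h1
    simpa [← mul_assoc, Matrix.nonsing_inv_mul _ (isUnit_iff_ne_zero.2 h0)] using this
  refine hv (funext fun i => ?_)
  have := congrFun (congrFun h2 i) i
  simpa [hN, Matrix.vecMulVec] using this

theorem contDiffAt_drift {n : WithTop ℕ∞} {ν : ℝ} (hν₀ : 0 < ν) (hν₁ : ν ≤ 1) (Q : Mat d)
    {S : Mat d} (hS : S.PosSemidef) : ContDiffAt ℝ n (drift ν Q) S := by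
  have h1 : ContDiffAt ℝ n (regMatrix (d := d) ν) S := by
    unfold regMatrix; fun_prop
  have h2 : ContDiffAt ℝ n (fun S : Mat d => (regMatrix ν S)⁻¹) S :=
    (contDiffAt_matrix_inv (regMatrix_det_ne_zero hν₀ hν₁ hS)).comp S h1
  unfold drift
  exact ((contDiffAt_const.mul contDiffAt_id).sub contDiffAt_const).mul h2

theorem conj_posSemidef {S : Mat d} (hS : S.PosSemidef) (L : Mat d) : (L * S * Lᵀ).PosSemidef := by
  have := hS.mul_mul_conjTranspose_same L
  rwa [Matrix.conjTranspose_eq_transpose_of_trivial] at this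

/-- The covariance curve is transported by a linear flow: `S t = Φ t S₀ (Φ t)ᵀ`, where
`Φ' = - A(S) Φ`. The vector field is cut off far away to get a global flow on `ℝ`; the entropy
is nonincreasing along the truncated flow as well, which confines it to a region, known in advance,
where nothing has been cut off. -/
theorem exists_flow {ν : ℝ} (hν₀ : 0 < ν) (hν₁ : ν ≤ 1) {Q S₀ : Mat d} (hQ : Q.PosDef)
    (hS₀ : S₀.PosDef) :
    ∃ Φ : ℝ → Mat d, Φ 0 = 1 ∧ ContDiff ℝ 1 Φ ∧ (∀ t, (Φ t).det ≠ 0) ∧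
      ∀ t, 0 ≤ t → HasDerivAt Φ (-(drift ν Q (Φ t * S₀ * (Φ t)ᵀ) * Φ t)) t := by
  obtain ⟨C, hC, hCS⟩ := exists_norm_sub_le_of_entropy hQ
  obtain ⟨N, hN, hNN⟩ := exists_posDef_sqrt hS₀
  have hNt := symm_of_posSemidef hN.posSemidef
  set e₀ := entropy Q S₀
  set b : ℝ := C * (e₀ + 2 * √e₀) + ‖Q‖
  -- a bound for the flow in terms of the a priori bound `b` for `S`, because `Φ = (Φ N) N⁻¹` and
  -- `‖Φ N‖² = ‖S‖`
  set R : ℝ := √b * ‖N⁻¹‖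
  have hR : 0 ≤ R := by positivity
  let χ : ContDiffBump (0 : Mat d) := ⟨R + 1, R + 2, by linarith, by linarith⟩
  let A : Mat d → Mat d := fun Φ => drift ν Q (Φ * S₀ * Φᵀ)
  have hA : ContDiff ℝ 1 A := by
    rw [contDiff_iff_contDiffAt]
    intro Φ
    have h1 : ContDiffAt ℝ 1 (fun Φ : Mat d => Φ * S₀ * Φᵀ) Φ :=
      ((contDiff_id.mul contDiff_const).mul contDiff_transpose).contDiffAt
    exact (contDiffAt_drift hν₀ hν₁ Q (conj_posSemidef hS₀.posSemidef Φ)).comp Φ h1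
  let G : Mat d → Mat d := fun Φ => χ Φ • (-(A Φ * Φ))
  have hG : ContDiff ℝ 1 G := χ.contDiff.smul (hA.mul contDiff_id).neg
  have hGs : HasCompactSupport G := χ.hasCompactSupport.smul_right
  obtain ⟨K, hK⟩ := hG.lipschitzWith_of_hasCompactSupport hGs (by simp)
  obtain ⟨c, hc⟩ := hGs.exists_bound_of_continuous hG.continuous
  obtain ⟨Φ, hΦ0, hΦ⟩ := exists_global_integralCurve (C := c.toNNReal) hK
    (fun x => (hc x).trans (Real.le_coe_toNNReal c)) (1 : Mat d)
  have hΦc : Continuous Φ := continuous_iff_continuousAt.2 fun t => (hΦ t).continuousAt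
  have hΦ1 : ContDiff ℝ 1 Φ := by
    rw [contDiff_one_iff_deriv]
    refine ⟨fun t => (hΦ t).differentiableAt, ?_⟩
    have : deriv Φ = fun t => G (Φ t) := funext fun t => (hΦ t).deriv
    rw [this]; exact hG.continuous.comp hΦc
  have hdet : ∀ t, (Φ t).det ≠ 0 := by
    refine det_ne_zero_of_linear_ode (B := fun t => -(χ (Φ t) • A (Φ t))) ?_ (fun t => ?_)
      (by simp [hΦ0])
    · exact ((χ.contDiff.continuous (n := 1).comp hΦc).smul (hA.continuous.comp hΦc)).neg
    · have := hΦ t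
      simpa [G] using this
  let S : ℝ → Mat d := fun t => Φ t * S₀ * (Φ t)ᵀ
  have hS : ∀ t, (S t).PosDef := fun t => conj_posDef hS₀ (hdet t)
  have hSd : ∀ t, HasDerivAt S
      (-(χ (Φ t) • (drift ν Q (S t) * S t + S t * (drift ν Q (S t))ᵀ))) t := by
    intro t
    have h1 := ((hΦ t).mul_const S₀).mul (hasDerivAt_transpose (hΦ t))
    refine h1.congr_deriv ?_
    simp only [G, A, S, Matrix.transpose_smul, Matrix.transpose_neg, Matrix.transpose_mul,
      smul_mul_assoc, mul_smul_comm, neg_mul, mul_neg, smul_add, mul_assoc, smul_neg,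
      neg_add]
  have hE : Antitone fun t => entropy Q (S t) := by
    refine antitone_of_hasDerivAt_nonpos (f' := fun t => -(χ (Φ t) * dissipation ν Q (S t)))
      (fun t => ?_) (fun t => ?_)
    · have := hasDerivAt_entropy hQ (hSd t) (hS t)
      rwa [mul_neg, mul_smul_comm, Matrix.trace_neg, Matrix.trace_smul,
        trace_mul_field_eq hQ (hS t), smul_eq_mul] at this
    · have := mul_nonneg (χ.nonneg (x := Φ t)) (dissipation_nonneg hν₀ hν₁ hQ (hS t)).1
      simpa using this
  refine ⟨Φ, hΦ0, hΦ1, hdet, fun t ht => ?_⟩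
  have he : entropy Q (S t) ≤ e₀ := by
    have := hE ht
    simpa [S, hΦ0] using this
  have hSb : ‖S t‖ ≤ b := by
    have h1 := (hCS (S t) (hS t)).2
    have h2 : ‖S t‖ ≤ ‖S t - Q‖ + ‖Q‖ := by simpa using norm_add_le (S t - Q) Q
    have h3 : C * (entropy Q (S t) + 2 * √(entropy Q (S t))) ≤ C * (e₀ + 2 * √e₀) := by gcongr
    linarith
  have hΦb : ‖Φ t‖ ≤ R := by
    have h1 : ‖Φ t * N‖ ≤ √b := by
      refine Real.le_sqrt_of_sq_le ?_
      rw [pow_two, ← CStarRing.norm_self_mul_star, Matrix.star_eq_conjTranspose,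
        Matrix.conjTranspose_eq_transpose_of_trivial, Matrix.transpose_mul, hNt, mul_assoc,
        ← mul_assoc N, hNN, ← mul_assoc]
      exact hSb
    have h2 : Φ t = Φ t * N * N⁻¹ := by
      rw [mul_assoc, Matrix.mul_nonsing_inv _ (isUnit_iff_ne_zero.2 hN.det_pos.ne'), mul_one]
    rw [h2]
    exact (norm_mul_le _ _).trans (mul_le_mul_of_nonneg_right h1 (norm_nonneg _))
  have hχ : χ (Φ t) = 1 := χ.one_of_mem_closedBall (by
    rw [mem_closedBall_zero_iff]; change ‖Φ t‖ ≤ R + 1; linarith)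
  have := hΦ t
  simpa [G, hχ] using this

/-! ### Uniqueness and convergence of the covariance flow -/

theorem contDiffAt_covarianceField {n : WithTop ℕ∞} {ν : ℝ} {Q S : Mat d}
    (hS : (regMatrix ν S).det ≠ 0) : ContDiffAt ℝ n (covarianceField ν Q) S := by
  have h1 : ContDiffAt ℝ n (regMatrix (d := d) ν) S := by
    unfold regMatrix; fun_prop
  have h2 : ContDiffAt ℝ n (fun S : Mat d => (regMatrix ν S)⁻¹) S :=
    (contDiffAt_matrix_inv hS).comp S h1
  have h3 : ContDiffAt ℝ n (fun S : Mat d => S ^ 2) S := contDiffAt_id.pow 2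
  exact (((h2.mul contDiffAt_id).const_smul (2 : ℝ)).sub ((h2.mul h3).mul contDiffAt_const)).sub
    ((contDiffAt_const.mul h2).mul h3)

/-- Uniqueness for autonomous equations whose field is `C¹` near the trajectories. -/
theorem ode_unique_of_contDiffAt {E : Type*} [NormedAddCommGroup E] [NormedSpace ℝ E]
    {v : E → E} {f g : ℝ → E}
    (hf : ∀ t, 0 ≤ t → HasDerivWithinAt f (v (f t)) (Ici 0) t)
    (hg : ∀ t, 0 ≤ t → HasDerivWithinAt g (v (g t)) (Ici 0) t)
    (hvf : ∀ t, 0 ≤ t → ContDiffAt ℝ 1 v (f t)) (hvg : ∀ t, 0 ≤ t → ContDiffAt ℝ 1 v (g t))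
    (h0 : f 0 = g 0) {T : ℝ} (hT : 0 ≤ T) : f T = g T := by
  have hfc : ContinuousOn f (Icc 0 T) := fun t ht =>
    (hf t ht.1).continuousWithinAt.mono Icc_subset_Ici_self
  have hgc : ContinuousOn g (Icc 0 T) := fun t ht =>
    (hg t ht.1).continuousWithinAt.mono Icc_subset_Ici_self
  set s := f '' Icc 0 T ∪ g '' Icc 0 T
  have hs : IsCompact s := (isCompact_Icc.image_of_continuousOn hfc).union
    (isCompact_Icc.image_of_continuousOn hgc)
  have hloc : LocallyLipschitzOn s v := by
    have key : ∀ x ∈ s, ContDiffAt ℝ 1 v x := by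
      rintro x (⟨t, ht, rfl⟩ | ⟨t, ht, rfl⟩)
      exacts [hvf t ht.1, hvg t ht.1]
    intro x hx
    obtain ⟨K, u, hu, hK⟩ := (key x hx).exists_lipschitzOnWith
    exact ⟨K, u, mem_nhdsWithin_of_mem_nhds hu, hK⟩
  obtain ⟨K, hK⟩ := hloc.exists_lipschitzOnWith_of_compact hs
  refine ODE_solution_unique_of_mem_Icc_right (v := fun _ => v) (s := fun _ => s) (K := K)
    (fun _ _ => hK) hfc (fun t ht => (hf t ht.1).mono (Ici_subset_Ici.2 ht.1))
    (fun t ht => Or.inl ⟨t, Ico_subset_Icc_self ht, rfl⟩) hgc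
    (fun t ht => (hg t ht.1).mono (Ici_subset_Ici.2 ht.1))
    (fun t ht => Or.inr ⟨t, Ico_subset_Icc_self ht, rfl⟩) h0 ⟨hT, le_rfl⟩

/-- The covariance equation has at most one positive semidefinite solution. -/
theorem covariance_unique {ν : ℝ} (hν₀ : 0 < ν) (hν₁ : ν ≤ 1) {Q : Mat d} {S T : ℝ → Mat d}
    (hS : ∀ t, 0 ≤ t → HasDerivWithinAt S (covarianceField ν Q (S t)) (Ici 0) t)
    (hT : ∀ t, 0 ≤ t → HasDerivWithinAt T (covarianceField ν Q (T t)) (Ici 0) t)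
    (hSp : ∀ t, 0 ≤ t → (S t).PosSemidef) (hTp : ∀ t, 0 ≤ t → (T t).PosSemidef)
    (h0 : S 0 = T 0) {t : ℝ} (ht : 0 ≤ t) : S t = T t :=
  ode_unique_of_contDiffAt hS hT
    (fun t ht => contDiffAt_covarianceField (regMatrix_det_ne_zero hν₀ hν₁ (hSp t ht)))
    (fun t ht => contDiffAt_covarianceField (regMatrix_det_ne_zero hν₀ hν₁ (hTp t ht))) h0 ht

theorem trace_inv_mul_nonneg {Q S : Mat d} (hQ : Q.PosDef) (hS : S.PosSemidef) :
    0 ≤ (Q⁻¹ * S).trace := by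
  obtain ⟨L, hL, hLL⟩ := exists_posDef_sqrt hQ.inv
  have hLt := symm_of_posSemidef hL.posSemidef
  have := (conj_posSemidef hS L).trace_nonneg
  rwa [hLt, mul_assoc, Matrix.trace_mul_comm, mul_assoc, hLL, Matrix.trace_mul_comm] at this

theorem isClosed_posSemidef : IsClosed {S : Mat d | S.PosSemidef} := by
  have : {S : Mat d | S.PosSemidef} =
      {S : Mat d | Sᵀ = S} ∩ ⋂ x : Fin d → ℝ, {S : Mat d | 0 ≤ x ⬝ᵥ (S *ᵥ x)} := by
    ext S
    simp [Matrix.posSemidef_iff_dotProduct_mulVec, Matrix.IsHermitian,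
      Matrix.conjTranspose_eq_transpose_of_trivial]
  rw [this]
  refine (isClosed_eq (contDiff_transpose (n := 0)).continuous continuous_id).inter
    (isClosed_iInter fun x => isClosed_le continuous_const ?_)
  fun_prop

theorem contDiffAt_entropy {n : WithTop ℕ∞} {Q S : Mat d} (hd : (Q⁻¹ * S).det ≠ 0) :
    ContDiffAt ℝ n (entropy Q) S := by
  have h1 : ContDiffAt ℝ n (fun S : Mat d => Q⁻¹ * S) S := contDiffAt_const.mul contDiffAt_id
  have h2 : ContDiffAt ℝ n (fun S : Mat d => (Q⁻¹ * S).trace) S :=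
    contDiff_trace.contDiffAt.comp S h1
  have h3 : ContDiffAt ℝ n (fun S : Mat d => (Q⁻¹ * S).det) S :=
    contDiff_det.contDiffAt.comp S h1
  exact (h2.sub contDiffAt_const).sub (h3.log hd)

theorem contDiffAt_dissipation {n : WithTop ℕ∞} {ν : ℝ} {Q S : Mat d} (hd : S.det ≠ 0)
    (hS : (regMatrix ν S).det ≠ 0) : ContDiffAt ℝ n (dissipation ν Q) S := by
  have h1 : ContDiffAt ℝ n (regMatrix (d := d) ν) S := by
    unfold regMatrix; fun_prop
  have h2 : ContDiffAt ℝ n (fun S : Mat d => (regMatrix ν S)⁻¹) S :=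
    (contDiffAt_matrix_inv hS).comp S h1
  have h3 : ContDiffAt ℝ n (fun S : Mat d => Q⁻¹ - S⁻¹) S :=
    contDiffAt_const.sub (contDiffAt_matrix_inv hd)
  exact contDiffAt_const.mul (contDiff_trace.contDiffAt.comp S
    ((h3.mul ((contDiffAt_id.mul h2).mul contDiffAt_id)).mul h3))

theorem entropy_self {Q : Mat d} (hQ : Q.PosDef) : entropy Q Q = 0 := by
  simp [entropy, Matrix.nonsing_inv_mul _ (isUnit_iff_ne_zero.2 hQ.det_pos.ne')]

/-- On the region `a ≤ entropy ≤ b`, `a > 0`, the dissipation is bounded below, because the region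
is compact. -/
theorem exists_dissipation_ge {ν : ℝ} (hν₀ : 0 < ν) (hν₁ : ν ≤ 1) {Q : Mat d} (hQ : Q.PosDef)
    {a b : ℝ} (ha : 0 < a) :
    ∃ η : ℝ, 0 < η ∧ ∀ S : Mat d, S.PosDef → a ≤ entropy Q S → entropy Q S ≤ b →
      η ≤ dissipation ν Q S := by
  obtain ⟨C, hC, hCS⟩ := exists_norm_sub_le_of_entropy hQ
  set B := C * (b + 2 * √b)
  -- a lower bound for `det (Q⁻¹ S)`, because `log det (Q⁻¹ S) = tr (Q⁻¹ S) - d - entropy ≥ -d - b`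
  set δ := Real.exp (-d - b)
  let K : Set (Mat d) := {S | S.PosSemidef} ∩ Metric.closedBall Q B ∩ {S | δ ≤ (Q⁻¹ * S).det}
  have hKc : IsCompact K := by
    have h1 : IsClosed {S : Mat d | δ ≤ (Q⁻¹ * S).det} :=
      isClosed_le continuous_const ((contDiff_det (n := 0)).continuous.comp
        (continuous_const.mul continuous_id))
    exact ((isCompact_closedBall Q B).inter_left isClosed_posSemidef).inter_right h1
  have hKd : ∀ S ∈ K, (Q⁻¹ * S).det ≠ 0 := fun S hS => ((Real.exp_pos _).trans_le hS.2).ne'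
  have hKp : ∀ S ∈ K, S.PosDef := fun S hS => hS.1.1.posDef_iff_det_ne_zero.2 fun h =>
    hKd S hS (by rw [Matrix.det_mul, h, mul_zero])
  have hF : ContinuousOn (entropy Q) K := fun S hS =>
    (contDiffAt_entropy (n := 0) (hKd S hS)).continuousAt.continuousWithinAt
  have hD : ContinuousOn (dissipation ν Q) K := fun S hS =>
    (contDiffAt_dissipation (n := 0) (hKp S hS).det_pos.ne'
      (regMatrix_det_ne_zero hν₀ hν₁ hS.1.1)).continuousAt.continuousWithinAt
  have hK' : IsCompact (K ∩ entropy Q ⁻¹' Ici a) :=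
    hKc.of_isClosed_subset (hF.preimage_isClosed_of_isClosed hKc.isClosed isClosed_Ici)
      inter_subset_left
  have hmem : ∀ S : Mat d, S.PosDef → a ≤ entropy Q S → entropy Q S ≤ b →
      S ∈ K ∩ entropy Q ⁻¹' Ici a := by
    intro S hS h1 h2
    have h3 := hCS S hS
    refine ⟨⟨⟨hS.posSemidef, ?_⟩, ?_⟩, h1⟩
    · rw [mem_closedBall_iff_norm]
      refine h3.2.trans ?_
      simp only [B]
      gcongr
    · have hpos : 0 < (Q⁻¹ * S).det := by
        rw [Matrix.det_mul]; exact mul_pos hQ.inv.det_pos hS.det_pos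
      change Real.exp (-d - b) ≤ _
      rw [← Real.le_log_iff_exp_le hpos]
      have := trace_inv_mul_nonneg hQ hS.posSemidef
      unfold entropy at h2
      linarith
  rcases (K ∩ entropy Q ⁻¹' Ici a).eq_empty_or_nonempty with he | hne
  · exact ⟨1, one_pos, fun S hS h1 h2 => absurd (hmem S hS h1 h2) (by simp [he])⟩
  · obtain ⟨S₁, hS₁, hmin⟩ := hK'.exists_isMinOn hne (hD.mono inter_subset_left)
    have hS₁' := dissipation_nonneg hν₀ hν₁ hQ (hKp S₁ hS₁.1)
    refine ⟨dissipation ν Q S₁, lt_of_le_of_ne hS₁'.1 fun h => ?_, fun S hS h1 h2 =>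
      hmin (hmem S hS h1 h2)⟩
    have h4 : a ≤ entropy Q S₁ := hS₁.2
    rw [hS₁'.2 h.symm, entropy_self hQ] at h4
    linarith

/-- The entropy tends to zero along the covariance flow, hence the flow tends to `Q`. -/
theorem tendsto_covariance {ν : ℝ} (hν₀ : 0 < ν) (hν₁ : ν ≤ 1) {Q : Mat d} (hQ : Q.PosDef)
    {S : ℝ → Mat d} (hSp : ∀ t, 0 ≤ t → (S t).PosDef)
    (hS : ∀ t, 0 ≤ t → HasDerivAt S (covarianceField ν Q (S t)) t) :
    Tendsto S atTop (𝓝 Q) := by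
  obtain ⟨C, hC, hCS⟩ := exists_norm_sub_le_of_entropy hQ
  have hE : ∀ t, 0 ≤ t → HasDerivAt (fun s => entropy Q (S s)) (-dissipation ν Q (S t)) t := by
    intro t ht
    have := hasDerivAt_entropy hQ (hS t ht) (hSp t ht)
    rwa [covarianceField_eq hν₀ hν₁ hQ (hSp t ht).posSemidef, mul_neg, Matrix.trace_neg,
      trace_mul_field_eq hQ (hSp t ht)] at this
  have hmv : ∀ η : ℝ, (∀ t, 0 ≤ t → η ≤ dissipation ν Q (S t)) → ∀ s t, 0 ≤ s → s ≤ t →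
      entropy Q (S t) - entropy Q (S s) ≤ -η * (t - s) := by
    intro η h s t hs hst
    refine (convex_Ici (0 : ℝ)).image_sub_le_mul_sub_of_deriv_le
      (fun x hx => (hE x hx).continuousAt.continuousWithinAt)
      (fun x hx => ?_) (fun x hx => ?_) s hs t (hs.trans hst) hst
    · exact (hE x (interior_subset hx)).differentiableAt.differentiableWithinAt
    · rw [(hE x (interior_subset hx)).deriv]
      linarith [h x (interior_subset hx)]
  have hanti : ∀ s t, 0 ≤ s → s ≤ t → entropy Q (S t) ≤ entropy Q (S s) := by
    intro s t hs hst
    have := hmv 0 (fun t ht => (dissipation_nonneg hν₀ hν₁ hQ (hSp t ht)).1) s t hs hst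
    linarith
  have hlim : Tendsto (fun t => entropy Q (S t)) atTop (𝓝 0) := by
    rw [Metric.tendsto_atTop]
    intro ε hε
    obtain ⟨T, hT, hTε⟩ : ∃ T, 0 ≤ T ∧ entropy Q (S T) < ε := by
      by_contra! hcon
      obtain ⟨η, hη, hηS⟩ := exists_dissipation_ge hν₀ hν₁ hQ (b := entropy Q (S 0)) hε
      have h1 := hmv η (fun t ht => hηS _ (hSp t ht) (hcon t ht) (hanti 0 t le_rfl ht)) 0
        (entropy Q (S 0) / η) le_rfl (div_nonneg (hCS _ (hSp 0 le_rfl)).1 hη.le)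
      have h2 := hcon (entropy Q (S 0) / η) (div_nonneg (hCS _ (hSp 0 le_rfl)).1 hη.le)
      have h3 : -η * (entropy Q (S 0) / η - 0) = -entropy Q (S 0) := by field_simp; ring
      linarith
    refine ⟨T, fun t ht => ?_⟩
    rw [Real.dist_eq, sub_zero, abs_of_nonneg (hCS _ (hSp t (hT.trans ht))).1]
    exact (hanti T t hT ht).trans_lt hTε
  rw [tendsto_iff_norm_sub_tendsto_zero]
  refine squeeze_zero' (Eventually.of_forall fun _ => norm_nonneg _)
    ((eventually_ge_atTop 0).mono fun t ht => (hCS _ (hSp t ht)).2) ?_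
  have := ((hlim.add ((Real.continuous_sqrt.tendsto 0 |>.comp hlim).const_mul 2)).const_mul C)
  simpa using this

/-! ### Rate of convergence in the commuting case -/

/-- Conjugation by `Q` maps solutions of the covariance equation to solutions, so a solution that
commutes with `Q` at time zero does so forever. -/
theorem commute_of_commute_zero {ν : ℝ} (hν₀ : 0 < ν) (hν₁ : ν ≤ 1) {Q : Mat d} (hQ : Q.PosDef)
    {S : ℝ → Mat d} (hSp : ∀ t, 0 ≤ t → (S t).PosSemidef)
    (hS : ∀ t, 0 ≤ t → HasDerivWithinAt S (covarianceField ν Q (S t)) (Ici 0) t)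
    (h0 : Commute (S 0) Q) {t : ℝ} (ht : 0 ≤ t) : Commute (S t) Q := by
  have hu : IsUnit Q.det := isUnit_iff_ne_zero.2 hQ.det_pos.ne'
  have hQQ : Q⁻¹ * Q = 1 := Matrix.nonsing_inv_mul _ hu
  have hQQ' : Q * Q⁻¹ = 1 := Matrix.mul_nonsing_inv _ hu
  have hcancel : ∀ X : Mat d, Q⁻¹ * (Q * X) = X := fun X => by rw [← mul_assoc, hQQ, one_mul]
  have hcancel' : ∀ X : Mat d, Q * (Q⁻¹ * X) = X := fun X => by rw [← mul_assoc, hQQ', one_mul]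
  have hreg : ∀ X : Mat d, regMatrix ν (Q * X * Q⁻¹) = Q * regMatrix ν X * Q⁻¹ := by
    intro X
    simp only [regMatrix, mul_add, add_mul, mul_smul_comm, smul_mul_assoc, mul_one, hQQ']
  have hregi : ∀ X : Mat d, (regMatrix ν (Q * X * Q⁻¹))⁻¹ = Q * (regMatrix ν X)⁻¹ * Q⁻¹ := by
    intro X
    rw [hreg, Matrix.mul_inv_rev, Matrix.mul_inv_rev, Matrix.nonsing_inv_nonsing_inv _ hu,
      mul_assoc]
  have hfield : ∀ X : Mat d,
      covarianceField ν Q (Q * X * Q⁻¹) = Q * covarianceField ν Q X * Q⁻¹ := by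
    intro X
    have := hregi X
    unfold regMatrix at this
    unfold covarianceField
    rw [this]
    simp only [pow_two, mul_sub, sub_mul, mul_smul_comm, smul_mul_assoc, mul_assoc, hcancel,
      hcancel']
  have key : S t = Q * S t * Q⁻¹ := by
    refine ode_unique_of_contDiffAt (v := covarianceField ν Q) (f := S)
      (g := fun t => Q * S t * Q⁻¹) hS (fun t ht => ?_)
      (fun t ht => contDiffAt_covarianceField (regMatrix_det_ne_zero hν₀ hν₁ (hSp t ht)))
      (fun t ht => contDiffAt_covarianceField ?_) ?_ ht
    · rw [hfield]
      exact ((hS t ht).const_mul Q).mul_const Q⁻¹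
    · rw [hreg, Matrix.det_mul, Matrix.det_mul]
      exact mul_ne_zero (mul_ne_zero hQ.det_pos.ne' (regMatrix_det_ne_zero hν₀ hν₁ (hSp t ht)))
        hQ.inv.det_pos.ne'
    · rw [← h0.eq, mul_assoc, hQQ', mul_one]
  calc S t * Q = Q * S t * Q⁻¹ * Q := by rw [← key]
    _ = Q * S t := by rw [mul_assoc, hQQ, mul_one]

/-- The trace is the sum over the rows `r` of `D` of `⟪E r, r⟫`. -/
theorem trace_mul_mul_le (E D : Mat d) : (D * E * Dᵀ).trace ≤ ‖E‖ * (D * Dᵀ).trace := by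
  have hrow : ∀ i, (D * E * Dᵀ) i i = inner ℝ (Matrix.toEuclideanLin (𝕜 := ℝ) E
      (WithLp.toLp 2 (D i))) (WithLp.toLp 2 (D i)) := by
    intro i
    simp only [PiLp.inner_apply, Matrix.toLpLin_apply, Matrix.mul_apply, Matrix.mulVec, dotProduct,
      Matrix.transpose_apply]
    simp only [RCLike.inner_apply, conj_trivial, Finset.sum_mul, Finset.mul_sum]
    rw [Finset.sum_comm]
    refine Finset.sum_congr rfl fun j _ => Finset.sum_congr rfl fun k _ => by ring
  have hrow' : ∀ i, (D * Dᵀ) i i = ‖(WithLp.toLp 2 (D i) : EuclideanSpace ℝ (Fin d))‖ ^ 2 := by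
    intro i
    rw [EuclideanSpace.real_norm_sq_eq]
    simp [Matrix.mul_apply, pow_two]
  rw [Matrix.trace, Matrix.trace, Finset.mul_sum]
  refine Finset.sum_le_sum fun i _ => ?_
  rw [Matrix.diag_apply, Matrix.diag_apply, hrow, hrow']
  refine (real_inner_le_norm _ _).trans ?_
  rw [pow_two, ← mul_assoc]
  gcongr
  exact Matrix.l2_opNorm_mulVec E (WithLp.toLp 2 (D i))

/-- If `lam` is the largest eigenvalue of `Q`, then `((1 - ν) Q + ν)⁻¹ ≥ ((1 - ν) lam + ν)⁻¹`. -/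
theorem trace_inv_regMatrix_ge {ν : ℝ} (hν₀ : 0 < ν) (hν₁ : ν ≤ 1) {Q : Mat d} (hQ : Q.PosDef)
    {lam : ℝ} (hlam : lam ∈ upperBounds {l : ℝ | Module.End.HasEigenvalue (Matrix.toLin' Q) l})
    (D : Mat d) :
    (D * Dᵀ).trace ≤ ((1 - ν) * lam + ν) * (D * (regMatrix ν Q)⁻¹ * Dᵀ).trace := by
  have h1 : (lam • (1 : Mat d) - Q).PosSemidef := by
    rw [Matrix.posSemidef_iff_isHermitian_and_spectrum_nonneg]
    refine ⟨(Matrix.isHermitian_one.smul (IsSelfAdjoint.all lam)).sub hQ.1, fun x hx => ?_⟩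
    rw [← Algebra.algebraMap_eq_smul_one, ← spectrum.singleton_sub_eq] at hx
    obtain ⟨y, hy, z, hz, rfl⟩ := Set.mem_sub.1 hx
    rw [Set.mem_singleton_iff] at hy
    subst hy
    have : z ≤ y := hlam (by
      rw [mem_ofPred_eq, Module.End.hasEigenvalue_iff_mem_spectrum, Matrix.spectrum_toLin']
      exact hz)
    simpa using this
  have hR := (regMatrix_posDef hν₀ hν₁ hQ.posSemidef)
  obtain ⟨N, hN, hNN⟩ := exists_posDef_sqrt hR.inv
  have hNt := symm_of_posSemidef hN.posSemidef
  have h2 : N * regMatrix ν Q * N = 1 := by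
    have hu : IsUnit N.det := isUnit_iff_ne_zero.2 hN.det_pos.ne'
    have h3 : regMatrix ν Q = N⁻¹ * N⁻¹ := by
      rw [← Matrix.mul_inv_rev, hNN, Matrix.nonsing_inv_nonsing_inv _
        (isUnit_iff_ne_zero.2 hR.det_pos.ne')]
    rw [h3, ← mul_assoc, Matrix.mul_nonsing_inv _ hu, one_mul, Matrix.nonsing_inv_mul _ hu]
  have h4 : ((1 - ν) * lam + ν) • (regMatrix ν Q)⁻¹ - 1 =
      N * ((1 - ν) • (lam • (1 : Mat d) - Q)) * Nᵀ := by
    have h5 : (1 - ν) • (lam • (1 : Mat d) - Q) =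
        ((1 - ν) * lam + ν) • (1 : Mat d) - regMatrix ν Q := by
      rw [regMatrix, smul_sub, smul_smul, add_smul]; abel
    rw [h5, hNt, mul_sub N, sub_mul (N * _), h2, mul_smul_comm, mul_one, smul_mul_assoc, hNN]
  have h6 := (conj_posSemidef (conj_posSemidef
    (h1.smul (by linarith : 0 ≤ 1 - ν)) N) D).trace_nonneg
  rw [← h4, mul_sub, sub_mul, mul_one, mul_smul_comm, smul_mul_assoc, Matrix.trace_sub,
    Matrix.trace_smul, smul_eq_mul] at h6
  linarith

/-- A form of Grönwall's inequality: `f e^a` is nonincreasing if `f' ≤ -a' f`. -/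
theorem mul_exp_le_mul_exp {f f' a a' : ℝ → ℝ} {T : ℝ} (hf : ∀ t, T ≤ t → HasDerivAt f (f' t) t)
    (ha : ∀ t, T ≤ t → HasDerivAt a (a' t) t) (h : ∀ t, T ≤ t → f' t ≤ -a' t * f t) {t : ℝ}
    (ht : T ≤ t) : f t * Real.exp (a t) ≤ f T * Real.exp (a T) := by
  have hd : ∀ t, T ≤ t → HasDerivAt (fun t => f t * Real.exp (a t))
      (f' t * Real.exp (a t) + f t * (Real.exp (a t) * a' t)) t := fun t ht =>
    (hf t ht).mul (ha t ht).exp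
  have := (convex_Ici T).image_sub_le_mul_sub_of_deriv_le
      (f := fun t => f t * Real.exp (a t)) (C := 0)
      (fun x hx => (hd x hx).continuousAt.continuousWithinAt)
      (fun x hx => ((hd x (interior_subset hx)).differentiableAt.differentiableWithinAt))
      (fun x hx => by
        rw [(hd x (interior_subset hx)).deriv]
        nlinarith [h x (interior_subset hx), Real.exp_pos (a x)]) T self_mem_Ici t ht ht
  linarith

/-- The scalar bootstrap behind the sharp rate: the perturbation `K √f` of the linear rate is
integrable, since a first, weaker application of the inequality makes `√f` decay exponentially. -/
theorem isBigO_exp_of_deriv_le {f f' : ℝ → ℝ} {κ K T : ℝ} (hκ : 0 < κ) (hK : 0 ≤ K)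
    (hf0 : ∀ t, T ≤ t → 0 ≤ f t) (hf : ∀ t, T ≤ t → HasDerivAt f (f' t) t)
    (hlim : Tendsto f atTop (𝓝 0))
    (h : ∀ t, T ≤ t → f' t ≤ -(4 / κ - 4 * K * √(f t)) * f t) :
    ∃ C T', ∀ t, T' ≤ t → √(f t) ≤ C * Real.exp (-2 * t / κ) := by
  have hsl : Tendsto (fun t => √(f t)) atTop (𝓝 0) := by
    have := (Real.continuous_sqrt.tendsto 0).comp hlim
    rwa [Real.sqrt_zero] at this
  have hev : ∀ᶠ t in atTop, 4 * K * √(f t) ≤ 2 / κ := by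
    have h1 : Tendsto (fun t => 4 * K * √(f t)) atTop (𝓝 0) := by simpa using hsl.const_mul (4 * K)
    exact (h1.eventually_lt_const (by positivity)).mono fun t ht => ht.le
  obtain ⟨T₁, hT₁⟩ := eventually_atTop.1 hev
  set T₂ := max T T₁
  have hT : ∀ t, T₂ ≤ t → T ≤ t := fun t ht => (le_max_left _ _).trans ht
  -- first decay estimate, with half of the rate
  set M := √(f T₂ * Real.exp (2 / κ * T₂))
  have h1 : ∀ t, T₂ ≤ t → √(f t) ≤ M * Real.exp (-(1 / κ * t)) := by
    intro t ht
    have h2 := mul_exp_le_mul_exp (a := fun t => 2 / κ * t) (a' := fun _ => 2 / κ)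
      (fun t ht => hf t (hT t ht))
      (fun t _ => by simpa using (hasDerivAt_id t).const_mul (2 / κ))
      (fun t ht => (h t (hT t ht)).trans (by
        have h3 := hf0 t (hT t ht)
        have h4 := hT₁ t ((le_max_right _ _).trans ht)
        have h5 : 4 / κ = 2 / κ + 2 / κ := by ring
        nlinarith)) ht
    have h3 : f t ≤ f T₂ * Real.exp (2 / κ * T₂) * Real.exp (-(2 / κ * t)) := by
      rw [Real.exp_neg, ← div_eq_mul_inv, le_div_iff₀ (Real.exp_pos _)]
      exact h2
    have h4 : Real.exp (-(1 / κ * t)) = √(Real.exp (-(2 / κ * t))) := by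
      rw [← Real.exp_half]; congr 1; ring
    rw [h4, ← Real.sqrt_mul (mul_nonneg (hf0 _ (hT _ le_rfl)) (Real.exp_pos _).le)]
    exact Real.sqrt_le_sqrt h3
  have hM : 0 ≤ M := Real.sqrt_nonneg _
  set a : ℝ → ℝ := fun t => 4 / κ * t + 4 * K * M * κ * Real.exp (-(1 / κ * t))
  have ha : ∀ t, HasDerivAt a (4 / κ - 4 * K * M * Real.exp (-(1 / κ * t))) t := by
    intro t
    have h2 : HasDerivAt (fun t : ℝ => -(1 / κ * t)) (-(1 / κ * 1)) t :=
      ((hasDerivAt_id t).const_mul (1 / κ)).neg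
    have h3 := ((hasDerivAt_id t).const_mul (4 / κ)).add (h2.exp.const_mul (4 * K * M * κ))
    refine h3.congr_deriv ?_
    field_simp
    ring
  set C := √(f T₂ * Real.exp (a T₂))
  refine ⟨C, T₂, fun t ht => ?_⟩
  have h2 := mul_exp_le_mul_exp (fun t ht => hf t (hT t ht)) (fun t _ => ha t)
    (fun t ht => (h t (hT t ht)).trans (by
      have h3 := hf0 t (hT t ht)
      have h4 := mul_le_mul_of_nonneg_left (h1 t ht) hK
      nlinarith)) ht
  have h3 : f t ≤ f T₂ * Real.exp (a T₂) * Real.exp (-(4 / κ * t)) := by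
    rw [Real.exp_neg, ← div_eq_mul_inv, le_div_iff₀ (Real.exp_pos _)]
    refine le_trans ?_ h2
    refine mul_le_mul_of_nonneg_left (Real.exp_le_exp.2 ?_) (hf0 t (hT t ht))
    simp only [a]
    have : 0 ≤ 4 * K * M * κ * Real.exp (-(1 / κ * t)) := by positivity
    linarith
  have h4 : Real.exp (-2 * t / κ) = √(Real.exp (-(4 / κ * t))) := by
    rw [← Real.exp_half]; congr 1; ring
  rw [h4, ← Real.sqrt_mul (mul_nonneg (hf0 _ (hT _ le_rfl)) (Real.exp_pos _).le)]
  exact Real.sqrt_le_sqrt h3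

/-- In the commuting case `D = S - Q` satisfies `D' = - 2 W D` with
`W = ((1 - ν) S + ν)⁻¹ S Q⁻¹`, which tends to `((1 - ν) Q + ν)⁻¹`. -/
theorem isBigO_of_commute {ν : ℝ} (hν₀ : 0 < ν) (hν₁ : ν ≤ 1) {Q : Mat d} (hQ : Q.PosDef)
    {S : ℝ → Mat d} (hSp : ∀ t, 0 ≤ t → (S t).PosDef)
    (hS : ∀ t, 0 ≤ t → HasDerivAt S (covarianceField ν Q (S t)) t)
    (h0 : Commute (S 0) Q) {lam : ℝ}
    (hlam : IsGreatest {l : ℝ | Module.End.HasEigenvalue (Matrix.toLin' Q) l} lam) :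
    (fun t => ‖S t - Q‖) =O[atTop] (fun t => Real.exp (-2 * t / ((1 - ν) * lam + ν))) := by
  have hlim := tendsto_covariance hν₀ hν₁ hQ hSp hS
  have hlampos : 0 < lam := by
    have h1 := hlam.1
    rw [mem_ofPred_eq, Module.End.hasEigenvalue_iff_mem_spectrum, Matrix.spectrum_toLin'] at h1
    have h2 : 0 ≤ lam := (Matrix.posSemidef_iff_isHermitian_and_spectrum_nonneg.1
      hQ.posSemidef).2 h1
    refine lt_of_le_of_ne h2 fun h => ?_
    rw [← h, spectrum.zero_mem_iff] at h1
    exact h1 hQ.isUnit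
  set κ := (1 - ν) * lam + ν with hκdef
  have hκ : 0 < κ := by
    have := mul_nonneg (by linarith : 0 ≤ 1 - ν) hlampos.le
    linarith
  let W : Mat d → Mat d := fun S => (regMatrix ν S)⁻¹ * S * Q⁻¹
  have hWQ : W Q = (regMatrix ν Q)⁻¹ := by
    simp only [W]
    rw [mul_assoc, Matrix.mul_nonsing_inv _ (isUnit_iff_ne_zero.2 hQ.det_pos.ne'), mul_one]
  have hWc : ContDiffAt ℝ 1 W Q := by
    have h1 : ContDiffAt ℝ 1 (regMatrix (d := d) ν) Q := by
      unfold regMatrix; fun_prop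
    exact (((contDiffAt_matrix_inv (regMatrix_det_ne_zero hν₀ hν₁ hQ.posSemidef)).comp Q h1).mul
      contDiffAt_id).mul contDiffAt_const
  obtain ⟨K, u, hu, hK⟩ := hWc.exists_lipschitzOnWith
  obtain ⟨T, hT⟩ := eventually_atTop.1 ((hlim.eventually hu).and (eventually_ge_atTop 0))
  let f : ℝ → ℝ := fun t => ((S t - Q) * (S t - Q)ᵀ).trace
  have hnorm : ∀ t, ‖S t - Q‖ ≤ √(f t) := fun t => Real.le_sqrt_of_sq_le (norm_sq_le_trace _)
  have hf0 : ∀ t, 0 ≤ f t := fun t => (sq_nonneg _).trans (norm_sq_le_trace _)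
  have hSd : ∀ t, 0 ≤ t → HasDerivAt (fun s => S s - Q) (-((2 : ℝ) • ((S t - Q) * W (S t)))) t := by
    intro t ht
    refine ((hS t ht).sub_const Q).congr_deriv ?_
    have hQu : IsUnit Q.det := isUnit_iff_ne_zero.2 hQ.det_pos.ne'
    have hc : Commute (S t) Q := commute_of_commute_zero hν₀ hν₁ hQ
      (fun t ht => (hSp t ht).posSemidef) (fun t ht => (hS t ht).hasDerivWithinAt) h0 ht
    have hcR : Commute (regMatrix ν (S t))⁻¹ (S t) :=
      commute_inv (regMatrix_det_ne_zero hν₀ hν₁ (hSp t ht).posSemidef) (commute_regMatrix _ _)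
    have hcRQ : Commute (regMatrix ν (S t))⁻¹ Q := by
      refine commute_inv (regMatrix_det_ne_zero hν₀ hν₁ (hSp t ht).posSemidef) ?_
      exact (hc.smul_left _).add_left ((Commute.one_left Q).smul_left _)
    have hcQi : Commute Q⁻¹ (S t) := commute_inv hQ.det_pos.ne' hc.symm
    have hcQR : Commute Q⁻¹ (regMatrix ν (S t))⁻¹ := commute_inv hQ.det_pos.ne' hcRQ.symm
    change (2 : ℝ) • ((regMatrix ν (S t))⁻¹ * S t) - (regMatrix ν (S t))⁻¹ * S t ^ 2 * Q⁻¹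
      - Q⁻¹ * (regMatrix ν (S t))⁻¹ * S t ^ 2 = _
    simp only [W]
    set R := (regMatrix ν (S t))⁻¹
    have e1 : Q⁻¹ * R * S t ^ 2 = R * S t ^ 2 * Q⁻¹ :=
      ((hcQR.mul_right (hcQi.pow_right 2)).eq ▸ mul_assoc Q⁻¹ R (S t ^ 2))
    have e2 : S t * (R * S t * Q⁻¹) = R * S t ^ 2 * Q⁻¹ := by
      rw [pow_two, ← mul_assoc, ← mul_assoc, ← mul_assoc, hcR.eq]
    have e3 : Q * (R * S t * Q⁻¹) = R * S t := by
      rw [← mul_assoc, ((hcRQ.symm.mul_right hc.symm).eq), mul_assoc,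
        Matrix.mul_nonsing_inv _ hQu, mul_one]
    rw [sub_mul, e1, e2, e3, smul_sub, two_smul, two_smul]
    abel
  have hfd : ∀ t, 0 ≤ t → HasDerivAt f (-(4 * ((S t - Q) * W (S t) * (S t - Q)ᵀ).trace)) t := by
    intro t ht
    have h1 := hasDerivAt_trace ((hSd t ht).mul (hasDerivAt_transpose (hSd t ht)))
    refine h1.congr_deriv ?_
    have h2 : ((S t - Q) * (-((2 : ℝ) • ((S t - Q) * W (S t))))ᵀ).trace =
        (-((2 : ℝ) • ((S t - Q) * W (S t))) * (S t - Q)ᵀ).trace := by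
      rw [← Matrix.trace_transpose, Matrix.transpose_mul, Matrix.transpose_transpose]
    rw [Matrix.trace_add, h2, neg_mul, smul_mul_assoc, Matrix.trace_neg, Matrix.trace_smul,
      smul_eq_mul]
    ring
  have hflim : Tendsto f atTop (𝓝 0) := by
    have hc : Continuous fun X : Mat d => ((X - Q) * (X - Q)ᵀ).trace := by
      have h1 : Continuous fun X : Mat d => X - Q := continuous_id.sub continuous_const
      exact (contDiff_trace (n := 0)).continuous.comp
        (h1.mul ((contDiff_transpose (n := 0)).continuous.comp h1))
    have := (hc.tendsto Q).comp hlim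
    rwa [sub_self, zero_mul, Matrix.trace_zero] at this
  obtain ⟨C, T', hC⟩ := isBigO_exp_of_deriv_le hκ K.coe_nonneg (fun t _ => hf0 t)
    (fun t ht => hfd t (hT t ht).2) hflim (fun t ht => by
      have h1 := trace_inv_regMatrix_ge hν₀ hν₁ hQ hlam.2 (S t - Q)
      have h2 := trace_mul_mul_le (W Q - W (S t)) (S t - Q)
      have h3 : ‖W Q - W (S t)‖ ≤ K * √(f t) := by
        have h4 := hK.dist_le_mul Q (mem_of_mem_nhds hu) (S t) (hT t ht).1
        rw [dist_eq_norm, dist_eq_norm, ← norm_neg (Q - S t), neg_sub] at h4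
        exact h4.trans (mul_le_mul_of_nonneg_left (hnorm t) K.coe_nonneg)
      rw [mul_sub, sub_mul, Matrix.trace_sub, hWQ] at h2
      rw [← hκdef] at h1
      have h5 : f t / κ ≤ ((S t - Q) * (regMatrix ν Q)⁻¹ * (S t - Q)ᵀ).trace := by
        rw [div_le_iff₀ hκ, mul_comm]; exact h1
      rw [hWQ] at h3
      have h6 := mul_le_mul_of_nonneg_right h3 (hf0 t)
      have h7 : -(4 / κ - 4 * K * √(f t)) * f t = -(4 * (f t / κ - K * √(f t) * f t)) := by
        ring
      rw [h7]
      change _ ≤ ‖(regMatrix ν Q)⁻¹ - W (S t)‖ * f t at h2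
      linarith)
  refine Asymptotics.IsBigO.of_bound C ((eventually_ge_atTop T').mono fun t ht => ?_)
  rw [norm_norm, Real.norm_of_nonneg (Real.exp_pos _).le]
  exact (hnorm t).trans (hC t ht)

/-! ### Centered Gaussian laws -/

/-- A matrix as a linear operator of Euclidean space. -/
abbrev lin (A : Mat d) : Rd d →L[ℝ] Rd d := Matrix.toEuclideanCLM (𝕜 := ℝ) A

theorem lin_mul_apply (A B : Mat d) (x : Rd d) : lin (A * B) x = lin A (lin B x) := by
  simp [lin, map_mul]

theorem lin_one_apply (x : Rd d) : lin (1 : Mat d) x = x := by simp [lin]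

theorem lin_add_apply (A B : Mat d) (x : Rd d) : lin (A + B) x = lin A x + lin B x := by
  simp [lin, map_add]

theorem lin_sub_apply (A B : Mat d) (x : Rd d) : lin (A - B) x = lin A x - lin B x := by
  simp [lin, map_sub]

theorem lin_smul_apply (c : ℝ) (A : Mat d) (x : Rd d) : lin (c • A) x = c • lin A x := by
  simp [lin, map_smul]

theorem inner_lin (A : Mat d) (x y : Rd d) : inner ℝ x (lin A y) = x.ofLp ⬝ᵥ (A *ᵥ y.ofLp) :=
  Matrix.inner_toEuclideanCLM A x y

theorem inner_lin_left (A : Mat d) (x y : Rd d) : inner ℝ (lin A x) y = inner ℝ x (lin Aᵀ y) := by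
  rw [real_inner_comm, inner_lin, inner_lin, Matrix.mulVec_transpose, Matrix.dotProduct_mulVec,
    dotProduct_comm]

theorem norm_lin_apply_le (A : Mat d) (x : Rd d) : ‖lin A x‖ ≤ ‖A‖ * ‖x‖ :=
  (lin A).le_opNorm x

theorem map_lin_multivariateGaussian {S : Mat d} (hS : S.PosSemidef) (L : Mat d) :
    (multivariateGaussian 0 S).map (lin L) = multivariateGaussian 0 (L * S * Lᵀ) := by
  apply Measure.ext_of_charFun
  ext x
  have h1 : charFun ((multivariateGaussian 0 S).map (lin L)) x =
      charFun (multivariateGaussian 0 S) (lin Lᵀ x) := by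
    rw [charFun_apply, charFun_apply, integral_map (by fun_prop) (by fun_prop)]
    simp_rw [inner_lin_left]
  rw [h1, charFun_multivariateGaussian hS, charFun_multivariateGaussian (conj_posSemidef hS L)]
  simp only [inner_zero_right]
  congr 3
  rw [← inner_lin, ← inner_lin, inner_lin_left, Matrix.transpose_transpose, ← lin_mul_apply,
    ← lin_mul_apply]

theorem gaussianDensity_pos {S : Mat d} (hS : S.PosDef) (x : Rd d) : 0 < gaussianDensity S x := by
  have := hS.det_pos
  unfold gaussianDensity
  positivity

theorem gaussianDensity_eq (S : Mat d) (x : Rd d) : gaussianDensity S x =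
    (√((2 * Real.pi) ^ d * S.det))⁻¹ * Real.exp (-(inner ℝ x (lin S⁻¹ x)) / 2) := by
  rw [gaussianDensity, inner_lin]

theorem continuous_gaussianDensity (S : Mat d) : Continuous (gaussianDensity S) := by
  have : gaussianDensity S = fun x => (√((2 * Real.pi) ^ d * S.det))⁻¹ *
    Real.exp (-(inner ℝ x (lin S⁻¹ x)) / 2) := funext (gaussianDensity_eq S)
  rw [this]
  fun_prop

/-- The two laws have the same characteristic function. -/
theorem stdGaussian_eq_densityMeasure :
    stdGaussian (Rd d) = densityMeasure (gaussianDensity (1 : Mat d)) := by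
  have hρ : ∀ x : Rd d, gaussianDensity (1 : Mat d) x =
      (√((2 * Real.pi) ^ d))⁻¹ * Real.exp (-‖x‖ ^ 2 / 2) := by
    intro x
    rw [gaussianDensity_eq, inv_one, lin_one_apply, Matrix.det_one, mul_one,
      real_inner_self_eq_norm_sq]
  have hint : Integrable (gaussianDensity (1 : Mat d)) := by
    have h1 := (GaussianFourier.integrable_cexp_neg_mul_sq_norm_add (V := Rd d) (b := 1 / 2)
      (by norm_num) 0 0).norm
    have h2 : Integrable fun v : Rd d => Real.exp (-‖v‖ ^ 2 / 2) := by
      refine h1.congr (Eventually.of_forall fun v => ?_)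
      simp only [Complex.norm_exp]
      congr 1
      simp [← Complex.ofReal_pow]
      ring
    have h3 : gaussianDensity (1 : Mat d) = fun x =>
      (√((2 * Real.pi) ^ d))⁻¹ * Real.exp (-‖x‖ ^ 2 / 2) := funext hρ
    rw [h3]
    exact h2.const_mul _
  have hfin : IsFiniteMeasure (densityMeasure (gaussianDensity (1 : Mat d))) :=
    isFiniteMeasure_withDensity_ofReal hint.2
  apply Measure.ext_of_charFun
  ext ξ
  rw [charFun_stdGaussian, charFun_apply, densityMeasure,
    integral_withDensity_eq_integral_toReal_smul
      (by have := (continuous_gaussianDensity (1 : Mat d)).measurable; fun_prop)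
      (Eventually.of_forall fun _ => ENNReal.ofReal_lt_top)]
  have h1 : ∀ x : Rd d, (ENNReal.ofReal (gaussianDensity (1 : Mat d) x)).toReal •
      Complex.exp (inner ℝ x ξ * Complex.I) = ((√((2 * Real.pi) ^ d))⁻¹ : ℝ) *
        Complex.exp (-(1 / 2 : ℂ) * ‖x‖ ^ 2 + Complex.I * inner ℝ ξ x) := by
    intro x
    rw [ENNReal.toReal_ofReal (gaussianDensity_pos Matrix.PosDef.one x).le, hρ, Complex.real_smul,
      Complex.ofReal_mul, mul_assoc, Complex.ofReal_exp, ← Complex.exp_add, real_inner_comm]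
    congr 2
    push_cast
    ring
  simp_rw [h1]
  rw [integral_const_mul, GaussianFourier.integral_cexp_neg_mul_sq_norm_add (by norm_num)]
  have h2 : (Real.pi / (1 / 2 : ℂ)) ^ (Module.finrank ℝ (Rd d) / 2 : ℂ) =
      ((√((2 * Real.pi) ^ d) : ℝ) : ℂ) := by
    have : (Real.pi / (1 / 2 : ℂ)) = ((2 * Real.pi : ℝ) : ℂ) := by push_cast; ring
    rw [this, finrank_euclideanSpace_fin, Real.sqrt_eq_rpow, ← Real.rpow_natCast,
      ← Real.rpow_mul (by positivity)]
    rw [Complex.ofReal_cpow (by positivity)]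
    push_cast
    ring_nf
  rw [h2, ← mul_assoc, ← Complex.ofReal_mul, inv_mul_cancel₀ (by positivity), Complex.ofReal_one,
    one_mul]
  congr 1
  rw [Complex.I_sq]
  ring

theorem densityMeasure_map_lin (ρ : Rd d → ℝ) {N : Mat d} (hN : N.det ≠ 0) :
    (densityMeasure ρ).map (lin N) =
      densityMeasure (fun x => |(N⁻¹).det| * ρ (lin N⁻¹ x)) := by
  have hu : IsUnit N.det := isUnit_iff_ne_zero.2 hN
  have h1 : ∀ x, lin N⁻¹ (lin N x) = x := fun x => by
    rw [← lin_mul_apply, Matrix.nonsing_inv_mul _ hu, lin_one_apply]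
  have h2 : ∀ x, lin N (lin N⁻¹ x) = x := fun x => by
    rw [← lin_mul_apply, Matrix.mul_nonsing_inv _ hu, lin_one_apply]
  have hdet : (lin N⁻¹).det = (N⁻¹).det := by
    rw [ContinuousLinearMap.det, Matrix.coe_toEuclideanCLM_eq_toEuclideanLin]
    change LinearMap.det (Matrix.toLpLin 2 2 N⁻¹) = _
    rw [Matrix.toLpLin_eq_toLin, LinearMap.det_toLin]
  ext A hA
  have himg : lin N⁻¹ '' A = lin N ⁻¹' A := by
    ext x
    refine ⟨?_, fun hx => ⟨lin N x, hx, h1 x⟩⟩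
    rintro ⟨y, hy, rfl⟩
    change lin N (lin N⁻¹ y) ∈ A
    rwa [h2]
  rw [Measure.map_apply (by fun_prop) hA, densityMeasure, densityMeasure,
    withDensity_apply _ hA, withDensity_apply _ ((lin N).measurable hA), ← himg,
    lintegral_image_eq_lintegral_abs_det_fderiv_mul volume hA
      (fun x _ => (lin N⁻¹).hasFDerivWithinAt) (Function.LeftInverse.injective h2).injOn]
  simp_rw [hdet, ENNReal.ofReal_mul (abs_nonneg (N⁻¹).det)]

/-- `N(0, S)` is the image of the standard Gaussian under `S^(1/2)`, and densities transform by the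
change of variables formula. -/
theorem multivariateGaussian_eq_densityMeasure {S : Mat d} (hS : S.PosDef) :
    multivariateGaussian 0 S = densityMeasure (gaussianDensity S) := by
  obtain ⟨N, hN, hNN⟩ := exists_posDef_sqrt hS
  have hNt := symm_of_posSemidef hN.posSemidef
  have h1 := map_lin_multivariateGaussian (Matrix.PosSemidef.one (n := Fin d) (R := ℝ)) N
  rw [mul_one, hNt, hNN] at h1
  rw [← h1, multivariateGaussian_zero_one, stdGaussian_eq_densityMeasure,
    densityMeasure_map_lin _ hN.det_pos.ne']
  congr 1
  ext x
  have hSi : S⁻¹ = N⁻¹ * N⁻¹ := by rw [← hNN, Matrix.mul_inv_rev]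
  have h2 : inner ℝ (lin N⁻¹ x) (lin (1 : Mat d)⁻¹ (lin N⁻¹ x)) = inner ℝ x (lin S⁻¹ x) := by
    rw [inv_one, lin_one_apply, inner_lin_left, symm_of_posSemidef hN.inv.posSemidef,
      ← lin_mul_apply, hSi]
  have h3 : √((2 * Real.pi) ^ d * S.det) = √((2 * Real.pi) ^ d * (1 : Mat d).det) * N.det := by
    rw [Matrix.det_one, mul_one, ← hNN, Matrix.det_mul, Real.sqrt_mul (by positivity),
      Real.sqrt_mul_self hN.det_pos.le]
  rw [gaussianDensity_eq, gaussianDensity_eq, h2, h3, abs_of_pos hN.inv.det_pos,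
    Matrix.det_nonsing_inv, Ring.inverse_eq_inv', mul_inv]
  ring

theorem tendsto_gaussianLaw {S : ℝ → Mat d} {Q : Mat d} (hQ : Q.PosDef)
    (hS : ∀ t, 0 ≤ t → (S t).PosDef) (h : Tendsto S atTop (𝓝 Q)) :
    Tendsto (fun t => gaussianLaw (S t)) atTop (𝓝 (gaussianLaw Q)) := by
  rw [tendsto_iff_seq_tendsto]
  intro u hu
  refine ProbabilityMeasure.tendsto_of_tendsto_charFun fun ξ => ?_
  change Tendsto (fun n => charFun (multivariateGaussian 0 (S (u n))) ξ) atTop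
    (𝓝 (charFun (multivariateGaussian 0 Q) ξ))
  rw [charFun_multivariateGaussian hQ.posSemidef]
  have hc : Continuous fun X : Mat d =>
      Complex.exp (inner ℝ ξ (0 : Rd d) * Complex.I - (ξ.ofLp ⬝ᵥ X *ᵥ ξ.ofLp : ℝ) / 2) := by
    fun_prop
  refine ((hc.tendsto Q).comp (h.comp hu)).congr' ?_
  filter_upwards [hu.eventually (eventually_ge_atTop 0)] with n hn
  rw [charFun_multivariateGaussian (hS _ hn).posSemidef]
  rfl

/-! ### Moments -/

/-- The matrix of second moments. -/
def secondMoment (μ : Measure (Rd d)) : Mat d := Matrix.of fun i j => ∫ x, x i * x j ∂μ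

theorem integrable_of_quadratic {μ : Measure (Rd d)} [IsFiniteMeasure μ]
    (h2 : Integrable (fun x => ‖x‖ ^ 2) μ) {F : Type*} [NormedAddCommGroup F] {f : Rd d → F}
    (hf : AEStronglyMeasurable f μ) {C : ℝ} (hC : ∀ x, ‖f x‖ ≤ C * (1 + ‖x‖ ^ 2)) :
    Integrable f μ :=
  (((integrable_const (1 : ℝ)).add h2).const_mul C).mono' hf (Eventually.of_forall hC)

theorem norm_le_one_add_sq (r : ℝ) : r ≤ 1 + r ^ 2 := by nlinarith [sq_nonneg (r - 1)]

theorem integrable_id_of_sq {μ : Measure (Rd d)} [IsFiniteMeasure μ]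
    (h2 : Integrable (fun x => ‖x‖ ^ 2) μ) : Integrable (fun x : Rd d => x) μ :=
  integrable_of_quadratic h2 (by fun_prop) (C := 1) fun x => by
    rw [one_mul]; exact norm_le_one_add_sq _

theorem integrable_inner_smul {μ : Measure (Rd d)} [IsFiniteMeasure μ]
    (h2 : Integrable (fun x => ‖x‖ ^ 2) μ) (x : Rd d) (A : Mat d) :
    Integrable (fun y : Rd d => (inner ℝ x y : ℝ) • lin A y) μ := by
  refine integrable_of_quadratic h2 (C := ‖x‖ * ‖A‖) (by fun_prop) fun y => ?_
  rw [norm_smul]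
  calc ‖(inner ℝ x y : ℝ)‖ * ‖lin A y‖ ≤ (‖x‖ * ‖y‖) * (‖A‖ * ‖y‖) :=
        mul_le_mul (norm_inner_le_norm _ _) (norm_lin_apply_le _ _) (norm_nonneg _) (by positivity)
    _ = ‖x‖ * ‖A‖ * ‖y‖ ^ 2 := by ring
    _ ≤ _ := by gcongr; linarith

theorem integral_inner_smul {μ : Measure (Rd d)} [IsFiniteMeasure μ]
    (h2 : Integrable (fun x => ‖x‖ ^ 2) μ) (x : Rd d) (A : Mat d) :
    ∫ y : Rd d, (inner ℝ x y : ℝ) • lin A y ∂μ = lin (A * secondMoment μ) x := by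
  have h3 := integrable_inner_smul h2 x (1 : Mat d)
  simp only [lin_one_apply] at h3
  have h1 : ∀ y : Rd d, (inner ℝ x y : ℝ) • lin A y = lin A ((inner ℝ x y : ℝ) • y) := fun y => by
    rw [map_smul]
  simp_rw [h1]
  rw [(lin A).integral_comp_comm h3, lin_mul_apply]
  congr 1
  ext i
  have h4 : (∫ y : Rd d, (inner ℝ x y : ℝ) • y ∂μ) i = ∫ y : Rd d, (inner ℝ x y : ℝ) * y i ∂μ := by
    have := ((EuclideanSpace.proj i : Rd d →L[ℝ] ℝ).integral_comp_comm h3)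
    simpa using this.symm
  rw [h4, Matrix.ofLp_toEuclideanCLM]
  simp only [Matrix.mulVec, dotProduct, secondMoment, Matrix.of_apply, PiLp.inner_apply,
    RCLike.inner_apply, conj_trivial, Finset.sum_mul]
  rw [integral_finsetSum]
  · refine Finset.sum_congr rfl fun j _ => ?_
    rw [← integral_mul_const]
    congr 1
    ext y
    ring
  · intro j _
    refine integrable_of_quadratic h2 (C := |x j|) (by fun_prop) fun y => ?_
    rw [Real.norm_eq_abs, abs_mul, abs_mul]
    have h5 : |y j| ≤ ‖y‖ := by simpa using PiLp.norm_apply_le y j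
    have h6 : |y i| ≤ ‖y‖ := by simpa using PiLp.norm_apply_le y i
    nlinarith [abs_nonneg (x j), abs_nonneg (y j), abs_nonneg (y i), norm_nonneg y,
      mul_le_mul h5 h6 (abs_nonneg _) (norm_nonneg _)]

theorem integrable_norm_sq_gaussian (S : Mat d) :
    Integrable (fun x : Rd d => ‖x‖ ^ 2) (multivariateGaussian 0 S) := by
  have := (IsGaussian.memLp_two_id (μ := multivariateGaussian (0 : Rd d) S)).integrable_norm_pow
    two_ne_zero
  simpa using this

theorem secondMoment_gaussian {S : Mat d} (hS : S.PosSemidef) :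
    secondMoment (multivariateGaussian 0 S) = S := by
  ext i j
  have hm : ∀ i, MemLp (fun x : Rd d => x i) 2 (multivariateGaussian 0 S) := fun i =>
    (EuclideanSpace.proj i : Rd d →L[ℝ] ℝ).comp_memLp'
      (IsGaussian.memLp_two_id (μ := multivariateGaussian (0 : Rd d) S))
  have h0 : ∀ i, ∫ x : Rd d, x i ∂(multivariateGaussian 0 S) = 0 := by
    intro i
    have := (EuclideanSpace.proj i : Rd d →L[ℝ] ℝ).integral_comp_comm
      (IsGaussian.integrable_id (μ := multivariateGaussian (0 : Rd d) S))
    simpa using this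
  have h1 := covariance_eval_multivariateGaussian (μ := (0 : Rd d)) hS i j
  rw [covariance_eq_sub (hm i) (hm j), h0 i, zero_mul, sub_zero] at h1
  exact h1

/-! ### The quadratic potential -/

theorem hasGradientAt_quadratic {A : Mat d} (hA : Aᵀ = A) (x : Rd d) :
    HasGradientAt (fun y : Rd d => inner ℝ y (lin A y) / 2) (lin A x) x := by
  rw [hasGradientAt_iff_hasFDerivAt]
  have h1 : HasFDerivAt (fun y : Rd d => (inner ℝ y (lin A y) : ℝ)) _ x :=
    (hasFDerivAt_id x).inner ℝ (lin A).hasFDerivAt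
  have h2 := h1.mul_const (2⁻¹ : ℝ)
  refine h2.congr_fderiv ?_
  ext v
  have h3 : inner ℝ x (lin A v) = inner ℝ (lin A x) v := by
    rw [inner_lin_left, hA]
  simp [fderivInnerCLM_apply, h3, real_inner_comm]
  ring

theorem potential_gaussianDensity {Q : Mat d} (hQ : Q.PosDef) (x : Rd d) :
    potential (gaussianDensity Q) x =
      inner ℝ x (lin Q⁻¹ x) / 2 + Real.log (√((2 * Real.pi) ^ d * Q.det)) := by
  have := hQ.det_pos
  rw [potential, gaussianDensity_eq, Real.log_mul (by positivity) (Real.exp_pos _).ne',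
    Real.log_exp, Real.log_inv]
  ring

theorem gradient_potential {Q : Mat d} (hQ : Q.PosDef) (x : Rd d) :
    gradient (potential (gaussianDensity Q)) x = lin Q⁻¹ x := by
  have h1 : potential (gaussianDensity Q) = fun x => inner ℝ x (lin Q⁻¹ x) / 2 +
      Real.log (√((2 * Real.pi) ^ d * Q.det)) := funext (potential_gaussianDensity hQ)
  rw [h1]
  have h2 := hasGradientAt_quadratic (symm_of_posSemidef hQ.inv.posSemidef) x
  rw [hasGradientAt_iff_hasFDerivAt] at h2
  have h3 := h2.add_const (Real.log (√((2 * Real.pi) ^ d * Q.det)))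
  rw [← hasGradientAt_iff_hasFDerivAt] at h3
  exact h3.gradient

theorem norm_sq_le_inner_inv {Q : Mat d} (hQ : Q.PosDef) :
    ∃ C : ℝ, 0 < C ∧ ∀ x : Rd d, ‖x‖ ^ 2 ≤ C * inner ℝ x (lin Q⁻¹ x) := by
  obtain ⟨L, hL, hLL⟩ := exists_posDef_sqrt hQ.inv
  refine ⟨‖L⁻¹‖ ^ 2 + 1, by positivity, fun x => ?_⟩
  have h1 : inner ℝ x (lin Q⁻¹ x) = ‖lin L x‖ ^ 2 := by
    rw [← hLL, lin_mul_apply, ← real_inner_self_eq_norm_sq, inner_lin_left L,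
      symm_of_posSemidef hL.posSemidef]
  have h2 : x = lin L⁻¹ (lin L x) := by
    rw [← lin_mul_apply, Matrix.nonsing_inv_mul _ (isUnit_iff_ne_zero.2 hL.det_pos.ne'),
      lin_one_apply]
  rw [h1]
  calc ‖x‖ ^ 2 = ‖lin L⁻¹ (lin L x)‖ ^ 2 := by rw [← h2]
    _ ≤ (‖L⁻¹‖ * ‖lin L x‖) ^ 2 := by gcongr; exact norm_lin_apply_le _ _
    _ = ‖L⁻¹‖ ^ 2 * ‖lin L x‖ ^ 2 := by ring
    _ ≤ _ := by gcongr; linarith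

/-- The potential of a Gaussian has exactly quadratic growth. -/
theorem exists_potential_bounds {Q : Mat d} (hQ : Q.PosDef) :
    ∃ C : ℝ, 0 < C ∧ ∀ x : Rd d, 1 + ‖x‖ ^ 2 ≤ C * (1 + |potential (gaussianDensity Q) x|) ∧
      1 + |potential (gaussianDensity Q) x| ≤ C * (1 + ‖x‖ ^ 2) := by
  obtain ⟨C, hC, h⟩ := norm_sq_le_inner_inv hQ
  set c := Real.log (√((2 * Real.pi) ^ d * Q.det)) with hc
  refine ⟨1 + 2 * C * (1 + |c|) + ‖Q⁻¹‖ + |c|, by positivity, fun x => ?_⟩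
  rw [potential_gaussianDensity hQ, ← hc]
  set q := inner ℝ x (lin Q⁻¹ x)
  have hq := h x
  have hq2 : q ≤ ‖Q⁻¹‖ * ‖x‖ ^ 2 := by
    refine (real_inner_le_norm _ _).trans ?_
    have := mul_le_mul_of_nonneg_left (norm_lin_apply_le Q⁻¹ x) (norm_nonneg x)
    linarith
  have hq0 : 0 ≤ q := by
    by_contra! hneg
    nlinarith [sq_nonneg ‖x‖]
  have hc0 := abs_nonneg c
  have hn := norm_nonneg Q⁻¹
  have hx := sq_nonneg ‖x‖
  constructor
  · have h1 : q / 2 ≤ |q / 2 + c| + |c| := by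
      have := le_abs_self (q / 2 + c)
      have := neg_abs_le c
      linarith
    set v := |q / 2 + c|
    have hv : 0 ≤ v := abs_nonneg _
    have h2 : ‖x‖ ^ 2 ≤ 2 * C * (v + |c|) := by nlinarith
    have h3 : 0 ≤ C * v * |c| := by positivity
    have h4 : 0 ≤ ‖Q⁻¹‖ * v := by positivity
    have h5 : 0 ≤ |c| * v := by positivity
    nlinarith
  · have h1 : |q / 2 + c| ≤ q / 2 + |c| := by
      refine (abs_add_le _ _).trans ?_
      rw [abs_of_nonneg (by positivity : 0 ≤ q / 2)]
    have h3 : 0 ≤ C * (1 + |c|) := by positivity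
    nlinarith [mul_nonneg h3 hx, mul_nonneg hc0 hx, mul_nonneg hn hx]

theorem continuous_potential {Q : Mat d} (hQ : Q.PosDef) :
    Continuous (potential (gaussianDensity Q)) := by
  have h1 : potential (gaussianDensity Q) = fun x => inner ℝ x (lin Q⁻¹ x) / 2 +
      Real.log (√((2 * Real.pi) ^ d * Q.det)) := funext (potential_gaussianDensity hQ)
  rw [h1]
  fun_prop

theorem IsCurve.integrable_sq {Q : Mat d} (hQ : Q.PosDef) {μ : ℝ → Measure (Rd d)}
    (h : IsCurve (potential (gaussianDensity Q)) μ) {t : ℝ} (ht : 0 ≤ t) :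
    Integrable (fun x : Rd d => ‖x‖ ^ 2) (μ t) := by
  obtain ⟨C, hC, hCV⟩ := exists_potential_bounds hQ
  have := h.prob t ht
  refine (((integrable_const (1 : ℝ)).add (h.integrable t ht).abs).const_mul C).mono'
    (by fun_prop) (Eventually.of_forall fun x => ?_)
  rw [Real.norm_of_nonneg (sq_nonneg _)]
  exact le_trans (by linarith) (hCV x).1

theorem IsCurve.continuousOn_integral {Q : Mat d} (hQ : Q.PosDef) {μ : ℝ → Measure (Rd d)}
    (h : IsCurve (potential (gaussianDensity Q)) μ) {f : Rd d → ℝ} (hf : Continuous f) {C : ℝ}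
    (hfC : ∀ x, |f x| ≤ C * (1 + ‖x‖ ^ 2)) :
    ContinuousOn (fun t => ∫ x, f x ∂(μ t)) (Ici 0) := by
  obtain ⟨C', hC', hCV⟩ := exists_potential_bounds hQ
  refine h.continuousOn f hf ⟨|C| * C', fun x => (hfC x).trans ?_⟩
  rw [mul_assoc]
  exact mul_le_mul (le_abs_self C) (hCV x).1 (by positivity) (abs_nonneg C)

theorem isCurve_of_quadratic {Q : Mat d} (hQ : Q.PosDef) {μ : ℝ → Measure (Rd d)}
    (hp : ∀ t, 0 ≤ t → IsProbabilityMeasure (μ t))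
    (h2 : ∀ t, 0 ≤ t → Integrable (fun x : Rd d => ‖x‖ ^ 2) (μ t))
    (hc : ∀ f : Rd d → ℝ, Continuous f → ∀ C : ℝ, (∀ x, |f x| ≤ C * (1 + ‖x‖ ^ 2)) →
      ContinuousOn (fun t => ∫ x, f x ∂(μ t)) (Ici 0)) :
    IsCurve (potential (gaussianDensity Q)) μ := by
  obtain ⟨C, hC, hCV⟩ := exists_potential_bounds hQ
  refine ⟨hp, fun t ht => ?_, fun f hf ⟨C', hC'⟩ => hc f hf (|C'| * C) fun x => (hC' x).trans ?_⟩
  · have := hp t ht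
    refine integrable_of_quadratic (h2 t ht) (continuous_potential hQ).aestronglyMeasurable
      (C := C) fun x => ?_
    have := (hCV x).2
    rw [Real.norm_eq_abs]
    linarith
  · rw [mul_assoc]
    exact mul_le_mul (le_abs_self C') (hCV x).2 (by positivity) (abs_nonneg C')

/-! ### The bilinear kernels and their regularized inverse -/

/-- The kernel `(x - a)ᵀ (y - a) + 1`. -/
def shiftKernel (a x y : Rd d) : ℝ := inner ℝ (x - a) (y - a) + 1

theorem bilinearKernel_eq (μ : Measure (Rd d)) : bilinearKernel μ = shiftKernel 0 := by
  ext x y; simp [bilinearKernel, shiftKernel]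

theorem affineInvariantKernel_eq (μ : Measure (Rd d)) :
    affineInvariantKernel μ = shiftKernel (∫ z, z ∂μ) := rfl

theorem gradient_shiftKernel (a x y : Rd d) :
    gradient (fun z => shiftKernel a x z) y = x - a := by
  refine HasGradientAt.gradient ?_
  rw [hasGradientAt_iff_hasFDerivAt]
  have h1 : HasFDerivAt (fun z : Rd d => (inner ℝ (x - a) (z - a) : ℝ))
      ((innerSL ℝ (x - a))) y := by
    have := ((innerSL ℝ (x - a)).hasFDerivAt (x := y - a)).comp y
      ((hasFDerivAt_id y).sub_const a)
    rwa [ContinuousLinearMap.comp_id] at this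
  exact h1.add_const 1

theorem steinIntegrand_shiftKernel {Q : Mat d} (hQ : Q.PosDef) (a x y : Rd d) :
    steinIntegrand (shiftKernel a) (potential (gaussianDensity Q)) x y =
      (inner ℝ (x - a) (y - a) + 1 : ℝ) • lin Q⁻¹ y - (x - a) := by
  rw [steinIntegrand, gradient_potential hQ, gradient_shiftKernel, shiftKernel]

/-- The rank-one matrix `u vᵀ`. -/
abbrev outer (u v : Rd d) : Mat d := Matrix.vecMulVec u.ofLp v.ofLp

theorem lin_outer (u v z : Rd d) : lin (outer u v) z = (inner ℝ z v : ℝ) • u := by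
  ext i
  rw [Matrix.ofLp_toEuclideanCLM, Matrix.vecMulVec_mulVec]
  simp [PiLp.inner_apply, dotProduct, mul_comm]

/-- The covariance matrix of a probability measure. -/
def covMatrix (μ : Measure (Rd d)) : Mat d :=
  secondMoment μ - outer (∫ y, y ∂μ) (∫ y, y ∂μ)

section Moments

variable {μ : Measure (Rd d)} [IsProbabilityMeasure μ]

theorem integrable_affine (h2 : Integrable (fun x => ‖x‖ ^ 2) μ) (A : Mat d) (w : Rd d) :
    Integrable (fun y => lin A y + w) μ :=
  ((lin A).integrable_comp (integrable_id_of_sq h2)).add (integrable_const w)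

theorem integral_affine (h2 : Integrable (fun x => ‖x‖ ^ 2) μ) (A : Mat d) (w : Rd d) :
    ∫ y, (lin A (y - ∫ y, y ∂μ) + w) ∂μ = w := by
  have h1 := integrable_id_of_sq h2
  have h3 : ∀ y : Rd d, lin A (y - ∫ y, y ∂μ) + w = lin A y + (w - lin A (∫ y, y ∂μ)) := by
    intro y; rw [map_sub]; abel
  simp_rw [h3]
  rw [integral_add ((lin A).integrable_comp h1) (integrable_const _),
    (lin A).integral_comp_comm h1, integral_const]
  simp

theorem integrable_inner_smul_affine (h2 : Integrable (fun x => ‖x‖ ^ 2) μ) (A : Mat d)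
    (z a w : Rd d) : Integrable (fun y => (inner ℝ z (y - a) : ℝ) • (lin A y + w)) μ := by
  have h1 := integrable_id_of_sq h2
  have h3 : ∀ y : Rd d, (inner ℝ z (y - a) : ℝ) • (lin A y + w) =
      (inner ℝ z y : ℝ) • lin A y + (inner ℝ z y : ℝ) • w - (inner ℝ z a : ℝ) • (lin A y + w) := by
    intro y; rw [inner_sub_right, sub_smul, smul_add]
  simp_rw [h3]
  exact ((integrable_inner_smul h2 z A).add ((h1.const_inner z).smul_const w)).sub
    ((integrable_affine h2 A w).smul (inner ℝ z a : ℝ))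

theorem integral_inner_smul_affine (h2 : Integrable (fun x => ‖x‖ ^ 2) μ) (A : Mat d)
    (z a w : Rd d) :
    ∫ y, (inner ℝ z (y - a) : ℝ) • (lin A (y - ∫ y, y ∂μ) + w) ∂μ =
      lin (A * covMatrix μ) z + (inner ℝ z ((∫ y, y ∂μ) - a) : ℝ) • w := by
  have h1 := integrable_id_of_sq h2
  set m := ∫ y, y ∂μ with hm
  have h3 : ∀ y : Rd d, (inner ℝ z (y - a) : ℝ) • (lin A (y - m) + w) =
      (inner ℝ z y : ℝ) • lin A y + (inner ℝ z y : ℝ) • (w - lin A m)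
        - (inner ℝ z a : ℝ) • (lin A (y - m) + w) := by
    intro y
    rw [inner_sub_right, sub_smul]
    congr 1
    rw [map_sub, ← smul_add]
    congr 1
    abel
  simp_rw [h3]
  have i1 := integrable_inner_smul h2 z A
  have i2 : Integrable (fun y : Rd d => (inner ℝ z y : ℝ) • (w - lin A m)) μ :=
    (h1.const_inner z).smul_const _
  have i3 : Integrable (fun y : Rd d => (inner ℝ z a : ℝ) • (lin A (y - m) + w)) μ := by
    have h4 : ∀ y : Rd d, lin A (y - m) + w = lin A y + (w - lin A m) := by
      intro y; rw [map_sub]; abel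
    simp_rw [h4]
    exact (integrable_affine h2 A _).smul (inner ℝ z a : ℝ)
  refine (integral_sub (i1.add i2) i3).trans ?_
  simp only [Pi.add_apply]
  rw [integral_add i1 i2, integral_inner_smul h2, integral_smul,
    integral_affine h2, integral_smul_const, integral_inner h1, ← hm, covMatrix, mul_sub,
    lin_sub_apply, lin_mul_apply A (outer m m), lin_outer, map_smul,
    inner_sub_right, sub_smul, smul_sub]
  abel

theorem integrable_shiftKernel_smul (h2 : Integrable (fun x => ‖x‖ ^ 2) μ) (A : Mat d)
    (x a w : Rd d) : Integrable (fun y => shiftKernel a x y • (lin A y + w)) μ := by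
  simp_rw [shiftKernel, add_smul, one_smul]
  exact (integrable_inner_smul_affine h2 A _ _ _).add (integrable_affine h2 A w)

/-- The kernelization operator takes affine fields to affine fields. -/
theorem integral_shiftKernel_smul (h2 : Integrable (fun x => ‖x‖ ^ 2) μ) (A : Mat d)
    (x a w : Rd d) :
    ∫ y, shiftKernel a x y • (lin A (y - ∫ y, y ∂μ) + w) ∂μ =
      lin (A * covMatrix μ) (x - a) + (inner ℝ (x - a) ((∫ y, y ∂μ) - a) : ℝ) • w + w := by
  have h4 : ∀ y : Rd d, lin A (y - ∫ y, y ∂μ) + w = lin A y + (w - lin A (∫ y, y ∂μ)) := by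
    intro y; rw [map_sub]; abel
  simp_rw [shiftKernel, add_smul, one_smul]
  rw [integral_add ?_ ?_, integral_inner_smul_affine h2, integral_affine h2]
  · simp_rw [h4]; exact integrable_inner_smul_affine h2 A _ _ _
  · simp_rw [h4]; exact integrable_affine h2 A _

theorem integrable_steinIntegrand {Q : Mat d} (hQ : Q.PosDef)
    (h2 : Integrable (fun x => ‖x‖ ^ 2) μ) (a x : Rd d) :
    Integrable (steinIntegrand (shiftKernel a) (potential (gaussianDensity Q)) x) μ := by
  have h1 : steinIntegrand (shiftKernel a) (potential (gaussianDensity Q)) x =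
      fun y => shiftKernel a x y • (lin Q⁻¹ y + 0) - (x - a) := by
    ext1 y; rw [steinIntegrand_shiftKernel hQ, add_zero]; rfl
  rw [h1]
  exact (integrable_shiftKernel_smul h2 _ _ _ _).sub (integrable_const _)

theorem kernelizedScore_shiftKernel {Q : Mat d} (hQ : Q.PosDef)
    (h2 : Integrable (fun x => ‖x‖ ^ 2) μ) (a x : Rd d) :
    kernelizedScore (shiftKernel a) (potential (gaussianDensity Q)) μ x =
      lin (Q⁻¹ * covMatrix μ) (x - a)
        + (inner ℝ (x - a) ((∫ y, y ∂μ) - a) : ℝ) • lin Q⁻¹ (∫ y, y ∂μ)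
        + lin Q⁻¹ (∫ y, y ∂μ) - (x - a) := by
  have h1 : ∀ y, steinIntegrand (shiftKernel a) (potential (gaussianDensity Q)) x y =
      shiftKernel a x y • (lin Q⁻¹ (y - ∫ y, y ∂μ) + lin Q⁻¹ (∫ y, y ∂μ)) - (x - a) := by
    intro y
    rw [steinIntegrand_shiftKernel hQ, ← map_add, sub_add_cancel]; rfl
  have h4 : ∀ y : Rd d, lin Q⁻¹ (y - ∫ y, y ∂μ) + lin Q⁻¹ (∫ y, y ∂μ) = lin Q⁻¹ y + 0 := by
    intro y; rw [← map_add, sub_add_cancel, add_zero]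
  have i1 : Integrable (fun y => shiftKernel a x y •
      (lin Q⁻¹ (y - ∫ y, y ∂μ) + lin Q⁻¹ (∫ y, y ∂μ))) μ := by
    simp_rw [h4]; exact integrable_shiftKernel_smul h2 _ _ _ _
  rw [kernelizedScore]
  simp_rw [h1]
  rw [integral_sub i1 (integrable_const _), integral_shiftKernel_smul h2, integral_const]
  simp

theorem covMatrix_posSemidef (h2 : Integrable (fun x => ‖x‖ ^ 2) μ) :
    (covMatrix μ).PosSemidef := by
  have hsym : (covMatrix μ).IsHermitian := by
    rw [Matrix.IsHermitian, Matrix.conjTranspose_eq_transpose_of_trivial]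
    ext i j
    simp [covMatrix, secondMoment, Matrix.vecMulVec, mul_comm]
  refine Matrix.PosSemidef.of_dotProduct_mulVec_nonneg hsym fun z => ?_
  -- `⟨z, Cov z⟩` is the integral of `⟨z, y - m⟩²`
  set m := ∫ y, y ∂μ with hm
  set z' : Rd d := WithLp.toLp 2 z
  have h1 := integral_inner_smul_affine h2 1 z' m 0
  have h3 : Integrable
      (fun y : Rd d => (inner ℝ z' (y - m) : ℝ) • (lin (1 : Mat d) (y - m) + 0)) μ := by
    have h4 : ∀ y : Rd d, lin (1 : Mat d) (y - m) + (0 : Rd d) = lin (1 : Mat d) y + (-m) := by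
      intro y; rw [lin_one_apply, lin_one_apply]; abel
    simp_rw [h4]; exact integrable_inner_smul_affine h2 1 _ _ _
  have h5 : inner ℝ z' (lin (covMatrix μ) z') = ∫ y, (inner ℝ z' (y - m) : ℝ) ^ 2 ∂μ := by
    rw [one_mul, smul_zero, add_zero] at h1
    rw [← h1, ← integral_inner h3]
    simp only [lin_one_apply, add_zero, inner_smul_right, pow_two]
  have h6 := inner_lin (covMatrix μ) z' z'
  rw [h5] at h6
  have h7 : star z ⬝ᵥ covMatrix μ *ᵥ z = ∫ y, (inner ℝ z' (y - m) : ℝ) ^ 2 ∂μ := by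
    rw [h6]; rfl
  rw [h7]
  exact integral_nonneg fun y => sq_nonneg _

/-- The matrix by which the regularizing operator acts on linear fields, for a law with covariance
matrix `C` and the kernel with center `mean - p`. -/
def centeredReg (ν : ℝ) (C : Mat d) (p : Rd d) : Mat d :=
  regMatrix ν C + ((1 - ν) * ν) • outer p p

/-- The linear part of the regularized velocity field of a law with covariance matrix `C` and mean
`m`, for the kernel with center `m - p`. -/
def centeredDrift (ν : ℝ) (Q C : Mat d) (m p : Rd d) : Mat d :=
  (Q⁻¹ * C - 1 + ν • (Q⁻¹ * outer m p)) * (centeredReg ν C p)⁻¹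

theorem outer_posSemidef (p : Rd d) : (outer p p).PosSemidef := by
  have := Matrix.posSemidef_vecMulVec_self_star p.ofLp
  rwa [star_trivial] at this

theorem centeredReg_det_ne_zero {ν : ℝ} (hν₀ : 0 < ν) (hν₁ : ν ≤ 1) {C : Mat d}
    (hC : C.PosSemidef) (p : Rd d) : (centeredReg ν C p).det ≠ 0 :=
  ((regMatrix_posDef hν₀ hν₁ hC).add_posSemidef
    ((outer_posSemidef p).smul (mul_nonneg (by linarith) hν₀.le))).det_pos.ne'

/-- The regularized velocity field of any law with finite second moments is affine: `T` has finite
rank and takes values in the affine fields. -/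
theorem exists_affine_of_isRegularizedInverse {ν : ℝ} (hν₀ : 0 < ν) {Q : Mat d} (hQ : Q.PosDef)
    (h2 : Integrable (fun x => ‖x‖ ^ 2) μ) {a : Rd d} {Ψ : Rd d → Rd d}
    (hΨ : IsRegularizedInverse ν (shiftKernel a) μ
      (kernelizedScore (shiftKernel a) (potential (gaussianDensity Q)) μ) Ψ) :
    ∃ (A : Mat d) (w : Rd d), ∀ x, Ψ x = lin A (x - ∫ y, y ∂μ) + w := by
  have hk := hΨ.kernelizable
  have i0 : Integrable Ψ μ := by
    have := hk a
    simpa [shiftKernel] using this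
  have i1 : ∀ z, Integrable (fun y => (inner ℝ z (y - a) : ℝ) • Ψ y) μ := by
    intro z
    have := (hk (z + a)).sub i0
    refine this.congr (Eventually.of_forall fun y => ?_)
    simp [shiftKernel, add_smul]
  let B : Rd d →ₗ[ℝ] Rd d :=
    { toFun := fun z => ∫ y, (inner ℝ z (y - a) : ℝ) • Ψ y ∂μ
      map_add' := fun z z' => by
        simp_rw [inner_add_left, add_smul]
        exact integral_add (i1 z) (i1 z')
      map_smul' := fun c z => by
        simp_rw [real_inner_smul_left, mul_smul]
        rw [integral_smul]; rfl }
  set m := ∫ y, y ∂μ with hm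
  let G : Rd d →ₗ[ℝ] Rd d := (lin (Q⁻¹ * covMatrix μ + outer (lin Q⁻¹ m) (m - a) - 1)).toLinearMap
  have hform : ∀ x, Ψ x = (ν⁻¹ • (G - (1 - ν) • B)) (x - a)
      + ν⁻¹ • (lin Q⁻¹ m - (1 - ν) • ∫ y, Ψ y ∂μ) := by
    intro x
    have h1 := hΨ.eq x
    rw [kernelizedScore_shiftKernel hQ h2, kernelize, ← hm] at h1
    have h3 : ∫ y, shiftKernel a x y • Ψ y ∂μ = B (x - a) + ∫ y, Ψ y ∂μ := by
      simp_rw [shiftKernel, add_smul, one_smul]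
      exact integral_add (i1 _) i0
    rw [h3] at h1
    have h4 : G (x - a) = lin (Q⁻¹ * covMatrix μ) (x - a) +
        (inner ℝ (x - a) (m - a) : ℝ) • lin Q⁻¹ m - (x - a) := by
      change lin _ _ = _
      rw [lin_sub_apply, lin_add_apply, lin_outer, lin_one_apply]
    have h5 : ν • Ψ x = (G - (1 - ν) • B) (x - a) + (lin Q⁻¹ m - (1 - ν) • ∫ y, Ψ y ∂μ) := by
      rw [LinearMap.sub_apply, LinearMap.smul_apply, h4, eq_sub_of_add_eq' h1]
      rw [smul_add]; abel
    rw [LinearMap.smul_apply, ← smul_add, ← h5, smul_smul, inv_mul_cancel₀ hν₀.ne', one_smul]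
  set L : Rd d →ₗ[ℝ] Rd d := ν⁻¹ • (G - (1 - ν) • B)
  refine ⟨(Matrix.toEuclideanCLM (𝕜 := ℝ) (n := Fin d)).symm (LinearMap.toContinuousLinearMap L),
    Ψ m, fun x => ?_⟩
  rw [lin, StarAlgEquiv.apply_symm_apply, hform x, hform m]
  simp only [LinearMap.coe_toContinuousLinearMap', map_sub]
  abel

/-- The regularized velocity field in closed form: comparing the coefficients of the affine fields
on both sides of `((1 - ν) T + ν) Ψ = g` gives a linear system for those of `Ψ`. -/
theorem isRegularizedInverse_eq {ν : ℝ} (hν₀ : 0 < ν) (hν₁ : ν ≤ 1) {Q : Mat d} (hQ : Q.PosDef)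
    (h2 : Integrable (fun x => ‖x‖ ^ 2) μ) {a : Rd d} {Ψ : Rd d → Rd d}
    (hΨ : IsRegularizedInverse ν (shiftKernel a) μ
      (kernelizedScore (shiftKernel a) (potential (gaussianDensity Q)) μ) Ψ) (x : Rd d) :
    Ψ x = lin (centeredDrift ν Q (covMatrix μ) (∫ y, y ∂μ) ((∫ y, y ∂μ) - a)) (x - ∫ y, y ∂μ)
      + (lin Q⁻¹ (∫ y, y ∂μ) + ν • lin (centeredDrift ν Q (covMatrix μ) (∫ y, y ∂μ)
          ((∫ y, y ∂μ) - a)) ((∫ y, y ∂μ) - a)) := by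
  obtain ⟨A, w, hA⟩ := exists_affine_of_isRegularizedInverse hν₀ hQ h2 hΨ
  set m := ∫ y, y ∂μ with hm
  set p := m - a with hp
  set C := covMatrix μ
  have heq : ∀ z, (1 - ν) • (lin (A * C) z + (inner ℝ z p : ℝ) • w + w)
      + ν • (lin A z - lin A p + w) =
      lin (Q⁻¹ * C) z + (inner ℝ z p : ℝ) • lin Q⁻¹ m + lin Q⁻¹ m - z := by
    intro z
    have h1 := hΨ.eq (z + a)
    rw [kernelizedScore_shiftKernel hQ h2, kernelize, ← hm, add_sub_cancel_right] at h1
    have h3 : ∫ y, shiftKernel a (z + a) y • Ψ y ∂μ =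
        lin (A * C) z + (inner ℝ z p : ℝ) • w + w := by
      simp_rw [hA]
      have := integral_shiftKernel_smul h2 A (z + a) a w
      rwa [add_sub_cancel_right] at this
    have h4 : Ψ (z + a) = lin A z - lin A p + w := by
      rw [hA, ← map_sub, hp]; congr 2; abel
    rw [h3, h4] at h1
    exact h1
  have hw : w = lin Q⁻¹ m + ν • lin A p := by
    have h1 := heq 0
    simp only [map_zero, inner_zero_left, zero_smul, zero_add, zero_sub, sub_zero] at h1
    rw [← h1, smul_add, smul_neg, sub_smul, one_smul]
    abel
  have hlin : A * centeredReg ν C p = Q⁻¹ * C - 1 + ν • (Q⁻¹ * outer m p) := by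
    refine (Matrix.toEuclideanCLM (𝕜 := ℝ) (n := Fin d)).injective ?_
    ext1 z
    change lin _ z = lin _ z
    have h1 := heq z
    have h0 := heq 0
    simp only [map_zero, inner_zero_left, zero_smul, zero_add, zero_sub, sub_zero] at h0
    have h3 : (1 - ν) • (lin (A * C) z + (inner ℝ z p : ℝ) • w) + ν • lin A z =
        lin (Q⁻¹ * C) z + (inner ℝ z p : ℝ) • lin Q⁻¹ m - z := by
      calc _ = (1 - ν) • (lin (A * C) z + (inner ℝ z p : ℝ) • w + w)
            + ν • (lin A z - lin A p + w) - ((1 - ν) • w + ν • (-lin A p + w)) := by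
              simp only [smul_add, smul_sub, smul_neg]; abel
        _ = _ := by rw [h1, h0]; abel
    have e1 : lin (A * centeredReg ν C p) z = (1 - ν) • lin (A * C) z + ν • lin A z +
        ((1 - ν) * ν) • (inner ℝ z p : ℝ) • lin A p := by
      rw [centeredReg, regMatrix, mul_add, mul_add, mul_smul_comm, mul_smul_comm, mul_smul_comm,
        mul_one, lin_add_apply, lin_add_apply, lin_smul_apply, lin_smul_apply, lin_smul_apply]
      rw [lin_mul_apply A (outer p p), lin_outer, map_smul]
    have e2 : lin (Q⁻¹ * C - 1 + ν • (Q⁻¹ * outer m p)) z =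
        lin (Q⁻¹ * C) z - z + ν • (inner ℝ z p : ℝ) • lin Q⁻¹ m := by
      rw [lin_add_apply, lin_sub_apply, lin_smul_apply, lin_mul_apply Q⁻¹ (outer m p),
        lin_outer, map_smul, lin_one_apply]
    rw [hw] at h3
    rw [e1, e2]
    have h5 : lin (Q⁻¹ * C) z - z = (1 - ν) • (lin (A * C) z +
        (inner ℝ z p : ℝ) • (lin Q⁻¹ m + ν • lin A p)) + ν • lin A z -
        (inner ℝ z p : ℝ) • lin Q⁻¹ m := by
      rw [h3]; abel
    rw [h5]
    module
  have hA' : A = centeredDrift ν Q C m p := by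
    rw [centeredDrift, ← hlin, mul_assoc, Matrix.mul_nonsing_inv _ (isUnit_iff_ne_zero.2
      (centeredReg_det_ne_zero hν₀ hν₁ (covMatrix_posSemidef h2) p)), mul_one]
  rw [← hA', ← hw]
  exact hA x

end Moments

/-! ### From test functions in time to derivatives -/

/-- A smooth function with compact support in `(0, ∞)` is, on `(0, ∞)`, the derivative of a test
function on the line. -/
theorem exists_primitive_test {η : ℝ → ℝ} (hη : ContDiff ℝ ∞ η) (hc : HasCompactSupport η)
    (hsupp : tsupport η ⊆ Ioi 0) :
    ∃ θ : ℝ → ℝ, ContDiff ℝ ∞ θ ∧ HasCompactSupport θ ∧ ∀ t, 0 < t → HasDerivAt θ (η t) t := by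
  obtain ⟨R, hR⟩ := hc.isCompact.isBounded.subset_closedBall (0 : ℝ)
  have hηR : ∀ t, R < t → η t = 0 := fun t ht => by
    by_contra h
    have := hR (subset_tsupport η h)
    rw [mem_closedBall_zero_iff, Real.norm_eq_abs] at this
    linarith [le_abs_self t]
  have hη0 : ∀ t, t ≤ 0 → η t = 0 := fun t ht => by
    by_contra h
    exact absurd (hsupp (subset_tsupport η h)) (by simpa using ht)
  set R' := max R 0 + 1
  have hR'0 : 0 < R' := by positivity
  have hRR' : R < R' := (le_max_left R 0).trans_lt (lt_add_one _)
  let H : ℝ → ℝ := fun t => ∫ s in R'..t, η s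
  have hH : ∀ t, HasDerivAt H (η t) t := fun t =>
    intervalIntegral.integral_hasDerivAt_right (hη.continuous.intervalIntegrable _ _)
      hη.continuous.aestronglyMeasurable.stronglyMeasurableAtFilter hη.continuous.continuousAt
  have hHs : ContDiff ℝ ∞ H := by
    rw [contDiff_infty_iff_deriv]
    refine ⟨fun t => (hH t).differentiableAt, ?_⟩
    rwa [show deriv H = η from funext fun t => (hH t).deriv]
  have hHR : ∀ t, R' ≤ t → H t = 0 := by
    intro t ht
    refine intervalIntegral.integral_zero_ae (Eventually.of_forall fun s hs => hηR s ?_)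
    rw [uIoc_of_le ht] at hs
    linarith [hs.1]
  let χ : ContDiffBump (0 : ℝ) := ⟨R' + 1, R' + 2, by linarith, by linarith⟩
  refine ⟨fun t => H t * χ t, hHs.mul χ.contDiff, χ.hasCompactSupport.mul_left, fun t ht => ?_⟩
  have heq : (fun t => H t * χ t) =ᶠ[𝓝 t] H := by
    filter_upwards [lt_mem_nhds ht] with s hs
    rcases le_total s R' with h | h
    · rw [χ.one_of_mem_closedBall, mul_one]
      rw [mem_closedBall_zero_iff, Real.norm_eq_abs, abs_of_pos hs]
      change s ≤ R' + 1
      linarith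
    · rw [hHR s h, zero_mul]
  exact (hH t).congr_of_eventuallyEq heq

/-- If `u' = - v` holds against all test functions on `[0, ∞)`, boundary term included, then it
holds classically. -/
theorem hasDerivWithinAt_of_weak {u v : ℝ → ℝ} (hu : ContinuousOn u (Ici 0))
    (hv : ContinuousOn v (Ici 0))
    (h : ∀ θ : ℝ → ℝ, ContDiff ℝ ∞ θ → HasCompactSupport θ →
      (∫ t in Ioi (0 : ℝ), (deriv θ t * u t - θ t * v t)) + θ 0 * u 0 = 0) {t : ℝ} (ht : 0 ≤ t) :
    HasDerivWithinAt u (-v t) (Ici 0) t := by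
  -- constant extensions to negative times
  let u₁ : ℝ → ℝ := fun t => u (max t 0)
  let v₁ : ℝ → ℝ := fun t => v (max t 0)
  have hu₁ : Continuous u₁ := hu.comp_continuous (by fun_prop) fun t => mem_Ici.2 (le_max_right _ _)
  have hv₁ : Continuous v₁ := hv.comp_continuous (by fun_prop) fun t => mem_Ici.2 (le_max_right _ _)
  let U : ℝ → ℝ := fun t => u 0 - ∫ s in (0 : ℝ)..t, v₁ s
  have hU : ∀ t, HasDerivAt U (-v₁ t) t := fun t =>
    (intervalIntegral.integral_hasDerivAt_right (hv₁.intervalIntegrable _ _)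
      hv₁.aestronglyMeasurable.stronglyMeasurableAtFilter hv₁.continuousAt).const_sub (u 0)
  have hUc : Continuous U := continuous_iff_continuousAt.2 fun t => (hU t).continuousAt
  have hU0 : U 0 = u 0 := by simp [U]
  have key : ∀ θ : ℝ → ℝ, ContDiff ℝ ∞ θ → HasCompactSupport θ →
      ∫ t in Ioi (0 : ℝ), deriv θ t * (u₁ t - U t) = 0 := by
    intro θ hθ hθc
    have hθ' : Continuous (deriv θ) := hθ.continuous_deriv (by simp)
    have hθ'c : HasCompactSupport (deriv θ) := hθc.deriv
    have i1 : Integrable (fun t => deriv θ t * u₁ t - θ t * v₁ t) :=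
      ((hθ'.mul hu₁).integrable_of_hasCompactSupport hθ'c.mul_right).sub
        ((hθ.continuous.mul hv₁).integrable_of_hasCompactSupport hθc.mul_right)
    have i2 : Integrable (fun t => deriv θ t * U t - θ t * v₁ t) :=
      ((hθ'.mul hUc).integrable_of_hasCompactSupport hθ'c.mul_right).sub
        ((hθ.continuous.mul hv₁).integrable_of_hasCompactSupport hθc.mul_right)
    have h1 : (∫ t in Ioi (0 : ℝ), (deriv θ t * u₁ t - θ t * v₁ t)) = -(θ 0 * u 0) := by
      rw [← eq_neg_of_add_eq_zero_left (h θ hθ hθc)]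
      refine setIntegral_congr_fun measurableSet_Ioi fun s hs => ?_
      simp only [u₁, v₁, max_eq_left (le_of_lt (mem_Ioi.1 hs))]
    have h2 : (∫ t in Ioi (0 : ℝ), (deriv θ t * U t - θ t * v₁ t)) = -(θ 0 * u 0) := by
      have hd : ∀ t ∈ Ici (0 : ℝ), HasDerivAt (fun t => θ t * U t)
          (deriv θ t * U t - θ t * v₁ t) t := fun t _ => by
        have := ((hθ.differentiable (by simp) t).hasDerivAt).mul (hU t)
        refine this.congr_deriv ?_
        ring
      have hlim : Tendsto (fun t => θ t * U t) atTop (𝓝 0) := by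
        refine tendsto_const_nhds.congr' ?_
        obtain ⟨R, hR⟩ := hθc.isCompact.isBounded.subset_closedBall (0 : ℝ)
        filter_upwards [eventually_gt_atTop R] with t ht
        have : θ t = 0 := by
          by_contra h
          have := hR (subset_tsupport θ h)
          rw [mem_closedBall_zero_iff, Real.norm_eq_abs] at this
          linarith [le_abs_self t]
        rw [this, zero_mul]
      rw [integral_Ioi_of_hasDerivAt_of_tendsto' hd i2.integrableOn hlim, hU0, zero_sub]
    have h3 := integral_sub i1.integrableOn i2.integrableOn (μ := volume.restrict (Ioi 0))
    rw [h1, h2, sub_self] at h3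
    refine Eq.trans (integral_congr_ae (Eventually.of_forall fun t => ?_)) h3
    ring
  have hae : ∀ᵐ t : ℝ, t ∈ Ioi (0 : ℝ) → u₁ t - U t = 0 := by
    refine isOpen_Ioi.ae_eq_zero_of_integral_contDiff_smul_eq_zero
      ((hu₁.sub hUc).locallyIntegrable.locallyIntegrableOn _) fun η hη hηc hηs => ?_
    obtain ⟨θ, hθ, hθc, hθη⟩ := exists_primitive_test hη hηc hηs
    rw [← key θ hθ hθc, ← setIntegral_eq_integral_of_forall_compl_eq_zero (s := Ioi (0 : ℝ))]
    · refine setIntegral_congr_fun measurableSet_Ioi fun s hs => ?_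
      simp only [(hθη s hs).deriv, smul_eq_mul]
    · intro s hs
      have : η s = 0 := by
        by_contra hne
        exact hs (hηs (subset_tsupport η hne))
      rw [this, zero_smul]
  have heqIoi : EqOn u₁ U (Ioi 0) := by
    refine Measure.eqOn_open_of_ae_eq (μ := volume) ?_ isOpen_Ioi hu₁.continuousOn hUc.continuousOn
    rw [EventuallyEq, ae_restrict_iff' measurableSet_Ioi]
    exact hae.mono fun t ht h => sub_eq_zero.1 (ht h)
  have heq : ∀ s, 0 ≤ s → u s = U s := by
    intro s hs
    rcases hs.eq_or_lt with rfl | hs'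
    · exact hU0.symm
    · have := heqIoi hs'
      simpa [u₁, hs] using this
  have := (hU t).hasDerivWithinAt (s := Ici 0)
  simp only [v₁, max_eq_left ht] at this
  exact this.congr (fun s hs => heq s hs) (heq t ht)

/-! ### Transport by affine velocity fields -/

/-- A curve of laws with finite second moments, on `[0, ∞)`, that is transported by the affine
velocity fields `x ↦ - (A t x + c t)`. -/
structure IsAffineTransport (A : ℝ → Mat d) (c : ℝ → Rd d) (μ : ℝ → Measure (Rd d)) : Prop where
  prob : ∀ t, 0 ≤ t → IsProbabilityMeasure (μ t)
  integrable_sq : ∀ t, 0 ≤ t → Integrable (fun x : Rd d => ‖x‖ ^ 2) (μ t)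
  continuousOn_integral : ∀ f : Rd d → ℝ, Continuous f → ∀ C : ℝ,
    (∀ x, |f x| ≤ C * (1 + ‖x‖ ^ 2)) → ContinuousOn (fun t => ∫ x, f x ∂(μ t)) (Ici 0)
  continuousOn_linear : ContinuousOn A (Ici 0)
  continuousOn_const : ContinuousOn c (Ici 0)
  hasDerivWithinAt_test : ∀ ψ : Rd d → ℝ, ContDiff ℝ ∞ ψ → HasCompactSupport ψ → ∀ t, 0 ≤ t →
    HasDerivWithinAt (fun s => ∫ x, ψ x ∂(μ s))
      (-∫ x, fderiv ℝ ψ x (lin (A t) x + c t) ∂(μ t)) (Ici 0) t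

theorem norm_affine_le (A : Mat d) (c x : Rd d) : ‖lin A x + c‖ ≤ (‖A‖ + ‖c‖) * (1 + ‖x‖) := by
  refine (norm_add_le _ _).trans ?_
  have := norm_lin_apply_le A x
  nlinarith [norm_nonneg A, norm_nonneg c, norm_nonneg x,
    mul_nonneg (norm_nonneg c) (norm_nonneg x)]

theorem one_add_mul_one_add_le (r : ℝ) : (1 + r) * (1 + r) ≤ 2 * (1 + r ^ 2) := by
  nlinarith [sq_nonneg (r - 1)]

/-- Continuity of `t ↦ ∫ ℓ (A t x + c t) dμ_t` for fields `ℓ` of linear forms of linear growth. -/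
theorem continuousOn_integral_affine {A : ℝ → Mat d} {c : ℝ → Rd d} {μ : ℝ → Measure (Rd d)}
    (hp : ∀ t, 0 ≤ t → IsProbabilityMeasure (μ t))
    (h2 : ∀ t, 0 ≤ t → Integrable (fun x : Rd d => ‖x‖ ^ 2) (μ t))
    (hμ : ∀ f : Rd d → ℝ, Continuous f → ∀ C : ℝ,
      (∀ x, |f x| ≤ C * (1 + ‖x‖ ^ 2)) → ContinuousOn (fun t => ∫ x, f x ∂(μ t)) (Ici 0))
    (hA : ContinuousOn A (Ici 0)) (hc : ContinuousOn c (Ici 0))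
    {l : Rd d → Rd d →L[ℝ] ℝ} (hl : Continuous l) {C : ℝ} (hC : 0 ≤ C)
    (hlC : ∀ x, ‖l x‖ ≤ C * (1 + ‖x‖)) :
    ContinuousOn (fun t => ∫ x, l x (lin (A t) x + c t) ∂(μ t)) (Ici 0) := by
  let e : Fin d → Rd d := fun i => EuclideanSpace.single i 1
  have he : ∀ i, ‖e i‖ = 1 := fun i => by simp [e]
  have hexp : ∀ y : Rd d, y = ∑ i, y i • e i := fun y => by
    have := (EuclideanSpace.basisFun (Fin d) ℝ).sum_repr y
    simpa [e] using this.symm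
  have hcoord : ∀ (x : Rd d) i, |x i| ≤ ‖x‖ := fun x i => by simpa using PiLp.norm_apply_le x i
  have b1 : ∀ i x, |l x (e i)| ≤ C * (1 + ‖x‖) := fun i x => by
    have := (l x).le_opNorm (e i)
    rw [he, mul_one] at this
    exact this.trans (hlC x)
  have b2 : ∀ i j x, |l x (e i) * x j| ≤ 2 * C * (1 + ‖x‖ ^ 2) := fun i j x => by
    rw [abs_mul]
    calc _ ≤ (C * (1 + ‖x‖)) * (1 + ‖x‖) := by
          refine mul_le_mul (b1 i x) ((hcoord x j).trans (by linarith)) (abs_nonneg _) ?_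
          positivity
      _ = C * ((1 + ‖x‖) * (1 + ‖x‖)) := by ring
      _ ≤ C * (2 * (1 + ‖x‖ ^ 2)) := mul_le_mul_of_nonneg_left (one_add_mul_one_add_le _) hC
      _ = _ := by ring
  have b1' : ∀ i x, |l x (e i)| ≤ 2 * C * (1 + ‖x‖ ^ 2) := fun i x => by
    refine (b1 i x).trans ?_
    nlinarith [norm_le_one_add_sq ‖x‖, sq_nonneg ‖x‖, mul_le_mul_of_nonneg_left
      (norm_le_one_add_sq ‖x‖) hC]
  have c1 : ∀ i, Continuous fun x => l x (e i) := fun i => hl.clm_apply continuous_const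
  have c2 : ∀ i j, Continuous fun x : Rd d => l x (e i) * x j := fun i j =>
    (c1 i).mul (by fun_prop)
  have hsum : ∀ t, 0 ≤ t → ∫ x, l x (lin (A t) x + c t) ∂(μ t) =
      ∑ i, ((∑ j, A t i j * ∫ x, l x (e i) * x j ∂(μ t)) + c t i * ∫ x, l x (e i) ∂(μ t)) := by
    intro t ht
    have := hp t ht
    have hpt : ∀ x, l x (lin (A t) x + c t) =
        ∑ i, ((∑ j, A t i j * (l x (e i) * x j)) + c t i * l x (e i)) := by
      intro x
      conv_lhs => rw [hexp (lin (A t) x + c t), map_sum]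
      refine Finset.sum_congr rfl fun i _ => ?_
      rw [map_smul, smul_eq_mul, PiLp.add_apply, Matrix.ofLp_toEuclideanCLM, add_mul]
      simp only [Matrix.mulVec, dotProduct, Finset.sum_mul]
      congr 1
      refine Finset.sum_congr rfl fun j _ => by ring
    have i2 : ∀ i j, Integrable (fun x => l x (e i) * x j) (μ t) := fun i j =>
      integrable_of_quadratic (h2 t ht) (c2 i j).aestronglyMeasurable (b2 i j)
    have i1 : ∀ i, Integrable (fun x => l x (e i)) (μ t) := fun i =>
      integrable_of_quadratic (h2 t ht) (c1 i).aestronglyMeasurable (b1' i)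
    simp_rw [hpt]
    have i3 : ∀ i, Integrable (fun x => (∑ j, A t i j * (l x (e i) * x j)) + c t i * l x (e i))
        (μ t) := fun i =>
      (integrable_finsetSum _ fun j _ => (i2 i j).const_mul _).add ((i1 i).const_mul _)
    rw [integral_finsetSum _ fun i _ => i3 i]
    refine Finset.sum_congr rfl fun i _ => ?_
    rw [integral_add (integrable_finsetSum _ fun j _ => (i2 i j).const_mul _)
      ((i1 i).const_mul _), integral_finsetSum _ fun j _ => (i2 i j).const_mul _,
      integral_const_mul]
    simp_rw [integral_const_mul]
  refine ContinuousOn.congr ?_ hsum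
  refine continuousOn_finsetSum _ fun i _ => ContinuousOn.add
    (continuousOn_finsetSum _ fun j _ => ContinuousOn.mul ?_ (hμ _ (c2 i j) _ (b2 i j)))
    (ContinuousOn.mul ?_ (hμ _ (c1 i) _ (b1' i)))
  · exact (contDiff_entry (n := 0) i j).continuous.comp_continuousOn hA
  · exact (by fun_prop : Continuous fun y : Rd d => y i).comp_continuousOn hc

theorem hasDerivWithinAt_of_integral_eq {u v : ℝ → ℝ} (hv : ContinuousOn v (Ici 0))
    (h : ∀ T, 0 ≤ T → u T = u 0 - ∫ s in (0 : ℝ)..T, v s) {t : ℝ} (ht : 0 ≤ t) :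
    HasDerivWithinAt u (-v t) (Ici 0) t := by
  let v₁ : ℝ → ℝ := fun t => v (max t 0)
  have hv₁ : Continuous v₁ :=
    hv.comp_continuous (by fun_prop) fun t => mem_Ici.2 (le_max_right _ _)
  have hU : HasDerivAt (fun t => u 0 - ∫ s in (0 : ℝ)..t, v₁ s) (-v₁ t) t :=
    (intervalIntegral.integral_hasDerivAt_right (hv₁.intervalIntegrable _ _)
      hv₁.aestronglyMeasurable.stronglyMeasurableAtFilter hv₁.continuousAt).const_sub (u 0)
  have heq : ∀ s, 0 ≤ s → u s = u 0 - ∫ r in (0 : ℝ)..s, v₁ r := by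
    intro s hs
    rw [h s hs]
    congr 1
    refine intervalIntegral.integral_congr fun r hr => ?_
    rw [uIcc_of_le hs] at hr
    simp only [v₁, max_eq_left hr.1]
  have := hU.hasDerivWithinAt (s := Ici 0)
  simp only [v₁, max_eq_left ht] at this
  exact this.congr (fun s hs => heq s hs) (heq t ht)

/-- The transport equation holds against smooth functions of quadratic growth with a gradient of
linear growth: they are approximated by cutting them off at the scale `n + 1`, which perturbs the
gradient by at most a linearly growing field. -/
theorem IsAffineTransport.hasDerivWithinAt {A : ℝ → Mat d} {c : ℝ → Rd d}
    {μ : ℝ → Measure (Rd d)} (h : IsAffineTransport A c μ) {ψ : Rd d → ℝ} (hψ : ContDiff ℝ ∞ ψ)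
    {C : ℝ} (hC : 0 ≤ C) (b0 : ∀ x, |ψ x| ≤ C * (1 + ‖x‖ ^ 2))
    (b1 : ∀ x, ‖fderiv ℝ ψ x‖ ≤ C * (1 + ‖x‖)) {t : ℝ} (ht : 0 ≤ t) :
    HasDerivWithinAt (fun s => ∫ x, ψ x ∂(μ s))
      (-∫ x, fderiv ℝ ψ x (lin (A t) x + c t) ∂(μ t)) (Ici 0) t := by
  let χ : ContDiffBump (0 : Rd d) := ⟨1, 2, one_pos, one_lt_two⟩
  have hχs : ContDiff ℝ ∞ χ := χ.contDiff
  obtain ⟨B, hB⟩ := (χ.hasCompactSupport.fderiv ℝ).exists_bound_of_continuous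
    (hχs.continuous_fderiv (by simp))
  have hB0 : 0 ≤ B := (norm_nonneg _).trans (hB 0)
  let r : ℕ → ℝ := fun n => ((n : ℝ) + 1)⁻¹
  have hr0 : ∀ n, 0 < r n := fun n => by positivity
  have hr1 : ∀ n, r n ≤ 1 := fun n => inv_le_one_of_one_le₀ (by
    have : (0 : ℝ) ≤ n := n.cast_nonneg
    linarith)
  have hrlim : Tendsto r atTop (𝓝 0) := by
    have := tendsto_one_div_add_atTop_nhds_zero_nat (𝕜 := ℝ)
    simpa [r] using this
  let ψn : ℕ → Rd d → ℝ := fun n x => ψ x * χ (r n • x)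
  have hsm : ∀ n, ContDiff ℝ ∞ fun x : Rd d => χ (r n • x) := fun n =>
    hχs.comp (contDiff_id.const_smul (r n))
  have hψn : ∀ n, ContDiff ℝ ∞ (ψn n) := fun n => hψ.mul (hsm n)
  have hψnc : ∀ n, HasCompactSupport (ψn n) := fun n => by
    refine HasCompactSupport.mul_left ?_
    have := χ.hasCompactSupport.comp_homeomorph (Homeomorph.smulOfNeZero (r n) (hr0 n).ne')
    exact this
  have hfd : ∀ n x, HasFDerivAt (ψn n)
      (ψ x • (r n • fderiv ℝ χ (r n • x)) + χ (r n • x) • fderiv ℝ ψ x) x := fun n x => by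
    have e1 : HasFDerivAt (fun x : Rd d => χ (r n • x)) (r n • fderiv ℝ χ (r n • x)) x := by
      have h1 := (hχs.differentiable (by simp) (r n • x)).hasFDerivAt.comp x
        ((hasFDerivAt_id x).const_smul (r n))
      refine h1.congr_fderiv ?_
      ext v; simp
    exact (hψ.differentiable (by simp) x).hasFDerivAt.mul e1
  set C₁ := C * (1 + 2 * B)
  have hC₁ : 0 ≤ C₁ := by positivity
  have hCC₁ : C ≤ C₁ := by
    have : 0 ≤ C * B := by positivity
    simp only [C₁]; linarith
  have b1n : ∀ n x, ‖fderiv ℝ (ψn n) x‖ ≤ C₁ * (1 + ‖x‖) := fun n x => by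
    rw [(hfd n x).fderiv]
    have e1 : ‖χ (r n • x) • fderiv ℝ ψ x‖ ≤ C * (1 + ‖x‖) := by
      rw [norm_smul, Real.norm_of_nonneg χ.nonneg]
      exact (mul_le_of_le_one_left (norm_nonneg _) χ.le_one).trans (b1 x)
    have e2 : ‖ψ x • (r n • fderiv ℝ χ (r n • x))‖ ≤ C * (1 + 2 * ‖x‖) * B := by
      rcases le_or_gt ‖r n • x‖ 2 with hx | hx
      · rw [norm_smul, norm_smul, Real.norm_eq_abs, Real.norm_of_nonneg (hr0 n).le, ← mul_assoc]
        refine mul_le_mul ?_ (hB _) (norm_nonneg _) (by positivity)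
        calc |ψ x| * r n ≤ C * (1 + ‖x‖ ^ 2) * r n := by
              exact mul_le_mul_of_nonneg_right (b0 x) (hr0 n).le
          _ = C * (r n + ‖r n • x‖ * ‖x‖) := by
              rw [norm_smul, Real.norm_of_nonneg (hr0 n).le]; ring
          _ ≤ C * (1 + 2 * ‖x‖) := by
              have := hr1 n
              gcongr
      · have e3 : fderiv ℝ χ (r n • x) = 0 := by
          by_contra hne
          have := support_fderiv_subset ℝ hne
          rw [χ.tsupport_eq, mem_closedBall_zero_iff] at this
          exact absurd this (not_le.2 hx)
        rw [e3, smul_zero, smul_zero, norm_zero]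
        positivity
    refine (norm_add_le _ _).trans ((add_le_add e2 e1).trans ?_)
    have : 0 ≤ C * B := by positivity
    simp only [C₁]
    nlinarith [norm_nonneg x, mul_nonneg this (norm_nonneg x)]
  have b0n : ∀ n x, |ψn n x| ≤ C * (1 + ‖x‖ ^ 2) := fun n x => by
    rw [abs_mul, abs_of_nonneg χ.nonneg]
    exact (mul_le_of_le_one_right (abs_nonneg _) χ.le_one).trans (b0 x)
  -- near a given point the cutoff is eventually inactive
  have hev : ∀ x, ∀ᶠ n in atTop, ψn n =ᶠ[𝓝 x] ψ := fun x => by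
    have e1 : ∀ᶠ n in atTop, r n * (‖x‖ + 1) < 1 := by
      have := hrlim.mul_const (‖x‖ + 1)
      rw [zero_mul] at this
      exact this.eventually_lt_const one_pos
    filter_upwards [e1] with n hn
    have e2 : ∀ᶠ y in 𝓝 x, ‖y‖ < ‖x‖ + 1 :=
      continuous_norm.continuousAt.eventually_lt_const (lt_add_one _)
    filter_upwards [e2] with y hy
    simp only [ψn]
    rw [χ.one_of_mem_closedBall, mul_one]
    rw [mem_closedBall_zero_iff, norm_smul, Real.norm_of_nonneg (hr0 n).le]
    exact ((mul_le_mul_of_nonneg_left hy.le (hr0 n).le).trans hn.le)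
  let v : ℝ → ℝ := fun s => ∫ x, fderiv ℝ ψ x (lin (A s) x + c s) ∂(μ s)
  let vn : ℕ → ℝ → ℝ := fun n s => ∫ x, fderiv ℝ (ψn n) x (lin (A s) x + c s) ∂(μ s)
  have hfc : Continuous (fderiv ℝ ψ) := hψ.continuous_fderiv (by simp)
  have hfnc : ∀ n, Continuous (fderiv ℝ (ψn n)) := fun n => (hψn n).continuous_fderiv (by simp)
  have hv : ContinuousOn v (Ici 0) :=
    continuousOn_integral_affine h.prob h.integrable_sq h.continuousOn_integral
      h.continuousOn_linear h.continuousOn_const hfc hC b1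
  have hvn : ∀ n, ContinuousOn (vn n) (Ici 0) := fun n =>
    continuousOn_integral_affine h.prob h.integrable_sq h.continuousOn_integral
      h.continuousOn_linear h.continuousOn_const (hfnc n) hC₁ (b1n n)
  have hpt : ∀ n s x, ‖fderiv ℝ (ψn n) x (lin (A s) x + c s)‖ ≤
      2 * C₁ * (‖A s‖ + ‖c s‖) * (1 + ‖x‖ ^ 2) := fun n s x => by
    refine ((fderiv ℝ (ψn n) x).le_opNorm _).trans ?_
    calc _ ≤ (C₁ * (1 + ‖x‖)) * ((‖A s‖ + ‖c s‖) * (1 + ‖x‖)) :=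
          mul_le_mul (b1n n x) (norm_affine_le _ _ _) (norm_nonneg _) (by positivity)
      _ = C₁ * (‖A s‖ + ‖c s‖) * ((1 + ‖x‖) * (1 + ‖x‖)) := by ring
      _ ≤ C₁ * (‖A s‖ + ‖c s‖) * (2 * (1 + ‖x‖ ^ 2)) :=
          mul_le_mul_of_nonneg_left (one_add_mul_one_add_le _) (by positivity)
      _ = _ := by ring
  have hone : ∀ s, 0 ≤ s → Integrable (fun x : Rd d => 1 + ‖x‖ ^ 2) (μ s) := fun s hs => by
    have := h.prob s hs
    exact (integrable_const _).add (h.integrable_sq s hs)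
  have hsq : ContinuousOn (fun s => ∫ x : Rd d, (1 + ‖x‖ ^ 2) ∂(μ s)) (Ici 0) :=
    h.continuousOn_integral _ (by fun_prop) 1 fun x => by
      rw [one_mul, abs_of_nonneg (by positivity)]
  have hulim : ∀ s, 0 ≤ s → Tendsto (fun n => ∫ x, ψn n x ∂(μ s)) atTop
      (𝓝 (∫ x, ψ x ∂(μ s))) := fun s hs =>
    tendsto_integral_of_dominated_convergence (fun x => C * (1 + ‖x‖ ^ 2))
      (fun n => (hψn n).continuous.aestronglyMeasurable) ((hone s hs).const_mul C)
      (fun n => Eventually.of_forall fun x => b0n n x)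
      (Eventually.of_forall fun x => tendsto_const_nhds.congr' (by
        filter_upwards [hev x] with n hn
        exact hn.eq_of_nhds.symm))
  have hvlim : ∀ s, 0 ≤ s → Tendsto (fun n => vn n s) atTop (𝓝 (v s)) := fun s hs =>
    tendsto_integral_of_dominated_convergence
      (fun x => 2 * C₁ * (‖A s‖ + ‖c s‖) * (1 + ‖x‖ ^ 2))
      (fun n => ((hfnc n).clm_apply (by fun_prop)).aestronglyMeasurable)
      ((hone s hs).const_mul _)
      (fun n => Eventually.of_forall fun x => hpt n s x)
      (Eventually.of_forall fun x => tendsto_const_nhds.congr' (by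
        filter_upwards [hev x] with n hn
        rw [hn.fderiv_eq]))
  refine hasDerivWithinAt_of_integral_eq hv (fun T hT => ?_) ht
  have hsub : Icc 0 T ⊆ Ici (0 : ℝ) := Icc_subset_Ici_self
  have hn : ∀ n, (∫ x, ψn n x ∂(μ T)) = (∫ x, ψn n x ∂(μ 0)) - ∫ s in (0 : ℝ)..T, vn n s := by
    intro n
    have hd := h.hasDerivWithinAt_test (ψn n) (hψn n) (hψnc n)
    have := intervalIntegral.integral_eq_sub_of_hasDeriv_right_of_le hT
      (f := fun s => ∫ x, ψn n x ∂(μ s)) (f' := fun s => -vn n s)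
      (fun s hs => (hd s hs.1).continuousWithinAt.mono hsub)
      (fun s hs => (hd s hs.1.le).mono ((Ioi_subset_Ioi hs.1.le).trans Ioi_subset_Ici_self))
      ((((hvn n).mono hsub).neg).intervalIntegrable_of_Icc hT)
    rw [intervalIntegral.integral_neg] at this
    linarith
  have hint : Tendsto (fun n => ∫ s in (0 : ℝ)..T, vn n s) atTop (𝓝 (∫ s in (0 : ℝ)..T, v s)) := by
    refine intervalIntegral.tendsto_integral_filter_of_dominated_convergence
      (fun s => 2 * C₁ * (‖A s‖ + ‖c s‖) * ∫ x : Rd d, (1 + ‖x‖ ^ 2) ∂(μ s))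
      (Eventually.of_forall fun n => ?_) (Eventually.of_forall fun n => ?_) ?_ ?_
    · rw [uIoc_of_le hT]
      exact (((hvn n).mono hsub).mono Ioc_subset_Icc_self).aestronglyMeasurable measurableSet_Ioc
    · refine Eventually.of_forall fun s hs => ?_
      rw [uIoc_of_le hT] at hs
      rw [← integral_const_mul]
      exact norm_integral_le_of_norm_le ((hone s hs.1.le).const_mul _)
        (Eventually.of_forall fun x => hpt n s x)
    · refine ContinuousOn.intervalIntegrable_of_Icc hT ?_
      exact (((_root_.continuousOn_const.mul (h.continuousOn_linear.norm.add
        h.continuousOn_const.norm)).mul hsq).mono hsub)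
    · refine Eventually.of_forall fun s hs => ?_
      rw [uIoc_of_le hT] at hs
      exact hvlim s hs.1.le
  refine tendsto_nhds_unique (hulim T hT) ?_
  simp_rw [hn]
  exact (hulim 0 le_rfl).sub hint

/-! ### Transport along characteristics -/

/-- A product rule in which the second factor only has to be continuous, because the first one
vanishes at the point. -/
theorem hasDerivWithinAt_mul_of_eq_zero {a b : ℝ → ℝ} {a' t : ℝ} {s : Set ℝ}
    (ha : HasDerivWithinAt a a' s t) (ha0 : a t = 0) (hb : ContinuousWithinAt b s t) :
    HasDerivWithinAt (fun r => a r * b r) (a' * b t) s t := by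
  rw [hasDerivWithinAt_iff_tendsto_slope] at ha ⊢
  refine (ha.mul (hb.mono sdiff_subset).tendsto).congr fun r => ?_
  simp only [slope, vsub_eq_sub, smul_eq_mul, ha0, sub_zero, zero_mul]
  ring

theorem hasDerivWithinAt_zero_of_abs_le {a b : ℝ → ℝ} {t : ℝ} {s : Set ℝ}
    (hb : HasDerivWithinAt b 0 s t) (hb0 : b t = 0) (ht : t ∈ s)
    (h : ∀ r ∈ s, |a r| ≤ b r) : HasDerivWithinAt a 0 s t := by
  have ha0 : a t = 0 := abs_nonpos_iff.1 ((h t ht).trans hb0.le)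
  rw [hasDerivWithinAt_iff_isLittleO] at hb ⊢
  simp only [smul_zero, sub_zero, hb0, ha0] at hb ⊢
  refine Asymptotics.IsBigO.trans_isLittleO ?_ hb
  refine Asymptotics.IsBigO.of_bound 1 ?_
  filter_upwards [self_mem_nhdsWithin] with r hr
  rw [one_mul, Real.norm_eq_abs, Real.norm_eq_abs]
  exact (h r hr).trans (le_abs_self _)

theorem abs_sub_sub_le_sq {g : ℝ → ℝ} (hg : Differentiable ℝ g)
    (hlip : ∀ r s, |deriv g r - deriv g s| ≤ |r - s|) (r s : ℝ) :
    |g r - g s - deriv g s * (r - s)| ≤ (r - s) ^ 2 := by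
  have hd : ∀ y, HasDerivAt (fun y => g y - deriv g s * y) (deriv g y - deriv g s) y := fun y => by
    refine ((hg y).hasDerivAt.sub ((hasDerivAt_id y).const_mul (deriv g s))).congr_deriv ?_
    rw [mul_one]
  have := (convex_uIcc s r).norm_image_sub_le_of_norm_hasDerivWithin_le (C := |r - s|)
    (fun y _ => (hd y).hasDerivWithinAt) (fun y hy => by
      exact (hlip y s).trans (abs_sub_left_of_mem_uIcc hy)) left_mem_uIcc right_mem_uIcc
  rw [Real.norm_eq_abs, Real.norm_eq_abs, ← pow_two, sq_abs] at this
  convert this using 2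
  ring

/-- For a transport by linear fields and a curve `ξ` solving the adjoint equation, the integrals of
`x ↦ g ⟪ξ t, x⟫` do not depend on time. The derivative at `t` is computed from the splitting of
the increment of the integral into the increment for the fixed `ξ t`, the part that is linear in
`ξ s - ξ t`, and a remainder of order `‖ξ s - ξ t‖²`. -/
theorem IsAffineTransport.integral_characteristic_eq {A : ℝ → Mat d} {μ : ℝ → Measure (Rd d)}
    (h : IsAffineTransport A (fun _ => 0) μ) {ξ : ℝ → Rd d}
    (hξ : ∀ t, 0 ≤ t → HasDerivWithinAt ξ (lin (A t)ᵀ (ξ t)) (Ici 0) t) {g : ℝ → ℝ}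
    (hg : ContDiff ℝ ∞ g) (hg0 : ∀ r, |g r| ≤ 1) (hg1 : ∀ r, |deriv g r| ≤ 1)
    (hlip : ∀ r s, |deriv g r - deriv g s| ≤ |r - s|) {T : ℝ} (hT : 0 ≤ T) :
    ∫ x, g (inner ℝ (ξ T) x) ∂(μ T) = ∫ x, g (inner ℝ (ξ 0) x) ∂(μ 0) := by
  have hg' : Continuous (deriv g) := hg.continuous_deriv (by simp)
  have hcoord : ∀ (x : Rd d) i, |x i| ≤ ‖x‖ := fun x i => by simpa using PiLp.norm_apply_le x i
  have key : ∀ t, 0 ≤ t →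
      HasDerivWithinAt (fun s => ∫ x, g (inner ℝ (ξ s) x) ∂(μ s)) 0 (Ici 0) t := by
    intro t ht
    let ψ : Rd d → ℝ := fun x => g (inner ℝ (ξ t) x)
    have hψ : ContDiff ℝ ∞ ψ := hg.comp (contDiff_const.inner ℝ contDiff_id)
    have hψd : ∀ x v, fderiv ℝ ψ x v = deriv g (inner ℝ (ξ t) x) * inner ℝ (ξ t) v := by
      intro x v
      have h1 : HasFDerivAt ψ (deriv g (inner ℝ (ξ t) x) • innerSL ℝ (ξ t)) x :=
        ((hg.differentiable (by simp) _).hasDerivAt).comp_hasFDerivAt x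
          (innerSL ℝ (ξ t)).hasFDerivAt
      rw [h1.fderiv]; rfl
    have hle : ∀ r : ℝ, 0 ≤ r → 1 ≤ (1 + ‖ξ t‖) * (1 + r) ∧ ‖ξ t‖ ≤ (1 + ‖ξ t‖) * (1 + r) := by
      intro r hr
      have h1 := norm_nonneg (ξ t)
      have h2 := mul_nonneg h1 hr
      constructor <;> linarith
    have hF2 := h.hasDerivWithinAt hψ (C := 1 + ‖ξ t‖) (by positivity)
      (fun x => (hg0 _).trans (hle _ (sq_nonneg ‖x‖)).1)
      (fun x => by
        refine (ContinuousLinearMap.opNorm_le_bound _ (norm_nonneg (ξ t)) fun v => ?_).trans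
          (hle _ (norm_nonneg x)).2
        rw [hψd, norm_mul, Real.norm_eq_abs]
        exact (mul_le_of_le_one_left (norm_nonneg _) (hg1 _)).trans (norm_inner_le_norm _ _)) ht
    simp only [hψd, add_zero] at hF2
    -- the coefficients of the part that is linear in `ξ s - ξ t`
    let G : Fin d → ℝ → ℝ := fun i s => ∫ x, deriv g (inner ℝ (ξ t) x) * x i ∂(μ s)
    have cG : ∀ i, Continuous fun x : Rd d => deriv g (inner ℝ (ξ t) x) * x i := fun i =>
      (hg'.comp (by fun_prop)).mul (by fun_prop)
    have bG : ∀ i (x : Rd d), |deriv g (inner ℝ (ξ t) x) * x i| ≤ 1 * (1 + ‖x‖ ^ 2) := fun i x => by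
      rw [abs_mul, one_mul]
      exact ((mul_le_of_le_one_left (abs_nonneg _) (hg1 _)).trans (hcoord x i)).trans
        (norm_le_one_add_sq _)
    have iG : ∀ i s, 0 ≤ s → Integrable (fun x : Rd d => deriv g (inner ℝ (ξ t) x) * x i) (μ s) :=
      fun i s hs => by
        have := h.prob s hs
        exact integrable_of_quadratic (h.integrable_sq s hs) (cG i).aestronglyMeasurable (bG i)
    have hG : ∀ i, ContinuousOn (G i) (Ici 0) := fun i => h.continuousOn_integral _ (cG i) 1 (bG i)
    have hexp : ∀ (z : Rd d) s, 0 ≤ s → ∑ i, z i * G i s =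
        ∫ x, deriv g (inner ℝ (ξ t) x) * inner ℝ z x ∂(μ s) := by
      intro z s hs
      simp only [G]
      simp_rw [← integral_const_mul]
      rw [← integral_finsetSum _ fun i _ => (iG i s hs).const_mul _]
      refine integral_congr_ae (Eventually.of_forall fun x => ?_)
      simp only [PiLp.inner_apply, RCLike.inner_apply, conj_trivial, Finset.mul_sum]
      exact Finset.sum_congr rfl fun i _ => by ring
    have hF1 : HasDerivWithinAt (fun s => ∑ i, (ξ s - ξ t) i * G i s)
        (∑ i, (lin (A t)ᵀ (ξ t)) i * G i t) (Ici 0) t := by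
      refine HasDerivWithinAt.fun_sum fun i _ => ?_
      refine hasDerivWithinAt_mul_of_eq_zero ?_ (by simp) (hG i t ht)
      exact (EuclideanSpace.proj i : Rd d →L[ℝ] ℝ).hasFDerivAt.comp_hasDerivWithinAt t
        ((hξ t ht).sub_const (ξ t))
    have hF3 : HasDerivWithinAt (fun s => (∫ x, g (inner ℝ (ξ s) x) ∂(μ s)) - (∫ x, ψ x ∂(μ s))
        - ∑ i, (ξ s - ξ t) i * G i s) 0 (Ici 0) t := by
      have hb : HasDerivWithinAt (fun s => ‖ξ s - ξ t‖ ^ 2 * ∫ x : Rd d, ‖x‖ ^ 2 ∂(μ s)) 0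
          (Ici 0) t := by
        have h1 := ((hξ t ht).sub_const (ξ t)).norm_sq
        rw [sub_self, inner_zero_left, mul_zero] at h1
        have h2 := hasDerivWithinAt_mul_of_eq_zero h1 (by simp)
          (h.continuousOn_integral (fun x => ‖x‖ ^ 2) (by fun_prop) 1 (fun x => by
            rw [abs_of_nonneg (sq_nonneg _)]; linarith) t ht)
        rwa [zero_mul] at h2
      refine hasDerivWithinAt_zero_of_abs_le hb (by simp) ht fun s hs => ?_
      have hps := h.prob s hs
      have i1 : ∀ z : Rd d, Integrable (fun x : Rd d => g (inner ℝ z x)) (μ s) := fun z =>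
        (integrable_const (1 : ℝ)).mono' (hg.continuous.comp (by fun_prop)).aestronglyMeasurable
          (Eventually.of_forall fun x => hg0 _)
      have i2 : Integrable (fun x => deriv g (inner ℝ (ξ t) x) * inner ℝ (ξ s - ξ t) x) (μ s) := by
        refine integrable_of_quadratic (h.integrable_sq s hs)
          ((hg'.comp (by fun_prop)).mul (by fun_prop)).aestronglyMeasurable
          (C := ‖ξ s - ξ t‖) fun x => ?_
        rw [norm_mul, Real.norm_eq_abs]
        refine (mul_le_of_le_one_left (norm_nonneg _) (hg1 _)).trans
          ((norm_inner_le_norm _ _).trans ?_)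
        exact mul_le_mul_of_nonneg_left (norm_le_one_add_sq _) (norm_nonneg _)
      have i3 : Integrable (fun x => g (inner ℝ (ξ s) x) - g (inner ℝ (ξ t) x)) (μ s) :=
        (i1 _).sub (i1 _)
      rw [hexp _ s hs, ← integral_sub (i1 _) (i1 _), ← integral_sub i3 i2,
        ← integral_const_mul]
      rw [← Real.norm_eq_abs]
      refine norm_integral_le_of_norm_le ((h.integrable_sq s hs).const_mul _)
        (Eventually.of_forall fun x => ?_)
      rw [inner_sub_left, Real.norm_eq_abs]
      refine (abs_sub_sub_le_sq (hg.differentiable (by simp)) hlip _ _).trans ?_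
      rw [← inner_sub_left, ← mul_pow, ← sq_abs]
      gcongr
      exact abs_real_inner_le_norm _ _
    have hsum := (hF3.add hF2).add hF1
    have hzero : (0 + -∫ x, deriv g (inner ℝ (ξ t) x) * inner ℝ (ξ t) (lin (A t) x) ∂(μ t)) +
        ∑ i, (lin (A t)ᵀ (ξ t)) i * G i t = 0 := by
      rw [hexp _ t ht]
      simp_rw [inner_lin_left, Matrix.transpose_transpose]
      ring
    rw [hzero] at hsum
    refine hsum.congr_of_mem (fun s _ => ?_) ht
    simp only [Pi.add_apply]
    ring
  exact constant_of_has_deriv_right_zero (a := 0) (b := T)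
    (fun t ht => (key t ht.1).continuousWithinAt.mono Icc_subset_Ici_self)
    (fun t ht => (key t ht.1).mono (Ici_subset_Ici.2 ht.1)) T ⟨hT, le_rfl⟩

/-- A transport by linear fields is the push-forward of its initial value under the flow. -/
theorem IsAffineTransport.eq_map {A Φ : ℝ → Mat d} {μ : ℝ → Measure (Rd d)}
    (h : IsAffineTransport A (fun _ => 0) μ) (hΦ0 : Φ 0 = 1) (hdet : ∀ t, (Φ t).det ≠ 0)
    (hΦ : ∀ t, 0 ≤ t → HasDerivAt Φ (-(A t * Φ t)) t) {T : ℝ} (hT : 0 ≤ T) :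
    μ T = (μ 0).map (lin (Φ T)) := by
  have := h.prob T hT
  have := h.prob 0 le_rfl
  have : IsProbabilityMeasure ((μ 0).map (lin (Φ T))) :=
    Measure.isProbabilityMeasure_map (by fun_prop)
  have hlin : ∀ v : Rd d, ∃ F : Mat d →L[ℝ] Rd d, ∀ X, F X = lin X v := fun v =>
    ⟨LinearMap.toContinuousLinearMap
      { toFun := fun X => lin X v
        map_add' := fun X Y => lin_add_apply X Y v
        map_smul' := fun r X => lin_smul_apply r X v }, fun X => rfl⟩
  apply Measure.ext_of_charFun
  ext η
  set ξ : ℝ → Rd d := fun t => lin ((Φ t)⁻¹)ᵀ (lin (Φ T)ᵀ η)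
  have hξ : ∀ t, 0 ≤ t → HasDerivWithinAt ξ (lin (A t)ᵀ (ξ t)) (Ici 0) t := by
    intro t ht
    obtain ⟨F, hF⟩ := hlin (lin (Φ T)ᵀ η)
    have h1 := hasDerivAt_transpose (hasDerivAt_matrix_inv (hΦ t ht) (hdet t))
    have h2 := (F.hasFDerivAt.comp_hasDerivAt t h1).hasDerivWithinAt (s := Ici 0)
    have h3 : (F ∘ fun s => ((Φ s)⁻¹)ᵀ) = ξ := funext fun s => hF _
    rw [h3] at h2
    refine h2.congr_deriv ?_
    rw [hF, ← lin_mul_apply (A t)ᵀ, ← Matrix.transpose_mul]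
    congr 3
    rw [mul_neg, neg_mul, neg_neg, mul_assoc, mul_assoc,
      Matrix.mul_nonsing_inv _ (isUnit_iff_ne_zero.2 (hdet t)), mul_one]
  have hξT : ξ T = η := by
    simp only [ξ]
    rw [← lin_mul_apply, ← Matrix.transpose_mul,
      Matrix.mul_nonsing_inv _ (isUnit_iff_ne_zero.2 (hdet T)), Matrix.transpose_one, lin_one_apply]
  have hξ0 : ∀ x, inner ℝ (ξ 0) x = inner ℝ η (lin (Φ T) x) := by
    intro x
    simp only [ξ, hΦ0, inv_one, Matrix.transpose_one, lin_one_apply]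
    rw [inner_lin_left, Matrix.transpose_transpose]
  have hcos := h.integral_characteristic_eq hξ Real.contDiff_cos Real.abs_cos_le_one
    (fun r => by rw [Real.deriv_cos, abs_neg]; exact Real.abs_sin_le_one r)
    (fun r s => by
      rw [Real.deriv_cos, Real.deriv_cos, neg_sub_neg, abs_sub_comm]
      exact Real.abs_sin_sub_sin_le r s) hT
  have hsin := h.integral_characteristic_eq hξ Real.contDiff_sin Real.abs_sin_le_one
    (fun r => by rw [Real.deriv_sin]; exact Real.abs_cos_le_one r)
    (fun r s => by
      rw [Real.deriv_sin]
      exact Real.abs_cos_sub_cos_le r s) hT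
  rw [hξT] at hcos hsin
  simp_rw [hξ0] at hcos hsin
  have hexp : ∀ (ρ : Measure (Rd d)) [IsProbabilityMeasure ρ] (f : Rd d → ℝ), Continuous f →
      ∫ x, Complex.exp (f x * Complex.I) ∂ρ =
        (∫ x, Real.cos (f x) ∂ρ : ℝ) + (∫ x, Real.sin (f x) ∂ρ : ℝ) * Complex.I := by
    intro ρ _ f hf
    have i1 : Integrable (fun x => Real.cos (f x)) ρ :=
      (integrable_const (1 : ℝ)).mono' (by fun_prop)
        (Eventually.of_forall fun x => Real.abs_cos_le_one _)
    have i2 : Integrable (fun x => Real.sin (f x)) ρ :=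
      (integrable_const (1 : ℝ)).mono' (by fun_prop)
        (Eventually.of_forall fun x => Real.abs_sin_le_one _)
    rw [← integral_complex_ofReal, ← integral_complex_ofReal, ← integral_mul_const,
      ← integral_add i1.ofReal (i2.ofReal.mul_const _)]
    refine integral_congr_ae (Eventually.of_forall fun x => ?_)
    simp only [Complex.exp_mul_I, Complex.ofReal_cos, Complex.ofReal_sin]
  rw [charFun_apply, charFun_apply, integral_map (by fun_prop) (by fun_prop)]
  simp_rw [real_inner_comm η]
  rw [hexp (μ T) _ (by fun_prop), hexp (μ 0) _ (by fun_prop), hcos, hsin]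

/-! ### Evolution of the first and second moments -/

theorem hasDerivWithinAt_of_coord {f : ℝ → Rd d} {f' : Rd d} {s : Set ℝ} {t : ℝ}
    (h : ∀ i, HasDerivWithinAt (fun r => f r i) (f' i) s t) : HasDerivWithinAt f f' s t := by
  have hexp : ∀ y : Rd d, y = ∑ i, y i • EuclideanSpace.single i (1 : ℝ) := fun y => by
    have := (EuclideanSpace.basisFun (Fin d) ℝ).sum_repr y
    simpa using this.symm
  rw [hexp f', show f = fun r => ∑ i, f r i • EuclideanSpace.single i (1 : ℝ) from
    funext fun r => hexp (f r)]
  exact HasDerivWithinAt.fun_sum fun i _ => (h i).smul_const _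

theorem hasDerivWithinAt_of_entry {f : ℝ → Mat d} {f' : Mat d} {s : Set ℝ} {t : ℝ}
    (h : ∀ i j, HasDerivWithinAt (fun r => f r i j) (f' i j) s t) :
    HasDerivWithinAt f f' s t := by
  have hexp : ∀ M : Mat d, M = ∑ i, ∑ j, M i j • Matrix.single i j (1 : ℝ) := fun M => by
    conv_lhs => rw [Matrix.matrix_eq_sum_single M]
    simp [Matrix.smul_single]
  rw [hexp f', show f = fun r => ∑ i, ∑ j, f r i j • Matrix.single i j (1 : ℝ) from
    funext fun r => hexp (f r)]
  exact HasDerivWithinAt.fun_sum fun i _ => HasDerivWithinAt.fun_sum fun j _ =>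
    (h i j).smul_const _

theorem abs_coord_le (x : Rd d) (i : Fin d) : |x i| ≤ ‖x‖ := by
  simpa using PiLp.norm_apply_le x i

theorem integral_coord {μ : Measure (Rd d)} [IsFiniteMeasure μ]
    (h2 : Integrable (fun x => ‖x‖ ^ 2) μ) (i : Fin d) : (∫ x, x ∂μ) i = ∫ x : Rd d, x i ∂μ :=
  ((EuclideanSpace.proj i : Rd d →L[ℝ] ℝ).integral_comp_comm (integrable_id_of_sq h2)).symm

theorem integrable_coord_mul {μ : Measure (Rd d)} [IsFiniteMeasure μ]
    (h2 : Integrable (fun x => ‖x‖ ^ 2) μ) (i j : Fin d) :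
    Integrable (fun x : Rd d => x i * x j) μ :=
  integrable_of_quadratic h2 (C := 1) (by fun_prop) fun x => by
    rw [norm_mul, Real.norm_eq_abs, Real.norm_eq_abs]
    have := mul_le_mul (abs_coord_le x i) (abs_coord_le x j) (abs_nonneg _) (norm_nonneg _)
    rw [← pow_two] at this
    linarith

theorem IsAffineTransport.hasDerivWithinAt_mean {A : ℝ → Mat d} {c : ℝ → Rd d}
    {μ : ℝ → Measure (Rd d)} (h : IsAffineTransport A c μ) {t : ℝ} (ht : 0 ≤ t) :
    HasDerivWithinAt (fun s => ∫ x, x ∂(μ s)) (-(lin (A t) (∫ x, x ∂(μ t)) + c t)) (Ici 0) t := by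
  refine hasDerivWithinAt_of_coord fun i => ?_
  have hpt := h.prob t ht
  have h1 := h.hasDerivWithinAt (ψ := fun x => x i) (by fun_prop) zero_le_one
    (fun x => by
      rw [one_mul]; exact (abs_coord_le x i).trans (norm_le_one_add_sq _))
    (fun x => by
      have : fderiv ℝ (fun x : Rd d => x i) x = (EuclideanSpace.proj i : Rd d →L[ℝ] ℝ) :=
        (EuclideanSpace.proj i : Rd d →L[ℝ] ℝ).hasFDerivAt.fderiv
      rw [this]
      refine ContinuousLinearMap.opNorm_le_bound _ (by positivity) fun v => ?_
      refine (abs_coord_le v i).trans ?_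
      nlinarith [norm_nonneg v, norm_nonneg x, mul_nonneg (norm_nonneg x) (norm_nonneg v)]) ht
  have h2 : ∀ x v : Rd d, fderiv ℝ (fun x : Rd d => x i) x v = v i := fun x v => by
    have : fderiv ℝ (fun x : Rd d => x i) x = (EuclideanSpace.proj i : Rd d →L[ℝ] ℝ) :=
      (EuclideanSpace.proj i : Rd d →L[ℝ] ℝ).hasFDerivAt.fderiv
    rw [this]; rfl
  simp only [h2] at h1
  have h3 : (∫ x, (lin (A t) x + c t) i ∂(μ t)) = (lin (A t) (∫ x, x ∂(μ t)) + c t) i := by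
    have hid := integrable_id_of_sq (h.integrable_sq t ht)
    have h4 := (EuclideanSpace.proj i : Rd d →L[ℝ] ℝ).integral_comp_comm
      (integrable_affine (h.integrable_sq t ht) (A t) (c t))
    refine h4.trans ?_
    rw [integral_add ((lin (A t)).integrable_comp hid) (integrable_const _),
      (lin (A t)).integral_comp_comm hid, integral_const]
    simp
  rw [h3] at h1
  exact h1.congr (fun s hs => by
    have := h.prob s hs
    exact integral_coord (h.integrable_sq s hs) i) (integral_coord (h.integrable_sq t ht) i)

theorem IsAffineTransport.hasDerivWithinAt_secondMoment {A : ℝ → Mat d}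
    {μ : ℝ → Measure (Rd d)} (h : IsAffineTransport A (fun _ => 0) μ) {t : ℝ} (ht : 0 ≤ t) :
    HasDerivWithinAt (fun s => secondMoment (μ s))
      (-(A t * secondMoment (μ t) + secondMoment (μ t) * (A t)ᵀ)) (Ici 0) t := by
  refine hasDerivWithinAt_of_entry fun i j => ?_
  have hpt := h.prob t ht
  have h2 : ∀ x : Rd d, HasFDerivAt (fun x : Rd d => x i * x j)
      (x i • (EuclideanSpace.proj j : Rd d →L[ℝ] ℝ)
        + x j • (EuclideanSpace.proj i : Rd d →L[ℝ] ℝ)) x := fun x =>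
    (EuclideanSpace.proj i : Rd d →L[ℝ] ℝ).hasFDerivAt.mul
      (EuclideanSpace.proj j : Rd d →L[ℝ] ℝ).hasFDerivAt
  have h1 := h.hasDerivWithinAt (ψ := fun x => x i * x j) (by fun_prop) zero_le_two
    (fun x => by
      rw [abs_mul]
      have := mul_le_mul (abs_coord_le x i) (abs_coord_le x j) (abs_nonneg _) (norm_nonneg _)
      nlinarith [sq_nonneg ‖x‖])
    (fun x => by
      rw [(h2 x).fderiv]
      refine ContinuousLinearMap.opNorm_le_bound _ (by positivity) fun v => ?_
      have e1 := mul_le_mul (abs_coord_le x i) (abs_coord_le v j) (abs_nonneg _) (norm_nonneg _)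
      have e2 := mul_le_mul (abs_coord_le x j) (abs_coord_le v i) (abs_nonneg _) (norm_nonneg _)
      rw [← abs_mul] at e1 e2
      refine (abs_add_le (x i * v j) (x j * v i)).trans ?_
      nlinarith [norm_nonneg v]) ht
  have h3 : ∀ x v : Rd d, fderiv ℝ (fun x : Rd d => x i * x j) x v = x i * v j + x j * v i :=
    fun x v => by rw [(h2 x).fderiv]; rfl
  simp only [h3, add_zero] at h1
  refine h1.congr_deriv ?_
  rw [Matrix.neg_apply, Matrix.add_apply, Matrix.mul_apply, Matrix.mul_apply]
  have h4 : ∀ (B : Mat d) (x : Rd d) k, (lin B x) k = ∑ l, B k l * x l := fun B x k => by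
    rw [Matrix.ofLp_toEuclideanCLM]; rfl
  have hi := fun k l => integrable_coord_mul (h.integrable_sq t ht) k l
  congr 1
  simp only [secondMoment, Matrix.of_apply, Matrix.transpose_apply, ← integral_const_mul,
    ← integral_mul_const]
  rw [← integral_finsetSum _ fun k _ => (hi k j).const_mul _,
    ← integral_finsetSum _ fun k _ => (hi i k).mul_const _,
    ← integral_add (integrable_finsetSum _ fun k _ => (hi k j).const_mul _)
      (integrable_finsetSum _ fun k _ => (hi i k).mul_const _)]
  refine integral_congr_ae (Eventually.of_forall fun x => ?_)
  simp only [h4, Finset.mul_sum]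
  rw [add_comm]
  congr 1 <;> exact Finset.sum_congr rfl fun k _ => by ring

/-! ### Uniqueness of weak solutions -/

theorem continuousOn_mean {μ : ℝ → Measure (Rd d)}
    (hp : ∀ t, 0 ≤ t → IsProbabilityMeasure (μ t))
    (h2 : ∀ t, 0 ≤ t → Integrable (fun x : Rd d => ‖x‖ ^ 2) (μ t))
    (hμ : ∀ f : Rd d → ℝ, Continuous f → ∀ C : ℝ,
      (∀ x, |f x| ≤ C * (1 + ‖x‖ ^ 2)) → ContinuousOn (fun t => ∫ x, f x ∂(μ t)) (Ici 0)) :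
    ContinuousOn (fun t => ∫ x, x ∂(μ t)) (Ici 0) := by
  have h1 : ContinuousOn (fun t => (WithLp.toLp 2 fun i => ∫ x : Rd d, x i ∂(μ t) : Rd d))
      (Ici 0) :=
    (PiLp.continuous_toLp 2 _).comp_continuousOn (continuousOn_pi.2 fun i =>
      hμ (fun x => x i) (by fun_prop) 1 fun x => by
        rw [one_mul]; exact (abs_coord_le x i).trans (norm_le_one_add_sq _))
  refine h1.congr fun t ht => ?_
  have := hp t ht
  ext i
  exact integral_coord (h2 t ht) i

theorem continuousOn_covMatrix {μ : ℝ → Measure (Rd d)}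
    (hp : ∀ t, 0 ≤ t → IsProbabilityMeasure (μ t))
    (h2 : ∀ t, 0 ≤ t → Integrable (fun x : Rd d => ‖x‖ ^ 2) (μ t))
    (hμ : ∀ f : Rd d → ℝ, Continuous f → ∀ C : ℝ,
      (∀ x, |f x| ≤ C * (1 + ‖x‖ ^ 2)) → ContinuousOn (fun t => ∫ x, f x ∂(μ t)) (Ici 0)) :
    ContinuousOn (fun t => covMatrix (μ t)) (Ici 0) := by
  have hm := continuousOn_mean hp h2 hμ
  have hmi : ∀ i, ContinuousOn (fun t => (∫ x, x ∂(μ t)) i) (Ici 0) := fun i =>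
    (by fun_prop : Continuous fun y : Rd d => y i).comp_continuousOn hm
  refine continuousOn_pi.2 fun i => continuousOn_pi.2 fun j => ?_
  refine ContinuousOn.sub (f := fun t => secondMoment (μ t) i j) ?_ ((hmi i).mul (hmi j))
  refine hμ (fun x => x i * x j) (by fun_prop) 1 fun x => ?_
  rw [abs_mul]
  have := mul_le_mul (abs_coord_le x i) (abs_coord_le x j) (abs_nonneg _) (norm_nonneg _)
  nlinarith [sq_nonneg ‖x‖]

theorem continuous_outer : Continuous fun p : Rd d × Rd d => outer p.1 p.2 := by
  refine continuous_pi fun i => continuous_pi fun j => ?_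
  simp only [Matrix.vecMulVec_apply]
  fun_prop

theorem continuousOn_centeredDrift {ν : ℝ} (hν₀ : 0 < ν) (hν₁ : ν ≤ 1) (Q : Mat d)
    {C : ℝ → Mat d} {m p : ℝ → Rd d} {s : Set ℝ} (hC : ContinuousOn C s) (hm : ContinuousOn m s)
    (hp : ContinuousOn p s) (hCp : ∀ t ∈ s, (C t).PosSemidef) :
    ContinuousOn (fun t => centeredDrift ν Q (C t) (m t) (p t)) s := by
  have h1 : ContinuousOn (fun t => centeredReg ν (C t) (p t)) s := by
    have := continuous_outer.comp_continuousOn (hp.prodMk hp)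
    unfold centeredReg regMatrix
    fun_prop
  have h2 : ContinuousOn (fun t => (centeredReg ν (C t) (p t))⁻¹) s := fun t ht =>
    (contDiffAt_matrix_inv (n := 0) (centeredReg_det_ne_zero hν₀ hν₁ (hCp t ht) (p t))
      ).continuousAt.comp_continuousWithinAt (f := fun t => centeredReg ν (C t) (p t)) (h1 t ht)
  have h3 := continuous_outer.comp_continuousOn (hm.prodMk hp)
  unfold centeredDrift
  exact (((continuousOn_const.mul hC).sub continuousOn_const).add
    ((continuousOn_const.mul h3).const_smul ν)).mul h2

theorem continuous_lin : Continuous fun q : Mat d × Rd d => lin q.1 q.2 := by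
  have h1 : (fun q : Mat d × Rd d => lin q.1 q.2) =
      fun q => WithLp.toLp 2 (q.1 *ᵥ q.2.ofLp) := by
    ext q i
    rw [Matrix.ofLp_toEuclideanCLM]
  rw [h1]
  exact (PiLp.continuous_toLp 2 _).comp
    (continuous_fst.matrix_mulVec ((PiLp.continuous_ofLp 2 _).comp continuous_snd))

theorem continuousOn_lin_apply {A : ℝ → Mat d} {v : ℝ → Rd d} {s : Set ℝ} (hA : ContinuousOn A s)
    (hv : ContinuousOn v s) : ContinuousOn (fun t => lin (A t) (v t)) s :=
  Continuous.comp_continuousOn' (g := fun q : Mat d × Rd d => lin q.1 q.2)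
    (f := fun t => (A t, v t)) continuous_lin (hA.prodMk hv)

/-- The linear part of the regularized velocity field of the law `μ`, for the kernel with center
`a`. -/
def velocityMatrix (ν : ℝ) (Q : Mat d) (μ : Measure (Rd d)) (a : Rd d) : Mat d :=
  centeredDrift ν Q (covMatrix μ) (∫ y, y ∂μ) ((∫ y, y ∂μ) - a)

/-- The value at the origin of the regularized velocity field of the law `μ`, for the kernel with
center `a`. -/
def velocityConst (ν : ℝ) (Q : Mat d) (μ : Measure (Rd d)) (a : Rd d) : Rd d :=
  lin Q⁻¹ (∫ y, y ∂μ) + ν • lin (velocityMatrix ν Q μ a) ((∫ y, y ∂μ) - a)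
    - lin (velocityMatrix ν Q μ a) (∫ y, y ∂μ)

theorem inner_gradient_left (f : Rd d → ℝ) (x v : Rd d) :
    inner ℝ (gradient f x) v = fderiv ℝ f x v := by
  rw [gradient, InnerProductSpace.toDual_symm_apply]

/-- The weak formulation of the continuity equation with an affine velocity, against test functions
in space and time, is a transport by affine fields. -/
theorem IsAffineTransport.of_weak {A : ℝ → Mat d} {c : ℝ → Rd d} {μ : ℝ → Measure (Rd d)}
    (hp : ∀ t, 0 ≤ t → IsProbabilityMeasure (μ t))
    (h2 : ∀ t, 0 ≤ t → Integrable (fun x : Rd d => ‖x‖ ^ 2) (μ t))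
    (hμ : ∀ f : Rd d → ℝ, Continuous f → ∀ C : ℝ,
      (∀ x, |f x| ≤ C * (1 + ‖x‖ ^ 2)) → ContinuousOn (fun t => ∫ x, f x ∂(μ t)) (Ici 0))
    (hA : ContinuousOn A (Ici 0)) (hc : ContinuousOn c (Ici 0)) {Ψ : ℝ → Rd d → Rd d}
    (hΨ : ∀ s, 0 ≤ s → ∀ x, Ψ s x = lin (A s) x + c s)
    (heq : ∀ φ : ℝ → Rd d → ℝ, ContDiff ℝ ∞ (fun p : ℝ × Rd d => φ p.1 p.2) →
      HasCompactSupport (fun p : ℝ × Rd d => φ p.1 p.2) →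
      (∫ t in Ioi (0 : ℝ), ∫ x, (deriv (fun s => φ s x) t - inner ℝ (gradient (φ t) x) (Ψ t x))
        ∂(μ t)) + ∫ x, φ 0 x ∂(μ 0) = 0) :
    IsAffineTransport A c μ := by
  refine ⟨hp, h2, hμ, hA, hc, fun ψ hψ hψc t ht => ?_⟩
  have hψ' : Continuous (fderiv ℝ ψ) := hψ.continuous_fderiv (by simp)
  obtain ⟨B, hB⟩ := hψc.exists_bound_of_continuous hψ.continuous
  obtain ⟨B', hB'⟩ := (hψc.fderiv ℝ).exists_bound_of_continuous hψ'
  have hB0 : 0 ≤ B := (norm_nonneg _).trans (hB 0)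
  have hB0' : 0 ≤ B' := (norm_nonneg _).trans (hB' 0)
  have hv := continuousOn_integral_affine hp h2 hμ hA hc hψ' hB0' fun x =>
    (hB' x).trans (le_mul_of_one_le_right hB0' (by linarith [norm_nonneg x]))
  refine hasDerivWithinAt_of_weak (hμ ψ hψ.continuous B fun x => (hB x).trans
    (le_mul_of_one_le_right hB0 (by linarith [sq_nonneg ‖x‖]))) hv (fun θ hθ hθc => ?_) ht
  have h4 := heq (fun t x => θ t * ψ x) ((hθ.comp contDiff_fst).mul (hψ.comp contDiff_snd)) (by
    refine HasCompactSupport.intro (hθc.isCompact.prod hψc.isCompact) fun q hq => ?_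
    by_contra hne
    exact hq ⟨subset_tsupport θ (left_ne_zero_of_mul hne),
      subset_tsupport ψ (right_ne_zero_of_mul hne)⟩)
  rw [integral_const_mul] at h4
  refine Eq.trans ?_ h4
  congr 1
  refine setIntegral_congr_fun measurableSet_Ioi fun s hs => ?_
  have hs0 : 0 ≤ s := le_of_lt hs
  have := hp s hs0
  have e1 : ∀ x, deriv (fun r => θ r * ψ x) s = deriv θ s * ψ x := fun x =>
    ((hθ.differentiable (by simp) s).hasDerivAt.mul_const (ψ x)).deriv
  have e2 : ∀ x, inner ℝ (gradient (fun x => θ s * ψ x) x) (Ψ s x) =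
      θ s * fderiv ℝ ψ x (lin (A s) x + c s) := fun x => by
    rw [inner_gradient_left, ((hψ.differentiable (by simp) x).hasFDerivAt.const_mul (θ s)).fderiv,
      hΨ s hs0]
    rfl
  simp only [e1, e2]
  have i1 : Integrable ψ (μ s) :=
    integrable_of_quadratic (h2 s hs0) hψ.continuous.aestronglyMeasurable (C := B) fun x =>
      (hB x).trans (le_mul_of_one_le_right hB0 (by linarith [sq_nonneg ‖x‖]))
  have i2 : Integrable (fun x => fderiv ℝ ψ x (lin (A s) x + c s)) (μ s) := by
    refine integrable_of_quadratic (h2 s hs0) (hψ'.clm_apply (by fun_prop)).aestronglyMeasurable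
      (C := B' * (2 * (‖A s‖ + ‖c s‖))) fun x => ?_
    refine ((fderiv ℝ ψ x).le_opNorm _).trans ?_
    rw [mul_assoc]
    refine mul_le_mul (hB' x) ((norm_affine_le _ _ _).trans ?_) (norm_nonneg _) hB0'
    have h5 : 1 + ‖x‖ ≤ 2 * (1 + ‖x‖ ^ 2) := by
      linarith [sq_nonneg ‖x‖, norm_le_one_add_sq ‖x‖]
    calc _ ≤ (‖A s‖ + ‖c s‖) * (2 * (1 + ‖x‖ ^ 2)) :=
          mul_le_mul_of_nonneg_left h5 (by positivity)
      _ = _ := by ring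
  rw [integral_sub (i1.const_mul _) (i2.const_mul _), integral_const_mul, integral_const_mul]

/-- A weak solution is transported by its own affine velocity fields. -/
theorem IsWeakSolution.isAffineTransport {K : Measure (Rd d) → Rd d → Rd d → ℝ} {ν : ℝ}
    (hν₀ : 0 < ν) (hν₁ : ν ≤ 1) {Q : Mat d} (hQ : Q.PosDef) {μ : ℝ → Measure (Rd d)}
    (h : IsWeakSolution K ν (potential (gaussianDensity Q)) μ) {a : ℝ → Rd d}
    (ha : ContinuousOn a (Ici 0)) (hK : ∀ t, 0 ≤ t → K (μ t) = shiftKernel (a t)) :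
    IsAffineTransport (fun t => velocityMatrix ν Q (μ t) (a t))
      (fun t => velocityConst ν Q (μ t) (a t)) μ := by
  have hp := h.curve.prob
  have h2 : ∀ t, 0 ≤ t → Integrable (fun x : Rd d => ‖x‖ ^ 2) (μ t) := fun t ht =>
    h.curve.integrable_sq hQ ht
  have hμ : ∀ f : Rd d → ℝ, Continuous f → ∀ C : ℝ, (∀ x, |f x| ≤ C * (1 + ‖x‖ ^ 2)) →
      ContinuousOn (fun t => ∫ x, f x ∂(μ t)) (Ici 0) := fun f hf C hC =>
    h.curve.continuousOn_integral hQ hf hC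
  obtain ⟨Ψ, hΨ, heq⟩ := h.equation
  have hm := continuousOn_mean hp h2 hμ
  have hA : ContinuousOn (fun t => velocityMatrix ν Q (μ t) (a t)) (Ici 0) :=
    continuousOn_centeredDrift hν₀ hν₁ Q (continuousOn_covMatrix hp h2 hμ) hm (hm.sub ha)
      fun t ht => by
        have := hp t ht
        exact covMatrix_posSemidef (h2 t ht)
  have h3 : ContinuousOn (fun t => lin Q⁻¹ (∫ x, x ∂(μ t))) (Ici 0) :=
    (lin Q⁻¹).continuous.comp_continuousOn hm
  have h4 : ContinuousOn (fun t => lin (velocityMatrix ν Q (μ t) (a t))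
      ((∫ x, x ∂(μ t)) - a t)) (Ici 0) := continuousOn_lin_apply hA (hm.sub ha)
  have h5 : ContinuousOn (fun t => lin (velocityMatrix ν Q (μ t) (a t)) (∫ x, x ∂(μ t)))
      (Ici 0) := continuousOn_lin_apply hA hm
  have hc : ContinuousOn (fun t => velocityConst ν Q (μ t) (a t)) (Ici 0) := by
    unfold velocityConst
    exact (h3.add (h4.const_smul ν)).sub h5
  refine IsAffineTransport.of_weak hp h2 hμ hA hc (Ψ := Ψ) (fun s hs x => ?_) heq
  have := hp s hs
  have h3 := hΨ s hs
  rw [hK s hs] at h3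
  rw [isRegularizedInverse_eq hν₀ hν₁ hQ (h2 s hs) h3 x, map_sub]
  simp only [velocityConst, velocityMatrix]
  abel

theorem centeredDrift_zero (ν : ℝ) (Q C : Mat d) : centeredDrift ν Q C 0 0 = drift ν Q C := by
  simp [centeredDrift, centeredReg, drift, outer]

/-- A weak solution started from a centered Gaussian is the push-forward of its initial value under
the flow of the covariance dynamics. The mean solves a linear homogeneous equation, so it stays
zero; then the second moments solve the covariance equation, which determines the velocity. -/
theorem IsWeakSolution.eq_gaussian {K : Measure (Rd d) → Rd d → Rd d → ℝ} {ν : ℝ}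
    (hν₀ : 0 < ν) (hν₁ : ν ≤ 1) {Q S₀ : Mat d} (hQ : Q.PosDef) (hS₀ : S₀.PosDef)
    (hK : K = bilinearKernel ∨ K = affineInvariantKernel) {μ : ℝ → Measure (Rd d)}
    (h : IsWeakSolution K ν (potential (gaussianDensity Q)) μ)
    (h0 : μ 0 = multivariateGaussian 0 S₀) {Φ : ℝ → Mat d} (hΦ0 : Φ 0 = 1)
    (hdet : ∀ t, (Φ t).det ≠ 0)
    (hΦ : ∀ t, 0 ≤ t → HasDerivAt Φ (-(drift ν Q (Φ t * S₀ * (Φ t)ᵀ) * Φ t)) t)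
    (hS : ∀ t, 0 ≤ t → HasDerivAt (fun s => Φ s * S₀ * (Φ s)ᵀ)
      (covarianceField ν Q (Φ t * S₀ * (Φ t)ᵀ)) t)
    {T : ℝ} (hT : 0 ≤ T) : μ T = multivariateGaussian 0 (Φ T * S₀ * (Φ T)ᵀ) := by
  have hp := h.curve.prob
  have h2 : ∀ t, 0 ≤ t → Integrable (fun x : Rd d => ‖x‖ ^ 2) (μ t) := fun t ht =>
    h.curve.integrable_sq hQ ht
  have hmc : ContinuousOn (fun t => ∫ x, x ∂(μ t)) (Ici 0) :=
    continuousOn_mean hp h2 fun f hf C hC => h.curve.continuousOn_integral hQ hf hC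
  obtain ⟨a, ha, hKa, hma⟩ : ∃ a : ℝ → Rd d, ContinuousOn a (Ici 0) ∧
      (∀ t, 0 ≤ t → K (μ t) = shiftKernel (a t)) ∧
      ∀ t, ‖(∫ x, x ∂(μ t)) - a t‖ ≤ ‖∫ x, x ∂(μ t)‖ := by
    rcases hK with rfl | rfl
    · exact ⟨fun _ => 0, continuousOn_const, fun t _ => bilinearKernel_eq _, fun t => by simp⟩
    · exact ⟨fun t => ∫ x, x ∂(μ t), hmc, fun t _ => affineInvariantKernel_eq _,
        fun t => by simp⟩
  have htr := h.isAffineTransport hν₀ hν₁ hQ ha hKa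
  set m : ℝ → Rd d := fun t => ∫ y, y ∂(μ t) with hm_def
  set A : ℝ → Mat d := fun t => velocityMatrix ν Q (μ t) (a t) with hA_def
  have hm0 : m 0 = 0 := by
    simp only [hm_def, h0, integral_id_multivariateGaussian]
  have hm : ∀ t, 0 ≤ t → m t = 0 := by
    intro t ht
    obtain ⟨B, hB⟩ := (isCompact_Icc (a := 0) (b := t)).exists_bound_of_continuousOn
      (htr.continuousOn_linear.mono Icc_subset_Ici_self)
    refine eq_zero_of_abs_deriv_le_mul_abs_self_of_eq_zero_right (K := ‖Q⁻¹‖ + ν * B)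
      (hmc.mono Icc_subset_Ici_self)
      (fun s hs => (htr.hasDerivWithinAt_mean hs.1).mono (Ici_subset_Ici.2 hs.1)) hm0
      (fun s hs => ?_) t ⟨ht, le_rfl⟩
    have e1 : lin (A s) (m s) + velocityConst ν Q (μ s) (a s) =
        lin Q⁻¹ (m s) + ν • lin (A s) (m s - a s) := by
      simp only [velocityConst, hA_def, hm_def]; abel
    rw [e1, norm_neg]
    refine (norm_add_le _ _).trans ?_
    rw [norm_smul, Real.norm_of_nonneg hν₀.le, add_mul, mul_assoc]
    refine add_le_add (norm_lin_apply_le _ _) (mul_le_mul_of_nonneg_left ?_ hν₀.le)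
    refine (norm_lin_apply_le _ _).trans ?_
    have hBs := hB s ⟨hs.1, hs.2.le⟩
    exact mul_le_mul hBs (hma s) (norm_nonneg _) ((norm_nonneg _).trans hBs)
  have hcov : ∀ t, 0 ≤ t → covMatrix (μ t) = secondMoment (μ t) := fun t ht => by
    have := hm t ht
    simp only [hm_def] at this
    simp [covMatrix, this]
  have hpa : ∀ t, 0 ≤ t → m t - a t = 0 := fun t ht => by
    have := hma t
    rw [show ∫ x, x ∂(μ t) = 0 from hm t ht, norm_zero] at this
    rw [hm t ht]
    exact norm_le_zero_iff.1 this
  have hAM : ∀ t, 0 ≤ t → A t = drift ν Q (secondMoment (μ t)) := fun t ht => by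
    change centeredDrift ν Q (covMatrix (μ t)) (m t) (m t - a t) = _
    rw [hpa t ht, hm t ht, centeredDrift_zero, hcov t ht]
  have htr' : IsAffineTransport A (fun _ => 0) μ :=
    ⟨htr.prob, htr.integrable_sq, htr.continuousOn_integral, htr.continuousOn_linear,
      continuousOn_const, fun ψ hψ hψc t ht => by
        have h3 := htr.hasDerivWithinAt_test ψ hψ hψc t ht
        have e1 : velocityConst ν Q (μ t) (a t) = 0 := by
          change lin Q⁻¹ (m t) + ν • lin (A t) (m t - a t) - lin (A t) (m t) = 0
          rw [hpa t ht, hm t ht]; simp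
        rwa [e1] at h3⟩
  have hMp : ∀ t, 0 ≤ t → (secondMoment (μ t)).PosSemidef := fun t ht => by
    have := hp t ht
    rw [← hcov t ht]
    exact covMatrix_posSemidef (h2 t ht)
  have hM : ∀ t, 0 ≤ t → secondMoment (μ t) = Φ t * S₀ * (Φ t)ᵀ := fun t ht => by
    refine covariance_unique hν₀ hν₁ (S := fun t => secondMoment (μ t))
      (T := fun t => Φ t * S₀ * (Φ t)ᵀ) (Q := Q) (fun s hs => ?_)
      (fun s hs => (hS s hs).hasDerivWithinAt) hMp
      (fun s _ => conj_posSemidef hS₀.posSemidef _) ?_ ht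
    · have h3 := htr'.hasDerivWithinAt_secondMoment hs
      rw [covarianceField_eq hν₀ hν₁ hQ (hMp s hs), ← hAM s hs]
      exact h3
    · simp only [h0, secondMoment_gaussian hS₀.posSemidef, hΦ0]
      simp
  have hΦ' : ∀ t, 0 ≤ t → HasDerivAt Φ (-(A t * Φ t)) t := fun t ht => by
    rw [hAM t ht, hM t ht]
    exact hΦ t ht
  rw [htr'.eq_map hΦ0 hdet hΦ' hT, h0, map_lin_multivariateGaussian hS₀.posSemidef]

/-! ### Integration by parts for the kernelized score -/

section Density

variable {E : Type*} [NormedAddCommGroup E] [NormedSpace ℝ E]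

theorem integrable_densityMeasure_iff {ρ : Rd d → ℝ} (hρ : Continuous ρ) (h0 : ∀ x, 0 ≤ ρ x)
    {f : Rd d → E} :
    Integrable f (densityMeasure ρ) ↔ Integrable (fun x => ρ x • f x) volume := by
  rw [densityMeasure, integrable_withDensity_iff_integrable_smul' (by fun_prop)
    (Eventually.of_forall fun x => ENNReal.ofReal_lt_top)]
  simp_rw [ENNReal.toReal_ofReal (h0 _)]

theorem integral_densityMeasure {ρ : Rd d → ℝ} (hρ : Continuous ρ) (h0 : ∀ x, 0 ≤ ρ x)
    (f : Rd d → E) : ∫ x, f x ∂(densityMeasure ρ) = ∫ x, ρ x • f x := by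
  rw [densityMeasure, integral_withDensity_eq_integral_toReal_smul (by fun_prop)
    (Eventually.of_forall fun x => ENNReal.ofReal_lt_top)]
  simp_rw [ENNReal.toReal_ofReal (h0 _)]

end Density

theorem relativeScore_eq {ρ : Rd d → ℝ} (hρ : Differentiable ℝ ρ) (h0 : ∀ x, 0 < ρ x) {Q : Mat d}
    (hQ : Q.PosDef) (x : Rd d) :
    relativeScore ρ (gaussianDensity Q) x = (ρ x)⁻¹ • gradient ρ x + lin Q⁻¹ x := by
  have h1 : (fun y => Real.log (ρ y / gaussianDensity Q y)) =
      fun y => Real.log (ρ y) + potential (gaussianDensity Q) y := by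
    ext y
    rw [Real.log_div (h0 y).ne' (gaussianDensity_pos hQ y).ne', potential, sub_eq_add_neg]
  have h2 : HasFDerivAt (fun y => Real.log (ρ y)) ((ρ x)⁻¹ • fderiv ℝ ρ x) x :=
    (hρ x).hasFDerivAt.log (h0 x).ne'
  have h3 : DifferentiableAt ℝ (potential (gaussianDensity Q)) x := by
    have : potential (gaussianDensity Q) = fun x => inner ℝ x (lin Q⁻¹ x) / 2 +
      Real.log (√((2 * Real.pi) ^ d * Q.det)) := funext (potential_gaussianDensity hQ)
    rw [this]
    exact ((hasGradientAt_quadratic (symm_of_posSemidef hQ.inv.posSemidef) x).differentiableAt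
      ).add_const _
  rw [relativeScore, h1, ← gradient_potential hQ]
  simp only [gradient]
  rw [(h2.fun_add h3.hasFDerivAt).fderiv, map_add]
  simp

/-- Integration by parts: for a law with a regular density, the kernelized relative score does not
see the derivative of the density. -/
theorem kernelize_relativeScore {ρ : Rd d → ℝ} (hρ : ContDiff ℝ 1 ρ) (h0 : ∀ x, 0 < ρ x)
    [IsProbabilityMeasure (densityMeasure ρ)]
    (h2 : Integrable (fun x : Rd d => ‖x‖ ^ 2) (densityMeasure ρ)) {Q : Mat d} (hQ : Q.PosDef)
    {a : Rd d} (hk : IsKernelizable (shiftKernel a) (densityMeasure ρ)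
      (relativeScore ρ (gaussianDensity Q))) :
    kernelize (shiftKernel a) (densityMeasure ρ) (relativeScore ρ (gaussianDensity Q)) =
      kernelizedScore (shiftKernel a) (potential (gaussianDensity Q)) (densityMeasure ρ) := by
  ext1 x
  have hc := hρ.continuous
  have hρd : Differentiable ℝ ρ := hρ.differentiable one_ne_zero
  have hnn : ∀ x, 0 ≤ ρ x := fun x => (h0 x).le
  have i1 := hk x
  have i2 := integrable_steinIntegrand hQ h2 a x
  have hdiff : ∀ y, ρ y • (shiftKernel a x y • relativeScore ρ (gaussianDensity Q) y -
      steinIntegrand (shiftKernel a) (potential (gaussianDensity Q)) x y) =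
      shiftKernel a x y • gradient ρ y + ρ y • (x - a) := by
    intro y
    rw [steinIntegrand_shiftKernel hQ, relativeScore_eq hρd h0 hQ, ← shiftKernel, smul_add,
      show ∀ u v w : Rd d, u + v - (v - w) = u + w from fun u v w => by abel, smul_add,
      smul_comm (ρ y) (shiftKernel a x y), smul_smul (ρ y),
      mul_inv_cancel₀ (h0 y).ne', one_smul]
  have i3 : Integrable (fun y => shiftKernel a x y • gradient ρ y + ρ y • (x - a)) := by
    have := (integrable_densityMeasure_iff hc hnn).1 (i1.sub i2)
    refine this.congr (Eventually.of_forall fun y => hdiff y)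
  have iρ : Integrable ρ := by
    have := (integrable_densityMeasure_iff hc hnn).1
      (integrable_const (μ := densityMeasure ρ) (1 : ℝ))
    simpa using this
  have i4 : Integrable (fun y => shiftKernel a x y • gradient ρ y) := by
    refine (i3.sub (iρ.smul_const (x - a))).congr (Eventually.of_forall fun y => ?_)
    simp
  have i5 : Integrable (fun y => shiftKernel a x y * ρ y) := by
    have h3 : Integrable (fun y => shiftKernel a x y) (densityMeasure ρ) :=
      (((integrable_id_of_sq h2).sub (integrable_const a)).const_inner (x - a)).add
        (integrable_const (1 : ℝ))
    refine ((integrable_densityMeasure_iff hc hnn).1 h3).congr (Eventually.of_forall fun y => ?_)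
    simp [mul_comm]
  have hkd : ∀ y, HasFDerivAt (shiftKernel a x) (innerSL ℝ (x - a)) y := fun y => by
    have := ((innerSL ℝ (x - a)).hasFDerivAt (x := y - a)).comp y
      ((hasFDerivAt_id y).sub_const a)
    rw [ContinuousLinearMap.comp_id] at this
    exact this.add_const 1
  rw [← sub_eq_zero, kernelize, kernelizedScore, ← integral_sub i1 i2,
    integral_densityMeasure hc hnn]
  simp_rw [hdiff]
  refine ext_inner_right ℝ fun v => ?_
  rw [inner_zero_left, real_inner_comm, ← integral_inner i3]
  have hv : ∀ y, inner ℝ v (shiftKernel a x y • gradient ρ y + ρ y • (x - a)) =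
      shiftKernel a x y * fderiv ℝ ρ y v + fderiv ℝ (shiftKernel a x) y v * ρ y := by
    intro y
    rw [(hkd y).fderiv, real_inner_comm, inner_add_left, real_inner_smul_left,
      real_inner_smul_left, inner_gradient_left, innerSL_apply_apply, mul_comm (inner ℝ (x - a) v)]
  simp_rw [hv]
  have i6 : Integrable (fun y => shiftKernel a x y * fderiv ℝ ρ y v) := by
    refine (i4.inner_const v).congr (Eventually.of_forall fun y => ?_)
    simp only [real_inner_smul_left, inner_gradient_left]
  have i7 : Integrable (fun y => fderiv ℝ (shiftKernel a x) y v * ρ y) := by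
    refine (iρ.const_mul (inner ℝ (x - a) v)).congr (Eventually.of_forall fun y => ?_)
    simp only [(hkd y).fderiv, innerSL_apply_apply]
  rw [integral_add i6 i7, integral_mul_fderiv_eq_neg_fderiv_mul_of_integrable i7 i6 i5
    (fun y _ => (hkd y).differentiableAt) (fun y _ => hρd y), neg_add_cancel]

/-- The divergence theorem for a compactly supported test function. -/
theorem integral_mul_divergence {φ : Rd d → ℝ} (hφ : ContDiff ℝ 1 φ) (hφc : HasCompactSupport φ)
    {F : Rd d → Rd d} (hF : ContDiff ℝ 1 F) :
    ∫ x, φ x * divergence F x = -∫ x, inner ℝ (gradient φ x) (F x) := by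
  let e : Fin d → Rd d := fun i => EuclideanSpace.single i 1
  have hFi : ∀ i, ContDiff ℝ 1 fun x => F x i := fun i =>
    (EuclideanSpace.proj i : Rd d →L[ℝ] ℝ).contDiff.comp hF
  have hfd : ∀ i x v, fderiv ℝ (fun x => F x i) x v = (fderiv ℝ F x v) i := fun i x v => by
    have : HasFDerivAt (fun x => F x i)
        ((EuclideanSpace.proj i : Rd d →L[ℝ] ℝ) ∘L fderiv ℝ F x) x :=
      (EuclideanSpace.proj i : Rd d →L[ℝ] ℝ).hasFDerivAt.comp x
        (hF.differentiable one_ne_zero x).hasFDerivAt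
    rw [this.fderiv]; rfl
  have c1 : ∀ i, Continuous fun x => fderiv ℝ φ x (e i) := fun i =>
    (hφ.continuous_fderiv one_ne_zero).clm_apply continuous_const
  have c2 : ∀ i, Continuous fun x => fderiv ℝ (fun x => F x i) x (e i) := fun i =>
    ((hFi i).continuous_fderiv one_ne_zero).clm_apply continuous_const
  have i1 : ∀ i, Integrable fun x => fderiv ℝ φ x (e i) * F x i := fun i =>
    ((c1 i).mul (hFi i).continuous).integrable_of_hasCompactSupport
      ((hφc.fderiv_apply ℝ (e i)).mul_right)
  have i2 : ∀ i, Integrable fun x => φ x * fderiv ℝ (fun x => F x i) x (e i) := fun i =>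
    (hφ.continuous.mul (c2 i)).integrable_of_hasCompactSupport hφc.mul_right
  have i3 : ∀ i, Integrable fun x => φ x * F x i := fun i =>
    (hφ.continuous.mul (hFi i).continuous).integrable_of_hasCompactSupport hφc.mul_right
  have h1 : ∀ x, φ x * divergence F x = ∑ i, φ x * fderiv ℝ (fun x => F x i) x (e i) := fun x => by
    rw [divergence, Finset.mul_sum]
    exact Finset.sum_congr rfl fun i _ => by rw [hfd]
  have h2 : ∀ x, inner ℝ (gradient φ x) (F x) = ∑ i, fderiv ℝ φ x (e i) * F x i := fun x => by
    have hexp : F x = ∑ i, F x i • e i := by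
      have := (EuclideanSpace.basisFun (Fin d) ℝ).sum_repr (F x)
      simpa [e] using this.symm
    rw [inner_gradient_left]
    conv_lhs => rw [hexp]
    simp [mul_comm]
  simp_rw [h1, h2]
  rw [integral_finsetSum _ fun i _ => i2 i, integral_finsetSum _ fun i _ => i1 i,
    ← Finset.sum_neg_distrib]
  exact Finset.sum_congr rfl fun i _ => integral_mul_fderiv_eq_neg_fderiv_mul_of_integrable
    (i1 i) (i2 i) (i3 i) (fun x _ => hφ.differentiable one_ne_zero x)
    (fun x _ => (hFi i).differentiable one_ne_zero x)

/-! ### Classical solutions are weak solutions -/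

theorem hasDerivAt_slice {φ : ℝ → Rd d → ℝ}
    (hφ : Differentiable ℝ (fun p : ℝ × Rd d => φ p.1 p.2)) (t : ℝ) (x : Rd d) :
    HasDerivAt (fun s => φ s x) (fderiv ℝ (fun p : ℝ × Rd d => φ p.1 p.2) (t, x) (1, 0)) t :=
  (hφ (t, x)).hasFDerivAt.comp_hasDerivAt (f := fun s : ℝ => (s, x)) t
    ((hasDerivAt_id t).prodMk (hasDerivAt_const t x))

/-- If `ρ' = ∂ₜ ρ` on `[0, ∞)`, then integrating `∂ₜ (φ ρ)` over time and then over space, for a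
test function `φ`, leaves only the contribution of the initial time. -/
theorem integral_test_of_hasDerivWithinAt {ρ : ℝ → Rd d → ℝ}
    (hρ : ContDiffOn ℝ 1 (fun p : ℝ × Rd d => ρ p.1 p.2) (Ici 0 ×ˢ univ)) {ρ' : ℝ → Rd d → ℝ}
    (hd : ∀ t, 0 ≤ t → ∀ x, HasDerivWithinAt (fun s => ρ s x) (ρ' t x) (Ici 0) t)
    {φ : ℝ → Rd d → ℝ} (hφ : ContDiff ℝ ∞ (fun p : ℝ × Rd d => φ p.1 p.2))
    (hφc : HasCompactSupport (fun p : ℝ × Rd d => φ p.1 p.2)) :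
    (∫ t in Ioi (0 : ℝ), ∫ x, (deriv (fun s => φ s x) t * ρ t x + φ t x * ρ' t x)) +
      ∫ x, φ 0 x * ρ 0 x = 0 := by
  set R : ℝ × Rd d → ℝ := fun p => ρ p.1 p.2
  set P : ℝ × Rd d → ℝ := fun p => φ p.1 p.2
  have hu : UniqueDiffOn ℝ ((Ici (0 : ℝ)) ×ˢ (univ : Set (Rd d))) :=
    (uniqueDiffOn_Ici 0).prod uniqueDiffOn_univ
  have hρ' : ∀ t, 0 ≤ t → ∀ x, ρ' t x = fderivWithin ℝ R (Ici 0 ×ˢ univ) (t, x) (1, 0) := by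
    intro t ht x
    have h1 : HasFDerivWithinAt R (fderivWithin ℝ R (Ici 0 ×ˢ univ) (t, x))
        (Ici 0 ×ˢ univ) (t, x) :=
      (hρ.differentiableOn one_ne_zero (t, x) ⟨ht, mem_univ _⟩).hasFDerivWithinAt
    have h2 : HasDerivWithinAt (fun s : ℝ => (s, x)) ((1 : ℝ), (0 : Rd d)) (Ici 0) t :=
      ((hasDerivAt_id t).prodMk (hasDerivAt_const t x)).hasDerivWithinAt
    have h3 := h1.comp_hasDerivWithinAt t h2 (fun s hs => mk_mem_prod hs (mem_univ _))
    exact (uniqueDiffOn_Ici 0 t ht).eq_deriv _ (hd t ht x) h3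
  -- continuous extensions to negative times
  let q : ℝ × Rd d → ℝ × Rd d := fun p => (max p.1 0, p.2)
  have hq : Continuous q := by fun_prop
  have hqm : ∀ p, q p ∈ (Ici (0 : ℝ)) ×ˢ (univ : Set (Rd d)) := fun p =>
    mk_mem_prod (mem_Ici.2 (le_max_right _ _)) (mem_univ _)
  have hqe : ∀ t, 0 ≤ t → ∀ x : Rd d, q (t, x) = (t, x) := fun t ht x => by
    simp only [q, max_eq_left ht]
  have c1 : Continuous fun p => R (q p) := hρ.continuousOn.comp_continuous hq hqm
  have c2 : Continuous fun p => fderivWithin ℝ R (Ici 0 ×ˢ univ) (q p) (1, 0) :=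
    ((hρ.continuousOn_fderivWithin hu le_rfl).comp_continuous hq hqm).clm_apply continuous_const
  have hPt : ∀ t x, HasDerivAt (fun s => φ s x) (fderiv ℝ P (t, x) (1, 0)) t :=
    hasDerivAt_slice (hφ.differentiable (by simp))
  have c3 : Continuous fun p => fderiv ℝ P p (1, 0) :=
    (hφ.continuous_fderiv (by simp)).clm_apply continuous_const
  let H : ℝ → Rd d → ℝ := fun t x => fderiv ℝ P (t, x) (1, 0) * R (q (t, x)) +
    φ t x * fderivWithin ℝ R (Ici 0 ×ˢ univ) (q (t, x)) (1, 0)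
  have iH : Integrable (Function.uncurry H) := by
    have e : Function.uncurry H = (fun p => fderiv ℝ P p (1, 0) * R (q p)) +
      fun p => P p * fderivWithin ℝ R (Ici 0 ×ˢ univ) (q p) (1, 0) := rfl
    rw [e]
    exact ((c3.mul c1).integrable_of_hasCompactSupport
      ((hφc.fderiv_apply ℝ _).mul_right)).add
      ((hφ.continuous.mul c2).integrable_of_hasCompactSupport hφc.mul_right)
  have hslice : ∀ x, HasCompactSupport fun t => φ t x := fun x => by
    refine HasCompactSupport.intro (hφc.isCompact.image continuous_fst) fun t ht => ?_
    by_contra hne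
    exact ht ⟨(t, x), subset_tsupport P hne, rfl⟩
  have htime : ∀ x, ∫ t in Ioi (0 : ℝ), H t x = -(φ 0 x * ρ 0 x) := by
    intro x
    have h1 : ∀ t ∈ Ioi (0 : ℝ), HasDerivAt (fun s => φ s x * R (q (s, x))) (H t x) t := by
      intro t ht
      have ht0 : 0 ≤ t := le_of_lt ht
      have h2 : HasDerivAt (fun s => R (q (s, x)))
          (fderivWithin ℝ R (Ici 0 ×ˢ univ) (q (t, x)) (1, 0)) t := by
        have h3 := (hd t ht0 x).hasDerivAt (Ici_mem_nhds ht)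
        rw [hρ' t ht0 x, ← hqe t ht0 x] at h3
        refine h3.congr_of_eventuallyEq ?_
        filter_upwards [lt_mem_nhds ht] with s hs
        rw [hqe s hs.le x]
      exact (hPt t x).mul h2
    have cH : Continuous fun t => H t x := by
      have e1 : Continuous fun t : ℝ => (t, x) := by fun_prop
      exact ((c3.comp e1).mul (c1.comp e1)).add ((hφ.continuous.comp e1).mul (c2.comp e1))
    have h4 : HasCompactSupport fun t => H t x := by
      refine HasCompactSupport.add (HasCompactSupport.mul_right ?_) (hslice x).mul_right
      have : (fun t => fderiv ℝ P (t, x) (1, 0)) = deriv fun t => φ t x :=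
        funext fun t => (hPt t x).deriv.symm
      rw [this]
      exact (hslice x).deriv
    have hlim : Tendsto (fun s => φ s x * R (q (s, x))) atTop (𝓝 0) := by
      refine tendsto_const_nhds.congr' ?_
      have h3 := hasCompactSupport_iff_eventuallyEq.1 (hslice x)
      rw [coclosedCompact_eq_cocompact] at h3
      filter_upwards [atTop_le_cocompact h3] with s hs
      simp only [hs, Pi.zero_apply, zero_mul]
    have h5 := integral_Ioi_of_hasDerivAt_of_tendsto (a := 0) (m := 0)
      (f := fun s => φ s x * R (q (s, x)))
      ((hφ.continuous.comp (by fun_prop : Continuous fun t : ℝ => (t, x))).mul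
        (c1.comp (by fun_prop : Continuous fun t : ℝ => (t, x)))).continuousAt.continuousWithinAt h1
      (cH.integrable_of_hasCompactSupport h4).integrableOn
      hlim
    rw [h5, zero_sub, hqe 0 le_rfl]
  have hswap := integral_integral_swap (μ := volume.restrict (Ioi (0 : ℝ))) (ν := volume) (f := H)
    (by
      have := iH.mono_measure (μ := (volume.restrict (Ioi (0 : ℝ))).prod (volume : Measure (Rd d)))
        (Measure.prod_mono Measure.restrict_le_self le_rfl)
      exact this)
  simp_rw [htime, integral_neg] at hswap
  rw [← eq_neg_iff_add_eq_zero, ← hswap]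
  refine setIntegral_congr_fun measurableSet_Ioi fun t ht => ?_
  have ht0 : 0 ≤ t := le_of_lt ht
  refine integral_congr_ae (Eventually.of_forall fun x => ?_)
  simp only [H]
  rw [(hPt t x).deriv, hρ' t ht0 x, hqe t ht0 x]

/-- Both integrations by parts are combined: in the kernelized score, and in the pairing of the
equation with test functions. -/
theorem IsClassicalSolution.isWeakSolution {K : Measure (Rd d) → Rd d → Rd d → ℝ} {ν : ℝ}
    (hν₀ : 0 < ν) (hν₁ : ν ≤ 1) {Q : Mat d} (hQ : Q.PosDef)
    (hK : K = bilinearKernel ∨ K = affineInvariantKernel) {ρ : ℝ → Rd d → ℝ}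
    (h : IsClassicalSolution K ν (gaussianDensity Q) ρ) :
    IsWeakSolution K ν (potential (gaussianDensity Q)) fun t => densityMeasure (ρ t) := by
  obtain ⟨Ψ, hΨ⟩ := h.equation
  have hKa : ∀ μ : Measure (Rd d), ∃ a, K μ = shiftKernel a := fun μ => by
    rcases hK with rfl | rfl
    · exact ⟨0, bilinearKernel_eq μ⟩
    · exact ⟨_, affineInvariantKernel_eq μ⟩
  have h2 : ∀ t, 0 ≤ t → Integrable (fun x : Rd d => ‖x‖ ^ 2) (densityMeasure (ρ t)) :=
    fun t ht => h.curve.integrable_sq hQ ht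
  have hreg : ∀ t, 0 ≤ t → IsRegularizedInverse ν (K (densityMeasure (ρ t)))
      (densityMeasure (ρ t)) (kernelizedScore (K (densityMeasure (ρ t)))
        (potential (gaussianDensity Q)) (densityMeasure (ρ t))) (Ψ t) := by
    intro t ht
    have := h.curve.prob t ht
    have h3 := (hΨ t ht).1
    have h4 := h.kernelizable t ht
    obtain ⟨a, ha⟩ := hKa (densityMeasure (ρ t))
    rw [ha] at h3 h4 ⊢
    rwa [kernelize_relativeScore ((h.smooth t ht).of_le (by simp)) (h.pos t ht) (h2 t ht) hQ h4]
      at h3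
  refine ⟨h.curve, fun t ht x => ?_, Ψ, hreg, fun φ hφ hφc => ?_⟩
  · have := h.curve.prob t ht
    obtain ⟨a, ha⟩ := hKa (densityMeasure (ρ t))
    simp only [ha]
    exact integrable_steinIntegrand hQ (h2 t ht) a x
  · have h5 := integral_test_of_hasDerivWithinAt h.contDiffOn
      (fun t ht x => (hΨ t ht).2.2 x) hφ hφc
    have hc : ∀ t, 0 ≤ t → Continuous (ρ t) := fun t ht => (h.smooth t ht).continuous
    have hnn : ∀ t, 0 ≤ t → ∀ x, 0 ≤ ρ t x := fun t ht x => (h.pos t ht x).le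
    refine Eq.trans ?_ h5
    congr 1
    · refine setIntegral_congr_fun measurableSet_Ioi fun t ht => ?_
      have ht0 : 0 ≤ t := le_of_lt ht
      have := h.curve.prob t ht0
      have hΨs : ContDiff ℝ 1 (Ψ t) := by
        have h6 := hreg t ht0
        obtain ⟨a, ha⟩ := hKa (densityMeasure (ρ t))
        rw [ha] at h6
        rw [show Ψ t = _ from funext (isRegularizedInverse_eq hν₀ hν₁ hQ (h2 t ht0) h6)]
        exact ((lin _).contDiff.comp (contDiff_id.sub contDiff_const)).add contDiff_const
      have hF : ContDiff ℝ 1 fun y => ρ t y • Ψ t y :=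
        ((h.smooth t ht0).of_le (by simp)).smul hΨs
      have hφt : ContDiff ℝ 1 (φ t) :=
        (hφ.comp (contDiff_const.prodMk contDiff_id : ContDiff ℝ ∞ fun x : Rd d => (t, x))).of_le
          (by simp)
      have hφtc : HasCompactSupport (φ t) := by
        refine HasCompactSupport.intro (hφc.isCompact.image continuous_snd) fun x hx => ?_
        by_contra hne
        exact hx ⟨(t, x), subset_tsupport (fun p : ℝ × Rd d => φ p.1 p.2) hne, rfl⟩
      have hdt : (fun x => deriv (fun s => φ s x) t) =
          fun x => fderiv ℝ (fun p : ℝ × Rd d => φ p.1 p.2) (t, x) (1, 0) := funext fun x =>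
        (hasDerivAt_slice (hφ.differentiable (by simp)) t x).deriv
      have c1 : Continuous fun x => deriv (fun s => φ s x) t := by
        rw [hdt]
        exact ((hφ.continuous_fderiv (by simp)).comp (by fun_prop)).clm_apply continuous_const
      have hc1 : HasCompactSupport fun x => deriv (fun s => φ s x) t := by
        refine HasCompactSupport.intro (hφc.isCompact.image continuous_snd) fun x hx => ?_
        have : (fun s => φ s x) = fun _ => 0 := funext fun s => by
          by_contra hne
          exact hx ⟨(s, x), subset_tsupport (fun p : ℝ × Rd d => φ p.1 p.2) hne, rfl⟩
        rw [this, deriv_const]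
      have i1 : Integrable fun x => deriv (fun s => φ s x) t * ρ t x :=
        (c1.mul (hc t ht0)).integrable_of_hasCompactSupport hc1.mul_right
      have i2 : Integrable fun x => inner ℝ (gradient (φ t) x) (ρ t x • Ψ t x) := by
        simp_rw [inner_gradient_left]
        refine ((hφt.continuous_fderiv one_ne_zero).clm_apply
          hF.continuous).integrable_of_hasCompactSupport ?_
        refine (hφtc.fderiv ℝ).mono fun x hx => ?_
        rw [Function.mem_support] at hx ⊢
        intro h0
        rw [h0] at hx
        exact hx rfl
      have i3 : Integrable fun x => φ t x * divergence (fun y => ρ t y • Ψ t y) x := by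
        refine Continuous.integrable_of_hasCompactSupport (hφt.continuous.mul ?_) hφtc.mul_right
        unfold divergence
        refine continuous_finsetSum _ fun i _ => ?_
        exact (EuclideanSpace.proj i : Rd d →L[ℝ] ℝ).continuous.comp
          ((hF.continuous_fderiv one_ne_zero).clm_apply continuous_const)
      rw [integral_densityMeasure (hc t ht0) (hnn t ht0), integral_add i1 i3,
        integral_mul_divergence hφt hφtc hF, ← sub_eq_add_neg, ← integral_sub i1 i2]
      refine integral_congr_ae (Eventually.of_forall fun x => ?_)
      simp only [smul_eq_mul, inner_smul_right]
      ring
    · rw [integral_densityMeasure (hc 0 le_rfl) (hnn 0 le_rfl)]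
      simp only [smul_eq_mul, mul_comm]

theorem eq_of_densityMeasure_eq {ρ σ : Rd d → ℝ} (hρ : Continuous ρ) (hσ : Continuous σ)
    (hρ0 : ∀ x, 0 ≤ ρ x) (hσ0 : ∀ x, 0 ≤ σ x) [IsFiniteMeasure (densityMeasure ρ)]
    (h : densityMeasure ρ = densityMeasure σ) : ρ = σ := by
  have hae : (fun x => ENNReal.ofReal (ρ x)) =ᵐ[volume] fun x => ENNReal.ofReal (σ x) := by
    refine (withDensity_eq_iff (by fun_prop) (by fun_prop) ?_).1 h
    have := measure_ne_top (densityMeasure ρ) univ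
    rwa [densityMeasure, withDensity_apply _ MeasurableSet.univ, Measure.restrict_univ] at this
  refine Continuous.ae_eq_iff_eq volume hρ hσ |>.1 ?_
  filter_upwards [hae] with x hx
  rw [← ENNReal.toReal_ofReal (hρ0 x), hx, ENNReal.toReal_ofReal (hσ0 x)]

/-! ### The Gaussian solution -/

theorem contDiff_gaussianDensity {n : WithTop ℕ∞} (S : Mat d) :
    ContDiff ℝ n (gaussianDensity S) := by
  have : gaussianDensity S = fun x => (√((2 * Real.pi) ^ d * S.det))⁻¹ *
    Real.exp (-(inner ℝ x (lin S⁻¹ x)) / 2) := funext (gaussianDensity_eq S)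
  rw [this]
  exact contDiff_const.mul (((contDiff_id.inner ℝ (lin S⁻¹).contDiff).neg.div_const 2).exp)

theorem contDiff_gaussianDensity_path {S : ℝ → Mat d} (hS : ContDiff ℝ 1 S)
    (hSp : ∀ t, (S t).PosDef) : ContDiff ℝ 1 fun p : ℝ × Rd d => gaussianDensity (S p.1) p.2 := by
  rw [contDiff_iff_contDiffAt]
  intro p
  have hdet := (hSp p.1).det_pos
  have h1 : ContDiffAt ℝ 1 (fun p : ℝ × Rd d => S p.1) p := (hS.comp contDiff_fst).contDiffAt
  have h2 : ContDiffAt ℝ 1 (fun p : ℝ × Rd d => (S p.1).det) p :=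
    contDiff_det.contDiffAt.comp p h1
  have h3 : ContDiffAt ℝ 1 (fun p : ℝ × Rd d => (S p.1)⁻¹) p :=
    (contDiffAt_matrix_inv hdet.ne').comp p h1
  have h4 : ∀ i j, ContDiffAt ℝ 1 (fun p : ℝ × Rd d => (S p.1)⁻¹ i j) p := fun i j =>
    (contDiff_entry i j).contDiffAt.comp p h3
  have h5 : ∀ i, ContDiffAt ℝ 1 (fun p : ℝ × Rd d => p.2 i) p := fun i => by fun_prop
  have hpos : 0 < (2 * Real.pi) ^ d * (S p.1).det := by positivity
  unfold gaussianDensity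
  refine ContDiffAt.mul (((contDiffAt_const.mul h2).sqrt hpos.ne').inv (by positivity))
    (ContDiffAt.exp (ContDiffAt.div_const (ContDiffAt.neg ?_) 2))
  simp only [dotProduct, Matrix.mulVec]
  exact ContDiffAt.sum fun i _ => (h5 i).mul (ContDiffAt.sum fun j _ => (h4 i j).mul (h5 j))

theorem hasGradientAt_gaussianDensity {S : Mat d} (hS : S.PosDef) (x : Rd d) :
    HasGradientAt (gaussianDensity S) (-gaussianDensity S x • lin S⁻¹ x) x := by
  have h0 : gaussianDensity S = fun x => (√((2 * Real.pi) ^ d * S.det))⁻¹ *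
    Real.exp (-(inner ℝ x (lin S⁻¹ x) / 2)) := by
    ext x
    rw [gaussianDensity_eq, neg_div]
  have h1 := hasGradientAt_quadratic (symm_of_posSemidef hS.inv.posSemidef) x
  rw [hasGradientAt_iff_hasFDerivAt] at h1 ⊢
  have h2 := h1.fun_neg.exp.const_mul ((√((2 * Real.pi) ^ d * S.det))⁻¹)
  rw [h0]
  refine h2.congr_fderiv ?_
  ext v
  simp only [smul_apply, neg_apply, InnerProductSpace.toDual_apply_apply, inner_smul_left,
    smul_eq_mul, conj_trivial]
  simp
  ring

theorem relativeScore_gaussianDensity {S Q : Mat d} (hS : S.PosDef) (hQ : Q.PosDef) (x : Rd d) :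
    relativeScore (gaussianDensity S) (gaussianDensity Q) x = lin (Q⁻¹ - S⁻¹) x := by
  rw [relativeScore_eq ((contDiff_gaussianDensity (n := 1) S).differentiable one_ne_zero)
    (gaussianDensity_pos hS) hQ, (hasGradientAt_gaussianDensity hS x).gradient, smul_smul,
    mul_neg, inv_mul_cancel₀ (gaussianDensity_pos hS x).ne', neg_one_smul, lin_sub_apply]
  abel

theorem divergence_gaussianDensity_smul {S : Mat d} (hS : S.PosDef) (A : Mat d) (x : Rd d) :
    divergence (fun y => gaussianDensity S y • lin A y) x =
      gaussianDensity S x * (A.trace - inner ℝ (lin S⁻¹ x) (lin A x)) := by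
  have h1 := (hasGradientAt_gaussianDensity hS x)
  rw [hasGradientAt_iff_hasFDerivAt] at h1
  have h2 := h1.fun_smul (lin A).hasFDerivAt
  have hA : ∀ i, (lin A (EuclideanSpace.single i 1)) i = A i i := fun i => by
    rw [Matrix.ofLp_toEuclideanCLM]
    simp
  rw [divergence, h2.fderiv]
  have h3 : inner ℝ (lin S⁻¹ x) (lin A x) = ∑ i, (lin S⁻¹ x) i * (lin A x) i := by
    rw [PiLp.inner_apply]
    exact Finset.sum_congr rfl fun i _ => by simp [mul_comm]
  rw [h3, mul_sub, Matrix.trace, Finset.mul_sum, Finset.mul_sum, ← Finset.sum_sub_distrib]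
  refine Finset.sum_congr rfl fun i _ => ?_
  have h4 : inner ℝ (lin S⁻¹ x) (EuclideanSpace.single i (1 : ℝ)) = (lin S⁻¹ x) i := by
    rw [EuclideanSpace.inner_single_right]
    simp
  change gaussianDensity S x * (lin A (EuclideanSpace.single i 1)) i +
    inner ℝ (-gaussianDensity S x • lin S⁻¹ x) (EuclideanSpace.single i 1) * (lin A x) i = _
  rw [hA, real_inner_smul_left, h4, Matrix.diag_apply]
  ring

/-- Jacobi's formula for the determinant turns the covariance equation into the continuity equation
for the Gaussian densities. -/
theorem hasDerivAt_gaussianDensity {S : ℝ → Mat d} {A : Mat d} {t : ℝ} (hSp : (S t).PosDef)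
    (hS : HasDerivAt S (-(A * S t + S t * Aᵀ)) t) (x : Rd d) :
    HasDerivAt (fun s => gaussianDensity (S s) x)
      (divergence (fun y => gaussianDensity (S t) y • lin A y) x) t := by
  have hdet := hSp.det_pos
  have hu : IsUnit (S t).det := isUnit_iff_ne_zero.2 hdet.ne'
  have hpos : 0 < (2 * Real.pi) ^ d * (S t).det := by positivity
  obtain ⟨F, hF⟩ : ∃ F : Mat d →L[ℝ] ℝ, ∀ X, F X = inner ℝ x (lin X x) :=
    ⟨LinearMap.toContinuousLinearMap
      { toFun := fun X => inner ℝ x (lin X x)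
        map_add' := fun X Y => by rw [lin_add_apply, inner_add_right]
        map_smul' := fun r X => by rw [lin_smul_apply, inner_smul_right]; rfl }, fun X => rfl⟩
  have h1 : HasDerivAt (fun s => (2 * Real.pi) ^ d * (S s).det)
      ((2 * Real.pi) ^ d * ((S t).det * (-2 * A.trace))) t := by
    refine ((hasDerivAt_det hS hdet.ne').const_mul _).congr_deriv ?_
    have e : ((S t)⁻¹ * -(A * S t + S t * Aᵀ)).trace = -2 * A.trace := by
      rw [mul_neg, mul_add, Matrix.trace_neg, Matrix.trace_add, Matrix.trace_mul_comm, mul_assoc,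
        Matrix.mul_nonsing_inv _ hu, mul_one, ← mul_assoc, Matrix.nonsing_inv_mul _ hu, one_mul,
        Matrix.trace_transpose]
      ring
    rw [e]
  have h2 := (h1.sqrt hpos.ne').fun_inv (Real.sqrt_pos.2 hpos).ne'
  have h3 : HasDerivAt (fun s => inner ℝ x (lin (S s)⁻¹ x))
      (2 * inner ℝ (lin (S t)⁻¹ x) (lin A x)) t := by
    have h4 := F.hasFDerivAt.comp_hasDerivAt t (hasDerivAt_matrix_inv hS hdet.ne')
    have h5 : (F ∘ fun s => (S s)⁻¹) = fun s => inner ℝ x (lin (S s)⁻¹ x) := funext fun s => hF _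
    rw [h5] at h4
    refine h4.congr_deriv ?_
    have e : -((S t)⁻¹ * -(A * S t + S t * Aᵀ) * (S t)⁻¹) = (S t)⁻¹ * A + Aᵀ * (S t)⁻¹ := by
      rw [mul_neg, neg_mul, neg_neg, mul_add, add_mul, mul_assoc, mul_assoc,
        Matrix.mul_nonsing_inv _ hu, mul_one, ← mul_assoc (S t)⁻¹ (S t),
        Matrix.nonsing_inv_mul _ hu, one_mul]
    have e2 : inner ℝ (lin (S t)⁻¹ x) (lin A x) = inner ℝ x (lin ((S t)⁻¹ * A) x) := by
      rw [inner_lin_left, symm_of_posSemidef hSp.inv.posSemidef, lin_mul_apply]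
    have e3 : inner ℝ x (lin (Aᵀ * (S t)⁻¹) x) = inner ℝ (lin (S t)⁻¹ x) (lin A x) := by
      rw [lin_mul_apply, ← inner_lin_left, real_inner_comm]
    rw [hF, e, lin_add_apply, inner_add_right, e3, e2]
    ring
  have h6 := h2.fun_mul ((h3.fun_neg.div_const 2).exp)
  rw [divergence_gaussianDensity_smul hSp]
  simp_rw [gaussianDensity_eq]
  refine h6.congr_deriv ?_
  have hs : √((2 * Real.pi) ^ d * (S t).det) ^ 2 = (2 * Real.pi) ^ d * (S t).det :=
    Real.sq_sqrt hpos.le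
  have hs0 : √((2 * Real.pi) ^ d * (S t).det) ≠ 0 := (Real.sqrt_pos.2 hpos).ne'
  rw [← mul_assoc ((2 * Real.pi) ^ d)]
  generalize √((2 * Real.pi) ^ d * (S t).det) = r at hs hs0 ⊢
  rw [← hs]
  field_simp
  ring

section Moments

variable {S : Mat d}

theorem kernelize_lin_gaussian (hS : S.PosSemidef) (A : Mat d) (x : Rd d) :
    kernelize (shiftKernel 0) (multivariateGaussian 0 S) (fun y => lin A y) x = lin (A * S) x := by
  have hcov : covMatrix (multivariateGaussian 0 S) = S := by
    rw [covMatrix, secondMoment_gaussian hS, integral_id_multivariateGaussian, outer,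
      WithLp.ofLp_zero, Matrix.zero_vecMulVec, sub_zero]
  have h1 := integral_shiftKernel_smul (integrable_norm_sq_gaussian S) A x 0 0
  rw [hcov, integral_id_multivariateGaussian] at h1
  simp only [sub_zero, add_zero, smul_zero] at h1
  exact h1

theorem isKernelizable_lin_gaussian (A : Mat d) :
    IsKernelizable (shiftKernel 0) (multivariateGaussian 0 S) fun y => lin A y := fun x => by
  have h1 := integrable_shiftKernel_smul (integrable_norm_sq_gaussian S) A x 0 0
  simpa using h1

/-- The relative score of `N(0, S)` with respect to `N(0, Q)` is the linear field `Q⁻¹ - S⁻¹`, and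
the kernelization operator multiplies linear fields by `S` from the right. -/
theorem isRegularizedInverse_gaussian {ν : ℝ} (hν₀ : 0 < ν) (hν₁ : ν ≤ 1) {Q : Mat d}
    (hS : S.PosDef) : IsRegularizedInverse ν (shiftKernel 0) (multivariateGaussian 0 S)
      (kernelize (shiftKernel 0) (multivariateGaussian 0 S) fun y => lin (Q⁻¹ - S⁻¹) y)
      fun y => lin (drift ν Q S) y where
  memLp := (lin (drift ν Q S)).comp_memLp'
      (IsGaussian.memLp_two_id (μ := multivariateGaussian (0 : Rd d) S))
  kernelizable := isKernelizable_lin_gaussian _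
  eq x := by
    rw [kernelize_lin_gaussian hS.posSemidef, kernelize_lin_gaussian hS.posSemidef,
      ← lin_smul_apply, ← lin_smul_apply, ← lin_add_apply]
    congr 2
    have h1 : drift ν Q S * regMatrix ν S = Q⁻¹ * S - 1 := by
      rw [drift, mul_assoc, Matrix.nonsing_inv_mul _
        (isUnit_iff_ne_zero.2 (regMatrix_det_ne_zero hν₀ hν₁ hS.posSemidef)), mul_one]
    rw [sub_mul, Matrix.nonsing_inv_mul _ (isUnit_iff_ne_zero.2 hS.det_pos.ne'), ← h1, regMatrix,
      mul_add, mul_smul_comm, mul_smul_comm, mul_one]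

end Moments

/-- The laws are images of one Gaussian under a continuous family of linear maps, so that dominated
convergence applies. -/
theorem isCurve_gaussian {Q S₀ : Mat d} (hQ : Q.PosDef) (hS₀ : S₀.PosSemidef) {Φ : ℝ → Mat d}
    (hΦ : Continuous Φ) : IsCurve (potential (gaussianDensity Q))
      fun t => multivariateGaussian 0 (Φ t * S₀ * (Φ t)ᵀ) := by
  refine isCurve_of_quadratic hQ (fun t _ => inferInstance)
    (fun t _ => integrable_norm_sq_gaussian _) fun f hf C hC => ?_
  have h1 : (fun t => ∫ x, f x ∂(multivariateGaussian 0 (Φ t * S₀ * (Φ t)ᵀ))) =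
      fun t => ∫ x, f (lin (Φ t) x) ∂(multivariateGaussian 0 S₀) := by
    ext t
    rw [← map_lin_multivariateGaussian hS₀, integral_map (by fun_prop)
      hf.aestronglyMeasurable]
  rw [h1]
  refine Continuous.continuousOn (continuous_iff_continuousAt.2 fun t => ?_)
  refine continuousAt_of_dominated
    (bound := fun x => |C| * (1 + (‖Φ t‖ + 1) ^ 2 * ‖x‖ ^ 2))
    (Eventually.of_forall fun s => (hf.comp (lin (Φ s)).continuous).aestronglyMeasurable)
    ?_ ?_ (Eventually.of_forall fun x => ?_)
  · filter_upwards [hΦ.norm.continuousAt.eventually_lt_const (lt_add_one ‖Φ t‖)] with s hs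
    refine Eventually.of_forall fun x => (hC _).trans ?_
    have h2 : ‖lin (Φ s) x‖ ≤ (‖Φ t‖ + 1) * ‖x‖ :=
      (norm_lin_apply_le _ _).trans (mul_le_mul_of_nonneg_right hs.le (norm_nonneg x))
    rw [← mul_pow]
    gcongr
    exact le_abs_self C
  · exact ((integrable_const _).add ((integrable_norm_sq_gaussian S₀).const_mul _)).const_mul _
  · have h3 : Continuous fun s => lin (Φ s) x :=
      continuousOn_univ.1 (continuousOn_lin_apply hΦ.continuousOn continuousOn_const)
    exact (hf.comp h3).continuousAt

theorem isClassicalSolution_gaussian {K : Measure (Rd d) → Rd d → Rd d → ℝ} {ν : ℝ}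
    (hν₀ : 0 < ν) (hν₁ : ν ≤ 1) {Q S₀ : Mat d} (hQ : Q.PosDef) (hS₀ : S₀.PosDef)
    (hK : K = bilinearKernel ∨ K = affineInvariantKernel) {Φ : ℝ → Mat d}
    (hΦ : ContDiff ℝ 1 Φ) (hdet : ∀ t, (Φ t).det ≠ 0)
    (hS : ∀ t, 0 ≤ t → HasDerivAt (fun s => Φ s * S₀ * (Φ s)ᵀ)
      (covarianceField ν Q (Φ t * S₀ * (Φ t)ᵀ)) t) :
    IsClassicalSolution K ν (gaussianDensity Q) fun t => gaussianDensity (Φ t * S₀ * (Φ t)ᵀ) := by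
  have hSp : ∀ t, (Φ t * S₀ * (Φ t)ᵀ).PosDef := fun t => conj_posDef hS₀ (hdet t)
  have hSc : ContDiff ℝ 1 fun t => Φ t * S₀ * (Φ t)ᵀ :=
    (hΦ.mul contDiff_const).mul (contDiff_transpose.comp hΦ)
  have hlaw : ∀ t, densityMeasure (gaussianDensity (Φ t * S₀ * (Φ t)ᵀ)) =
      multivariateGaussian 0 (Φ t * S₀ * (Φ t)ᵀ) := fun t =>
    (multivariateGaussian_eq_densityMeasure (hSp t)).symm
  have hKg : ∀ S : Mat d, K (multivariateGaussian 0 S) = shiftKernel 0 := fun S => by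
    rcases hK with rfl | rfl
    · exact bilinearKernel_eq _
    · rw [affineInvariantKernel_eq, integral_id_multivariateGaussian]
  have hscore : ∀ t, relativeScore (gaussianDensity (Φ t * S₀ * (Φ t)ᵀ)) (gaussianDensity Q) =
      fun y => lin (Q⁻¹ - (Φ t * S₀ * (Φ t)ᵀ)⁻¹) y := fun t =>
    funext (relativeScore_gaussianDensity (hSp t) hQ)
  refine ⟨fun t _ => contDiff_gaussianDensity _, fun t _ => gaussianDensity_pos (hSp t), ?_,
    (contDiff_gaussianDensity_path hSc hSp).contDiffOn, fun t _ => ?_,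
    fun t y => lin (drift ν Q (Φ t * S₀ * (Φ t)ᵀ)) y, fun t ht => ⟨?_, ?_, fun x => ?_⟩⟩
  · simp_rw [hlaw]
    exact isCurve_gaussian hQ hS₀.posSemidef hΦ.continuous
  · rw [hlaw, hKg, hscore]
    exact isKernelizable_lin_gaussian _
  · rw [hlaw, hKg, hscore]
    exact isRegularizedInverse_gaussian hν₀ hν₁ (hSp t)
  · exact ((contDiff_gaussianDensity (n := 1) _).differentiable one_ne_zero).smul
      (lin _).differentiable
  · refine (hasDerivAt_gaussianDensity (S := fun s => Φ s * S₀ * (Φ s)ᵀ) (hSp t) ?_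
      x).hasDerivWithinAt
    rw [← covarianceField_eq hν₀ hν₁ hQ (hSp t).posSemidef]
    exact hS t ht

/-- The flow of the covariance dynamics turns into the covariance equation. -/
theorem hasDerivAt_conj {ν : ℝ} (hν₀ : 0 < ν) (hν₁ : ν ≤ 1) {Q S₀ : Mat d} (hQ : Q.PosDef)
    (hS₀ : S₀.PosSemidef) {Φ : ℝ → Mat d} {t : ℝ}
    (hΦ : HasDerivAt Φ (-(drift ν Q (Φ t * S₀ * (Φ t)ᵀ) * Φ t)) t) :
    HasDerivAt (fun s => Φ s * S₀ * (Φ s)ᵀ) (covarianceField ν Q (Φ t * S₀ * (Φ t)ᵀ)) t := by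
  refine ((hΦ.mul_const S₀).mul (hasDerivAt_transpose hΦ)).congr_deriv ?_
  rw [covarianceField_eq hν₀ hν₁ hQ (conj_posSemidef hS₀ _), Matrix.transpose_neg,
    Matrix.transpose_mul]
  noncomm_ring

end RSVGD

end

theorem mainTheorem9 {d : ℕ} (ν : ℝ) (hν₀ : 0 < ν) (hν₁ : ν ≤ 1)
    (K : Measure (RSVGD.Rd d) → RSVGD.Rd d → RSVGD.Rd d → ℝ)
    (hK : K = RSVGD.bilinearKernel ∨ K = RSVGD.affineInvariantKernel)
    (S₀ Q : Matrix (Fin d) (Fin d) ℝ) (hS₀ : S₀.PosDef) (hQ : Q.PosDef) :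
    ∃ S : ℝ → Matrix (Fin d) (Fin d) ℝ,
      -- the covariance curve
      S 0 = S₀ ∧
      (∀ t, 0 ≤ t → (S t).PosDef) ∧
      (∀ t, 0 ≤ t → HasDerivWithinAt S (RSVGD.covarianceField ν Q (S t)) (Ici 0) t) ∧
      -- the densities of `N(0, S t)` solve regularized SVGD, classically and weakly
      (∀ t, 0 ≤ t → multivariateGaussian 0 (S t)
        = RSVGD.densityMeasure (RSVGD.gaussianDensity (S t))) ∧
      RSVGD.IsClassicalSolution K ν (RSVGD.gaussianDensity Q)
        (fun t => RSVGD.gaussianDensity (S t)) ∧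
      RSVGD.IsWeakSolution K ν (RSVGD.potential (RSVGD.gaussianDensity Q))
        (fun t => multivariateGaussian 0 (S t)) ∧
      -- it is the only solution with this initial value, in the classical and in the weak sense
      (∀ ρ : ℝ → RSVGD.Rd d → ℝ, RSVGD.IsClassicalSolution K ν (RSVGD.gaussianDensity Q) ρ →
        ρ 0 = RSVGD.gaussianDensity S₀ → ∀ t, 0 ≤ t → ρ t = RSVGD.gaussianDensity (S t)) ∧
      (∀ μ : ℝ → Measure (RSVGD.Rd d),
        RSVGD.IsWeakSolution K ν (RSVGD.potential (RSVGD.gaussianDensity Q)) μ →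
        μ 0 = multivariateGaussian 0 S₀ → ∀ t, 0 ≤ t → μ t = multivariateGaussian 0 (S t)) ∧
      -- convergence to the target
      Tendsto (fun t => RSVGD.gaussianLaw (S t)) atTop (𝓝 (RSVGD.gaussianLaw Q)) ∧
      Tendsto S atTop (𝓝 Q) ∧
      -- rate in the spectral norm in the commuting case
      (S₀ * Q = Q * S₀ → ∀ lam : ℝ,
        IsGreatest {l : ℝ | Module.End.HasEigenvalue (Matrix.toLin' Q) l} lam →
        (fun t => ‖S t - Q‖) =O[atTop]
          (fun t => Real.exp (-2 * t / ((1 - ν) * lam + ν)))) := by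
  obtain ⟨Φ, hΦ0, hΦc, hdet, hΦ⟩ := RSVGD.exists_flow hν₀ hν₁ hQ hS₀
  have hS : ∀ t, 0 ≤ t → HasDerivAt (fun s => Φ s * S₀ * (Φ s)ᵀ)
      (RSVGD.covarianceField ν Q (Φ t * S₀ * (Φ t)ᵀ)) t := fun t ht =>
    RSVGD.hasDerivAt_conj hν₀ hν₁ hQ hS₀.posSemidef (hΦ t ht)
  have hSp : ∀ t, (Φ t * S₀ * (Φ t)ᵀ).PosDef := fun t => RSVGD.conj_posDef hS₀ (hdet t)
  have h0 : Φ 0 * S₀ * (Φ 0)ᵀ = S₀ := by simp [hΦ0]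
  have hlaw := fun t => RSVGD.multivariateGaussian_eq_densityMeasure (hSp t)
  have hcl := RSVGD.isClassicalSolution_gaussian hν₀ hν₁ hQ hS₀ hK hΦc hdet hS
  have hlim : Tendsto (fun t => Φ t * S₀ * (Φ t)ᵀ) atTop (𝓝 Q) :=
    RSVGD.tendsto_covariance hν₀ hν₁ hQ (fun t _ => hSp t) hS
  refine ⟨fun t => Φ t * S₀ * (Φ t)ᵀ, h0, fun t _ => hSp t,
    fun t ht => (hS t ht).hasDerivWithinAt, fun t _ => hlaw t, hcl, ?_, fun ρ hρ hρ0 t ht => ?_,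
    fun μ hμ hμ0 t ht => hμ.eq_gaussian hν₀ hν₁ hQ hS₀ hK hμ0 hΦ0 hdet hΦ hS ht,
    RSVGD.tendsto_gaussianLaw hQ (fun t _ => hSp t) hlim, hlim, fun hcomm lam hlam => ?_⟩
  · simp_rw [hlaw]
    exact hcl.isWeakSolution hν₀ hν₁ hQ hK
  · have h1 := (hρ.isWeakSolution hν₀ hν₁ hQ hK).eq_gaussian hν₀ hν₁ hQ hS₀ hK (by
      simp only [hρ0]
      exact (RSVGD.multivariateGaussian_eq_densityMeasure hS₀).symm) hΦ0 hdet hΦ hS ht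
    have := hρ.curve.prob t ht
    rw [hlaw] at h1
    exact RSVGD.eq_of_densityMeasure_eq (hρ.smooth t ht).continuous
      (RSVGD.continuous_gaussianDensity _) (fun x => (hρ.pos t ht x).le)
      (fun x => (RSVGD.gaussianDensity_pos (hSp t) x).le) h1
  · exact RSVGD.isBigO_of_commute hν₀ hν₁ hQ (fun t _ => hSp t) hS
      (by simp only [h0]; exact hcomm) hlam
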